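/- Let $L>0$ and $\mu>0$. Let $\mathcal G\subset\mathbb R^2$ be the ladder graph with vertices $M_j^{\pm}=(j,\pm L/2)$, $j\in\mathbb Z$, and edges $e_j=\{j\}\times(-L/2,L/2)$ (the rungs) and $e^{\pm}_{j+1/2}=(j,j+1)\times\{\pm L/2\}$, $j\in\mathbb Z$. Let $w^\mu(e_0)=\mu$ and $w^\mu(e)=1$ for every other edge $e$. Let $L_2^\mu(\mathcal G)$ be the Hilbert space of complex functions $u=(u_e)_e$ on $\mathcal G$ with $\|u\|^2=\sum_e w^\mu(e)\|u_e\|^2_{L_2(e)}<\infty$. Let $\mathcal A^\mu$ be the self-adjoint operator in $L_2^\mu(\mathcal G)$ given by $(\mathcal A^\mu u)_e=-u_e''$ on every edge $e$, whose domain consists of all $u\in L_2^\mu(\mathcal G)$ that are continuous on $\mathcal G$, belong to $H^2(e)$ for every edge $e$ with $\sum_e\|u\|^2_{H^2(e)}<\infty$, and satisfy at every vertex $M$ the Kirchhoff condition $\sum_{e\ni M}w^\mu(e)\,u_e'(M)=0$, where $u_e'(M)$ is the derivative at $M$ in the outgoing direction. Let $\mathcal A_a^\mu$ be the restriction of $\mathcal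 A^\mu$ to the closed subspace $L_{2,a}^\mu(\mathcal G)$ of functions with $u(x,y)=-u(x,-y)$. The discrete spectrum of $\mathcal A_a^\mu$ is the set of isolated points of its spectrum that are eigenvalues of finite multiplicity. The essential spectrum is the set of all $\lambda$ for which there are $u_n$ in the domain with $\inf_n\|u_n\|>0$, $u_n\rightharpoonup0$ weakly and $\mathcal A_a^\mu u_n-\lambda u_n\to0$. A gap of $\mathcal A_a^\mu$ is a connected component of the complement in $\mathbb R$ of the essential spectrum (including the unbounded component below the essential spectrum). Then: 1. If $\mu\ge1$, the discrete spectrum of $\mathcal A_a^\mu$ is empty. 2. If $0<\mu<1$, every gap of $\mathcal A_a^\mu$ contains exactly one or exactly two eigenvalues of $\mathcal A_a^\mu$, and each of these eigenvalues is simple. -/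

import Mathlib

open MeasureTheory Set Filter Topology
open scoped ENNReal

noncomputable section

/-! ### Spectral notions for an unbounded operator on an inner product space -/

namespace LinearPMap

variable {H : Type*} [NormedAddCommGroup H] [InnerProductSpace ℂ H]

/-- The resolvent set: those `z` for which `A - z : D(A) → H` is a bijection whose inverse `R` is a
bounded operator on `H`. -/
def resolventSetPMap (A : H →ₗ.[ℂ] H) : Set ℂ :=
  {z | ∃ R : H →L[ℂ] H,
    (∀ x : H, ∃ y : A.domain, (y : H) = R x ∧ A y - z • (y : H) = x) ∧
    ∀ y : A.domain, R (A y - z • (y : H)) = y}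

/-- The spectrum: the complement of the resolvent set. -/
def spectrumPMap (A : H →ₗ.[ℂ] H) : Set ℂ := (resolventSetPMap A)ᶜ

/-- The eigenspace `{u ∈ D(A) : A u = z u}`. -/
def eigenspacePMap (A : H →ₗ.[ℂ] H) (z : ℂ) : Submodule ℂ H :=
  A.graph.comap (LinearMap.id.prod (z • LinearMap.id))

/-- `z` is an eigenvalue: `A u = z u` for some nonzero `u ∈ D(A)`. -/
def IsEigenvaluePMap (A : H →ₗ.[ℂ] H) (z : ℂ) : Prop :=
  ∃ u : A.domain, (u : H) ≠ 0 ∧ A u = z • (u : H)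

/-- The discrete spectrum: eigenvalues of finite multiplicity that are isolated points of the
spectrum. -/
def discreteSpectrumPMap (A : H →ₗ.[ℂ] H) : Set ℂ :=
  {z | IsEigenvaluePMap A z ∧ FiniteDimensional ℂ (eigenspacePMap A z) ∧
    ¬ AccPt z (𝓟 (spectrumPMap A))}

/-- `u` is a singular (Weyl) sequence of `A` at `z`: `u n ∈ D(A)`, the norms are bounded away from
zero, `u n ⇀ 0` weakly and `A (u n) - z u n → 0`. -/
def IsSingularSequence (A : H →ₗ.[ℂ] H) (z : ℂ) (u : ℕ → A.domain) : Prop :=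
  (∃ c : ℝ, 0 < c ∧ ∀ n, c ≤ ‖(u n : H)‖) ∧
  (∀ v : H, Tendsto (fun n => inner ℂ v (u n : H)) atTop (𝓝 0)) ∧
  Tendsto (fun n => A (u n) - z • (u n : H)) atTop (𝓝 0)

/-- The essential spectrum (of a self-adjoint operator): the points that admit a singular
sequence. -/
def essentialSpectrumPMap (A : H →ₗ.[ℂ] H) : Set ℂ :=
  {z | ∃ u : ℕ → A.domain, IsSingularSequence A z u}

/-- A gap: a connected component of the real line with the essential spectrum removed. -/
def IsSpectralGap (A : H →ₗ.[ℂ] H) (I : Set ℝ) : Prop :=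
  ∃ x : ℝ, (x : ℂ) ∉ essentialSpectrumPMap A ∧
    I = connectedComponentIn {y : ℝ | (y : ℂ) ∉ essentialSpectrumPMap A} x

end LinearPMap

/-! ### Functions of class `H²` on an interval -/

namespace LadderGraph

/-- `u ∈ H²(a, b)` with first derivative `u'` and second derivative `u''`, where `u` and `u'` are
the continuous representatives on `[a, b]`: they are absolutely continuous, and `u'' ∈ L²(a, b)`. -/
structure IsH2On (a b : ℝ) (u u' u'' : ℝ → ℂ) : Prop where
  memLp : MemLp u'' 2 (volume.restrict (Ioo a b))
  eq_deriv : ∀ x ∈ Icc a b, u' x = u' a + ∫ t in a..x, u'' t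
  eq_self : ∀ x ∈ Icc a b, u x = u a + ∫ t in a..x, u' t

theorem IsH2On.intervalIntegrable_snd {a b : ℝ} {u u' u'' : ℝ → ℂ} (h : IsH2On a b u u' u'')
    {x : ℝ} (hx : x ∈ Icc a b) : IntervalIntegrable u'' volume a x := by
  have h1 : IntegrableOn u'' (Ioo a b) := h.memLp.integrable (by norm_num)
  have h2 : IntegrableOn u'' (Ioc a b) := by rwa [integrableOn_Ioc_iff_integrableOn_Ioo]
  rw [intervalIntegrable_iff_integrableOn_Ioc_of_le hx.1]
  exact h2.mono_set (Ioc_subset_Ioc_right hx.2)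

theorem IsH2On.continuousOn_fst {a b : ℝ} {u u' u'' : ℝ → ℂ} (h : IsH2On a b u u' u'') :
    ContinuousOn u' (Icc a b) := by
  rcases lt_or_ge b a with hab | hab
  · simp [Icc_eq_empty (not_le.2 hab)]
  have h1 : ContinuousOn (fun x => ∫ t in a..x, u'' t) (uIcc a b) :=
    intervalIntegral.continuousOn_primitive_interval'
      (h.intervalIntegrable_snd (right_mem_Icc.2 hab)) left_mem_uIcc
  rw [uIcc_of_le hab] at h1
  exact (continuousOn_const.add h1).congr h.eq_deriv

theorem IsH2On.intervalIntegrable_fst {a b : ℝ} {u u' u'' : ℝ → ℂ} (h : IsH2On a b u u' u'')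
    {x : ℝ} (hx : x ∈ Icc a b) : IntervalIntegrable u' volume a x :=
  ContinuousOn.intervalIntegrable_of_Icc hx.1
    (h.continuousOn_fst.mono (Icc_subset_Icc_right hx.2))

theorem IsH2On.zero (a b : ℝ) : IsH2On a b 0 0 0 :=
  ⟨MemLp.zero, by simp, by simp⟩

theorem IsH2On.add {a b : ℝ} {u u' u'' v v' v'' : ℝ → ℂ} (hu : IsH2On a b u u' u'')
    (hv : IsH2On a b v v' v'') : IsH2On a b (u + v) (u' + v') (u'' + v'') where
  memLp := hu.memLp.add hv.memLp
  eq_deriv x hx := by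
    simp only [Pi.add_apply]
    rw [intervalIntegral.integral_add (hu.intervalIntegrable_snd hx) (hv.intervalIntegrable_snd hx),
      hu.eq_deriv x hx, hv.eq_deriv x hx]
    ring
  eq_self x hx := by
    simp only [Pi.add_apply]
    rw [intervalIntegral.integral_add (hu.intervalIntegrable_fst hx) (hv.intervalIntegrable_fst hx),
      hu.eq_self x hx, hv.eq_self x hx]
    ring

theorem IsH2On.smul {a b : ℝ} {u u' u'' : ℝ → ℂ} (c : ℂ) (hu : IsH2On a b u u' u'') :
    IsH2On a b (c • u) (c • u') (c • u'') where
  memLp := hu.memLp.const_smul c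
  eq_deriv x hx := by
    simp only [Pi.smul_apply, smul_eq_mul]
    rw [intervalIntegral.integral_const_mul, hu.eq_deriv x hx]
    ring
  eq_self x hx := by
    simp only [Pi.smul_apply, smul_eq_mul]
    rw [intervalIntegral.integral_const_mul, hu.eq_self x hx]
    ring

theorem ae_eq_zero_of_primitive_eq_zero {a b : ℝ} {f : ℝ → ℂ} (hab : a ≤ b)
    (hf : IntervalIntegrable f volume a b) (h : ∀ x ∈ Icc a b, ∫ t in a..x, f t = 0) :
    ∀ᵐ x ∂(volume.restrict (Ioo a b)), f x = 0 := by
  rw [ae_restrict_iff' measurableSet_Ioo]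
  filter_upwards [hf.ae_hasDerivAt_integral] with x hx hxI
  have hx' : x ∈ uIcc a b := by rw [uIcc_of_le hab]; exact Ioo_subset_Icc_self hxI
  have h1 := hx hx' a left_mem_uIcc
  have h2 : (fun y => ∫ t in a..y, f t) =ᶠ[𝓝 x] fun _ => 0 := by
    filter_upwards [Ioo_mem_nhds hxI.1 hxI.2] with y hy
    exact h y (Ioo_subset_Icc_self hy)
  exact h1.unique ((hasDerivAt_const x (0 : ℂ)).congr_of_eventuallyEq h2)

theorem IsH2On.snd_ae_eq_zero {a b : ℝ} {u u' u'' : ℝ → ℂ} (h : IsH2On a b u u' u'')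
    (hu : ∀ᵐ x ∂(volume.restrict (Ioo a b)), u x = 0) :
    ∀ᵐ x ∂(volume.restrict (Ioo a b)), u'' x = 0 := by
  rcases le_or_gt b a with hab | hab
  · simp [Ioo_eq_empty (not_lt.2 hab)]
  have hb : b ∈ Icc a b := right_mem_Icc.2 hab.le
  have h1 : ContinuousOn (fun x => ∫ t in a..x, u' t) (Icc a b) := by
    have := intervalIntegral.continuousOn_primitive_interval' (h.intervalIntegrable_fst hb)
      left_mem_uIcc
    rwa [uIcc_of_le hab.le] at this
  have hcu : ContinuousOn u (Icc a b) := (continuousOn_const.add h1).congr h.eq_self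
  have hu0 : EqOn u 0 (Icc a b) := by
    refine Measure.eqOn_Icc_of_ae_eq volume hab.ne ?_ hcu continuousOn_const
    rw [← restrict_Ioo_eq_restrict_Icc]
    exact hu
  have hp1 : ∀ x ∈ Icc a b, ∫ t in a..x, u' t = 0 := by
    intro x hx
    have h3 := h.eq_self x hx
    rw [hu0 hx, hu0 (left_mem_Icc.2 hab.le)] at h3
    simpa using h3.symm
  have hu' : EqOn u' 0 (Icc a b) := by
    refine Measure.eqOn_Icc_of_ae_eq volume hab.ne ?_ h.continuousOn_fst continuousOn_const
    rw [← restrict_Ioo_eq_restrict_Icc]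
    exact ae_eq_zero_of_primitive_eq_zero hab.le (h.intervalIntegrable_fst hb) hp1
  refine ae_eq_zero_of_primitive_eq_zero hab.le (h.intervalIntegrable_snd hb) ?_
  intro x hx
  have h3 := h.eq_deriv x hx
  rw [hu' hx, hu' (left_mem_Icc.2 hab.le)] at h3
  simpa using h3.symm

/-! ### The ladder graph -/

/-- The two sides `y = L / 2` and `y = -L / 2` of the ladder. -/
inductive Side : Type
  | upper
  | lower

/-- `+1` on the upper side, `-1` on the lower side. -/
def Side.sign : Side → ℝ
  | .upper => 1
  | .lower => -1

/-- The edges: the rung `e_j = {j} × (-L/2, L/2)`, parametrised by `y`, and the horizontal edge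
`e^±_{j+1/2} = (j, j+1) × {±L/2}`, parametrised by `x`. -/
inductive Edge : Type
  | rung (j : ℤ)
  | rail (s : Side) (j : ℤ)

/-- Left end of the parameter interval of an edge. -/
def Edge.lo (L : ℝ) : Edge → ℝ
  | .rung _ => -L / 2
  | .rail _ j => j

/-- Right end of the parameter interval of an edge. -/
def Edge.hi (L : ℝ) : Edge → ℝ
  | .rung _ => L / 2
  | .rail _ j => j + 1

/-- The weight: `μ` on the rung `e_0` and `1` on every other edge. -/
def weight (μ : ℝ) : Edge → ℝ
  | .rung j => if j = 0 then μ else 1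
  | .rail _ _ => 1

/-- Lebesgue measure on an edge, multiplied by the weight of the edge. -/
def edgeMeasure (L μ : ℝ) (e : Edge) : Measure ℝ :=
  ENNReal.ofReal (weight μ e) • volume.restrict (Ioo (e.lo L) (e.hi L))

/-- `L_2^μ(G)`: families `u_e ∈ L_2(e)` with `∑_e w^μ(e) ‖u_e‖² < ∞`. -/
abbrev L2Graph (L μ : ℝ) : Type :=
  lp (fun e : Edge => Lp ℂ 2 (edgeMeasure L μ e)) 2

/-- The family `u`, `u'`, `u''` of functions on the edges is edgewise `H²`, is continuous at the
vertices `M_j^±`, and satisfies there the Kirchhoff conditions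
`∑_{e ∈ E(M)} w^μ(e) u_e'(M) = 0`, the derivatives being taken in the outgoing direction. -/
structure IsKirchhoffFamily (L μ : ℝ) (u u' u'' : Edge → ℝ → ℂ) : Prop where
  isH2On : ∀ e, IsH2On (e.lo L) (e.hi L) (u e) (u' e) (u'' e)
  continuous_right : ∀ (s : Side) (j : ℤ),
    u (.rail s j) j = u (.rung j) (s.sign * (L / 2))
  continuous_left : ∀ (s : Side) (j : ℤ),
    u (.rail s (j - 1)) j = u (.rung j) (s.sign * (L / 2))
  kirchhoff : ∀ (s : Side) (j : ℤ),
    (weight μ (.rail s j) : ℂ) * u' (.rail s j) j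
      + (weight μ (.rail s (j - 1)) : ℂ) * (-u' (.rail s (j - 1)) j)
      + (weight μ (.rung j) : ℂ) * (-s.sign * u' (.rung j) (s.sign * (L / 2))) = 0

/-- The pairs `(u, f)` with `u ∈ D(A^μ)` and `f = A^μ u`, that is `f_e = -u_e''` on each edge:
`u ∈ H²(G)` (so that the families `u`, `u'`, `u''` all belong to `L_2(G)`; for `u'` this is the
existence of `d`, for `u''` it is that of `f`) satisfies the Kirchhoff conditions. -/
def operatorGraph (L μ : ℝ) : Submodule ℂ (L2Graph L μ × L2Graph L μ) where
  carrier := {p | ∃ u u' u'' : Edge → ℝ → ℂ, IsKirchhoffFamily L μ u u' u'' ∧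
    (∀ e, p.1 e =ᵐ[edgeMeasure L μ e] u e) ∧
    (∃ d : L2Graph L μ, ∀ e, d e =ᵐ[edgeMeasure L μ e] u' e) ∧
    (∀ e, p.2 e =ᵐ[edgeMeasure L μ e] -u'' e)}
  zero_mem' := by
    refine ⟨0, 0, 0, ⟨fun e => IsH2On.zero _ _, by simp, by simp, by simp⟩, fun e => ?_,
      ⟨0, fun e => ?_⟩, fun e => ?_⟩
    · simpa using Lp.coeFn_zero ℂ 2 (edgeMeasure L μ e)
    · simpa using Lp.coeFn_zero ℂ 2 (edgeMeasure L μ e)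
    · simpa using Lp.coeFn_zero ℂ 2 (edgeMeasure L μ e)
  add_mem' := by
    rintro p q ⟨u, u', u'', hu, hpu, ⟨d, hd⟩, hpf⟩ ⟨v, v', v'', hv, hqv, ⟨d₂, hd₂⟩, hqf⟩
    refine ⟨u + v, u' + v', u'' + v'', ⟨fun e => (hu.isH2On e).add (hv.isH2On e), ?_, ?_, ?_⟩,
      fun e => ?_, ⟨d + d₂, fun e => ?_⟩, fun e => ?_⟩
    · intro s j
      simp only [Pi.add_apply, hu.continuous_right s j, hv.continuous_right s j]
    · intro s j
      simp only [Pi.add_apply, hu.continuous_left s j, hv.continuous_left s j]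
    · intro s j
      simp only [Pi.add_apply]
      linear_combination hu.kirchhoff s j + hv.kirchhoff s j
    · filter_upwards [Lp.coeFn_add (p.1 e) (q.1 e), hpu e, hqv e] with x h1 h2 h3
      simp only [Prod.fst_add, lp.coeFn_add, Pi.add_apply] at h1 ⊢
      rw [h1, h2, h3]
    · filter_upwards [Lp.coeFn_add (d e) (d₂ e), hd e, hd₂ e] with x h1 h2 h3
      simp only [lp.coeFn_add, Pi.add_apply] at h1 ⊢
      rw [h1, h2, h3]
    · filter_upwards [Lp.coeFn_add (p.2 e) (q.2 e), hpf e, hqf e] with x h1 h2 h3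
      simp only [Prod.snd_add, lp.coeFn_add, Pi.add_apply, Pi.neg_apply] at h1 h2 h3 ⊢
      rw [h1, h2, h3]
      ring
  smul_mem' := by
    rintro c p ⟨u, u', u'', hu, hpu, ⟨d, hd⟩, hpf⟩
    refine ⟨c • u, c • u', c • u'', ⟨fun e => (hu.isH2On e).smul c, ?_, ?_, ?_⟩,
      fun e => ?_, ⟨c • d, fun e => ?_⟩, fun e => ?_⟩
    · intro s j
      simp only [Pi.smul_apply, hu.continuous_right s j]
    · intro s j
      simp only [Pi.smul_apply, hu.continuous_left s j]
    · intro s j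
      simp only [Pi.smul_apply, smul_eq_mul]
      linear_combination c * hu.kirchhoff s j
    · filter_upwards [Lp.coeFn_smul c (p.1 e), hpu e] with x h1 h2
      simp only [Prod.smul_fst, lp.coeFn_smul, Pi.smul_apply] at h1 ⊢
      rw [h1, h2]
    · filter_upwards [Lp.coeFn_smul c (d e), hd e] with x h1 h2
      simp only [lp.coeFn_smul, Pi.smul_apply] at h1 ⊢
      rw [h1, h2]
    · filter_upwards [Lp.coeFn_smul c (p.2 e), hpf e] with x h1 h2
      simp only [Prod.smul_snd, lp.coeFn_smul, Pi.smul_apply, Pi.neg_apply] at h1 h2 ⊢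
      rw [h1, h2]
      simp

theorem operatorGraph_single_valued (L μ : ℝ) :
    ∀ p ∈ operatorGraph L μ, p.1 = 0 → p.2 = 0 := by
  rintro p ⟨u, u', u'', hu, hpu, -, hpf⟩ hp
  ext1
  funext e
  refine Lp.ext ?_
  have h0 : (p.2 e : ℝ → ℂ) =ᵐ[edgeMeasure L μ e] 0 := by
    by_cases hc : ENNReal.ofReal (weight μ e) = 0
    · simp [edgeMeasure, hc, Filter.EventuallyEq]
    · have hu0 : ∀ᵐ x ∂(edgeMeasure L μ e), u e x = 0 := by
        have h1 := Lp.coeFn_zero ℂ 2 (edgeMeasure L μ e)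
        have h2 := hpu e
        rw [hp] at h2
        filter_upwards [h1, h2] with x hx1 hx2
        rw [← hx2]
        exact hx1
      have hu2 : ∀ᵐ x ∂(edgeMeasure L μ e), u'' e x = 0 :=
        (Measure.ae_ennreal_smul_measure_iff hc).2
          ((hu.isH2On e).snd_ae_eq_zero ((Measure.ae_ennreal_smul_measure_iff hc).1 hu0))
      filter_upwards [hu2, hpf e] with x hx1 hx2
      rw [hx2, Pi.neg_apply, hx1]
      simp
  exact h0.trans (Lp.coeFn_zero ℂ 2 (edgeMeasure L μ e)).symm

/-- The operator `A^μ` in `L_2^μ(G)`. -/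
def operator (L μ : ℝ) : L2Graph L μ →ₗ.[ℂ] L2Graph L μ :=
  (operatorGraph L μ).toLinearPMap

theorem operator_graph (L μ : ℝ) : (operator L μ).graph = operatorGraph L μ :=
  Submodule.toLinearPMap_graph_eq _ (operatorGraph_single_valued L μ)

theorem quasiMeasurePreserving_neg_rung (L μ : ℝ) (j : ℤ) :
    Measure.QuasiMeasurePreserving (fun y : ℝ => -y) (edgeMeasure L μ (.rung j))
      (edgeMeasure L μ (.rung j)) := by
  have h1 : MeasurePreserving (fun y : ℝ => -y) (volume.restrict (Ioo (-L / 2) (L / 2)))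
      (volume.restrict (Ioo (-L / 2) (L / 2))) := by
    have h2 := (Measure.measurePreserving_neg (volume : Measure ℝ)).restrict_preimage
      (measurableSet_Ioo (a := -L / 2) (b := L / 2))
    have h3 : (Neg.neg : ℝ → ℝ) ⁻¹' Ioo (-L / 2) (L / 2) = Ioo (-L / 2) (L / 2) := by
      ext x
      simp only [mem_preimage, mem_Ioo]
      constructor <;> rintro ⟨h, h'⟩ <;> constructor <;> linarith
    rw [h3] at h2
    exact h2
  exact (h1.smul_measure _).quasiMeasurePreserving

/-- `L_{2,a}^μ(G)`: the functions with `u(x, y) = -u(x, -y)`. -/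
def antisymmetric (L μ : ℝ) : Submodule ℂ (L2Graph L μ) where
  carrier := {u |
    (∀ j : ℤ, ∀ᵐ y ∂(edgeMeasure L μ (.rung j)), u (.rung j) y = -u (.rung j) (-y)) ∧
    (∀ j : ℤ, ∀ᵐ x ∂(edgeMeasure L μ (.rail .upper j)),
      u (.rail .upper j) x = -u (.rail .lower j) x)}
  zero_mem' := by
    have h0 : ∀ e, ∀ᵐ x ∂(edgeMeasure L μ e), (0 : L2Graph L μ) e x = 0 := fun e =>
      Lp.coeFn_zero ℂ 2 (edgeMeasure L μ e)
    refine ⟨fun j => ?_, fun j => ?_⟩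
    · filter_upwards [h0 (.rung j), (quasiMeasurePreserving_neg_rung L μ j).ae (h0 (.rung j))]
        with x h1 h2
      rw [h1, h2, neg_zero]
    · have h3 : ∀ᵐ x ∂(edgeMeasure L μ (.rail .upper j)),
          (0 : L2Graph L μ) (.rail .lower j) x = 0 := h0 (.rail .lower j)
      filter_upwards [h0 (.rail .upper j), h3] with x h1 h2
      rw [h1, h2, neg_zero]
  add_mem' := by
    rintro u v ⟨hu, hu'⟩ ⟨hv, hv'⟩
    have h0 : ∀ e, ∀ᵐ x ∂(edgeMeasure L μ e), (u + v) e x = u e x + v e x := fun e =>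
      Lp.coeFn_add (u e) (v e)
    refine ⟨fun j => ?_, fun j => ?_⟩
    · filter_upwards [h0 (.rung j), (quasiMeasurePreserving_neg_rung L μ j).ae (h0 (.rung j)),
        hu j, hv j] with x h1 h2 h3 h4
      rw [h1, h2, h3, h4, neg_add]
    · have h5 : ∀ᵐ x ∂(edgeMeasure L μ (.rail .upper j)),
          (u + v) (.rail .lower j) x = u (.rail .lower j) x + v (.rail .lower j) x :=
        h0 (.rail .lower j)
      filter_upwards [h0 (.rail .upper j), h5, hu' j, hv' j] with x h1 h2 h3 h4
      rw [h1, h2, h3, h4, neg_add]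
  smul_mem' := by
    rintro c u ⟨hu, hu'⟩
    have h0 : ∀ e, ∀ᵐ x ∂(edgeMeasure L μ e), (c • u) e x = c • u e x := fun e =>
      Lp.coeFn_smul c (u e)
    refine ⟨fun j => ?_, fun j => ?_⟩
    · filter_upwards [h0 (.rung j), (quasiMeasurePreserving_neg_rung L μ j).ae (h0 (.rung j)),
        hu j] with x h1 h2 h3
      rw [h1, h2, h3, smul_neg]
    · have h5 : ∀ᵐ x ∂(edgeMeasure L μ (.rail .upper j)),
          (c • u) (.rail .lower j) x = c • u (.rail .lower j) x := h0 (.rail .lower j)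
      filter_upwards [h0 (.rail .upper j), h5, hu' j] with x h1 h2 h3
      rw [h1, h2, h3, smul_neg]

/-- The operator `A_a^μ`: the part of `A^μ` in `L_{2,a}^μ(G)`, that is `A^μ` on those
`u ∈ D(A^μ) ∩ L_{2,a}^μ(G)` for which `A^μ u ∈ L_{2,a}^μ(G)`; the last condition is automatic by
the symmetry of the graph. -/
def antisymmetricOperator (L μ : ℝ) : antisymmetric L μ →ₗ.[ℂ] antisymmetric L μ :=
  ((operator L μ).graph.comap
    ((antisymmetric L μ).subtype.prodMap (antisymmetric L μ).subtype)).toLinearPMap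

theorem mem_antisymmetricOperator_graph (L μ : ℝ) (u f : antisymmetric L μ) :
    (u, f) ∈ (antisymmetricOperator L μ).graph ↔
      ((u : L2Graph L μ), (f : L2Graph L μ)) ∈ operatorGraph L μ := by
  rw [antisymmetricOperator, Submodule.toLinearPMap_graph_eq, operator_graph]
  · rfl
  · rintro ⟨v, g⟩ hp hv
    rw [operator_graph] at hp
    refine Subtype.ext (operatorGraph_single_valued L μ _ hp ?_)
    simpa using hv

end LadderGraph

end

/-! By oddness, a solution of `-u'' = l u` in the domain is determined by its slopes `b j` at the
centres of the rungs and its right slopes `d j` at the upper vertices. Write `s`, `c` for `sinSol l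
(L / 2)`, `cosSol l (L / 2)`, write `σ`, `C` for `sinSol l 1`, `cosSol l 1`, and `N = 2 C s + σ c`
for `discr L l`. Continuity and the Kirchhoff condition, after elimination of `d`, give the Jacobi
recurrence `s (b (j+1) + b (j-1)) = (2 C s + w j σ c) b j` with `w 0 = μ` and `w j = 1` otherwise.
Off `j = 0` the right-hand coefficient is `N`.

The essential spectrum is `|N| ≤ 2 |s|`. There the recurrence has Bloch solutions with multiplier
`|q| = 1`; cut off on longer and longer blocks away from rung `0`, they form a singular sequence
(`mem_essentialSpectrum_of_notMem`). If `|N| > 2 |s|`, the recurrence is diagonally dominant off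
rung `0`, and the operator is bounded below up to one functional `⟨v, U⟩` that reads off `b 0`
(`exists_resolvent_estimate`). Hence there is no singular sequence, and every eigenvalue is simple.

In a gap a square summable solution is `b j = r ^ |j| b 0` with `|r| < 1` and `s (r + r⁻¹) = N`, and
rung `0` adds `2 s r = 2 C s + μ σ c`. It follows that `2 s r⁻¹ = 2 C s + (2 - μ) σ c` and `4 s²
(r⁻² - r²) = 4 (1 - μ) σ c N`. Since `σ c N > 0` in every gap (`pos_of_mem_resolventRegion`), an
eigenvalue there requires `μ < 1`, and for `μ < 1` the only remaining condition is that the two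
expressions multiply to `4 s²` (`isEigenvalue_iff`). In a band an eigenfunction would have `|b j|`
or `|d j|` constant on a half ladder, which is impossible in `ℓ²`, unless `s = σ = 0`, when the
multiplicity is infinite. As eigenvalues are real, the discrete spectrum is empty for `μ ≥ 1`.

For `μ < 1` put `l = ω²`, `θ = ω L / 2`, `ν = μ (2 - μ) < 1` and `F_ν = cot ω - tan θ + (ν / 4) cot
θ`. Away from the poles, eigenvalues in gaps are the zeros of `F_ν`, and gaps are given by `tan θ ·
F_1 > 0`. Each `F_ν` decreases strictly between poles and vanishes between any two consecutive ones.
Comparing `F_ν` with `F_1` shows that a zero is reached without leaving the gap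
(`exists_root_of_mem`). A gap contains no pole except zeros of `sin θ`, where `tan θ` changes sign,
so it has at most one zero for each sign of `tan θ` (`not_lt_of_roots`). This leaves one or two
eigenvalues. -/

namespace LadderGraph

/-! ### The fundamental system of `-u'' = l u` -/

/-- The solution of `-u'' = l u` with `u 0 = 1`, `u' 0 = 0`. -/
noncomputable def cosSol (l x : ℝ) : ℝ :=
  if 0 < l then Real.cos (√l * x) else Real.cosh (√(-l) * x)

/-- The solution of `-u'' = l u` with `u 0 = 0`, `u' 0 = 1`. -/
noncomputable def sinSol (l x : ℝ) : ℝ :=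
  if 0 < l then Real.sin (√l * x) / √l
  else if l = 0 then x else Real.sinh (√(-l) * x) / √(-l)

theorem cosSol_of_pos {l : ℝ} (hl : 0 < l) (x : ℝ) : cosSol l x = Real.cos (√l * x) :=
  if_pos hl

theorem sinSol_of_pos {l : ℝ} (hl : 0 < l) (x : ℝ) : sinSol l x = Real.sin (√l * x) / √l :=
  if_pos hl

theorem hasDerivAt_cosSol (l x : ℝ) : HasDerivAt (cosSol l) (-l * sinSol l x) x := by
  have hid (k : ℝ) : HasDerivAt (fun y : ℝ => k * y) k x := by
    simpa using (hasDerivAt_id x).const_mul k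
  rcases lt_trichotomy 0 l with hl | hl | hl
  · have h1 : √l ≠ 0 := (Real.sqrt_pos.2 hl).ne'
    have h2 : √l * √l = l := Real.mul_self_sqrt hl.le
    have h3 : cosSol l = fun x => Real.cos (√l * x) := funext fun x => if_pos hl
    rw [h3, sinSol_of_pos hl]
    convert! (hid (√l)).cos using 1
    field_simp
    linear_combination (Real.sin (√l * x)) * h2
  · subst hl
    have h3 : cosSol 0 = fun _ => 1 := by funext x; simp [cosSol]
    rw [h3]
    simpa using hasDerivAt_const x (1 : ℝ)
  · have hl' : 0 < -l := neg_pos.2 hl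
    have h1 : √(-l) ≠ 0 := (Real.sqrt_pos.2 hl').ne'
    have h2 : √(-l) * √(-l) = -l := Real.mul_self_sqrt hl'.le
    have h3 : cosSol l = fun x => Real.cosh (√(-l) * x) := funext fun x => if_neg hl.not_gt
    rw [h3, sinSol, if_neg hl.not_gt, if_neg hl.ne]
    convert! (hid (√(-l))).cosh using 1
    field_simp
    linear_combination -(Real.sinh (√(-l) * x)) * h2

theorem hasDerivAt_sinSol (l x : ℝ) : HasDerivAt (sinSol l) (cosSol l x) x := by
  have hid (k : ℝ) : HasDerivAt (fun y : ℝ => k * y) k x := by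
    simpa using (hasDerivAt_id x).const_mul k
  rcases lt_trichotomy 0 l with hl | hl | hl
  · have h1 : √l ≠ 0 := (Real.sqrt_pos.2 hl).ne'
    have h3 : sinSol l = fun x => Real.sin (√l * x) / √l := funext fun x => if_pos hl
    rw [h3, cosSol_of_pos hl]
    convert! (hid (√l)).sin.div_const (√l) using 1
    field_simp
  · subst hl
    have h3 : sinSol 0 = fun x => x := by funext x; simp [sinSol]
    rw [h3]
    simpa [cosSol] using hasDerivAt_id' x
  · have hl' : 0 < -l := neg_pos.2 hl
    have h1 : √(-l) ≠ 0 := (Real.sqrt_pos.2 hl').ne'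
    have h3 : sinSol l = fun x => Real.sinh (√(-l) * x) / √(-l) := by
      funext x; rw [sinSol, if_neg hl.not_gt, if_neg hl.ne]
    rw [h3, cosSol, if_neg hl.not_gt]
    convert! (hid (√(-l))).sinh.div_const (√(-l)) using 1
    field_simp

@[simp] theorem cosSol_zero_right (l : ℝ) : cosSol l 0 = 1 := by simp [cosSol]

@[simp] theorem sinSol_zero_right (l : ℝ) : sinSol l 0 = 0 := by simp [sinSol]

theorem cosSol_neg (l x : ℝ) : cosSol l (-x) = cosSol l x := by
  simp [cosSol]

theorem sinSol_neg (l x : ℝ) : sinSol l (-x) = -sinSol l x := by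
  simp only [sinSol, mul_neg, Real.sin_neg, Real.sinh_neg, neg_div]
  split_ifs <;> rfl

theorem continuous_cosSol (l : ℝ) : Continuous (cosSol l) :=
  continuous_iff_continuousAt.2 fun x => (hasDerivAt_cosSol l x).continuousAt

theorem continuous_sinSol (l : ℝ) : Continuous (sinSol l) :=
  continuous_iff_continuousAt.2 fun x => (hasDerivAt_sinSol l x).continuousAt

/-- The transfer matrix of the equation over a length `x` has determinant one. This identity is what
makes every elimination of `d` below collapse. -/
theorem cosSol_sq_add (l x : ℝ) : cosSol l x ^ 2 + l * sinSol l x ^ 2 = 1 := by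
  rcases lt_trichotomy 0 l with hl | hl | hl
  · rw [cosSol_of_pos hl, sinSol_of_pos hl, div_pow, Real.sq_sqrt hl.le,
      mul_div_cancel₀ _ hl.ne', Real.cos_sq_add_sin_sq]
  · subst hl; simp [cosSol]
  · have hl' : 0 < -l := neg_pos.2 hl
    rw [cosSol, if_neg hl.not_gt, sinSol, if_neg hl.not_gt, if_neg hl.ne, div_pow,
      Real.sq_sqrt hl'.le]
    have h2 := Real.cosh_sq (√(-l) * x)
    have h3 : l * (Real.sinh (√(-l) * x) ^ 2 / -l) = -Real.sinh (√(-l) * x) ^ 2 := by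
      have := hl.ne
      field_simp
    linarith

theorem one_le_cosSol {l : ℝ} (hl : l ≤ 0) (x : ℝ) : 1 ≤ cosSol l x := by
  rw [cosSol, if_neg hl.not_gt]
  exact Real.one_le_cosh _

theorem sinSol_pos {l : ℝ} (hl : l ≤ 0) {x : ℝ} (hx : 0 < x) : 0 < sinSol l x := by
  rw [sinSol, if_neg hl.not_gt]
  split_ifs with h
  · exact hx
  · have : 0 < √(-l) := Real.sqrt_pos.2 (neg_pos.2 (lt_of_le_of_ne hl h))
    exact div_pos (Real.sinh_pos_iff.2 (by positivity)) this

/-! ### The discriminant -/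

/-- The discriminant of the periodic problem: `l` lies in the essential spectrum if and only if
`|discr L l| ≤ 2 |sinSol l (L / 2)|`. -/
noncomputable def discr (L l : ℝ) : ℝ :=
  2 * cosSol l 1 * sinSol l (L / 2) + sinSol l 1 * cosSol l (L / 2)

/-- The complement of the essential spectrum. -/
def resolventRegion (L : ℝ) : Set ℝ := {l | 2 * |sinSol l (L / 2)| < |discr L l|}

/-- Here `C ≥ 1` and `s`, `σ`, `c` are positive, so already `N > 2 s`. The half line `l ≤ 0`
therefore belongs to the lowest gap. -/
theorem mem_resolventRegion_of_nonpos {L l : ℝ} (hL : 0 < L) (hl : l ≤ 0) :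
    l ∈ resolventRegion L := by
  have h1 := one_le_cosSol hl 1
  have h2 := one_le_cosSol hl (L / 2)
  have h3 := sinSol_pos hl (one_pos)
  have h4 := sinSol_pos hl (half_pos hL)
  have h5 : 2 * sinSol l (L / 2) < discr L l := by
    unfold discr
    nlinarith [mul_pos h3 (one_pos.trans_le h2), mul_nonneg (sub_nonneg.2 h1) h4.le]
  change 2 * |sinSol l (L / 2)| < |discr L l|
  rw [abs_of_pos h4]
  exact h5.trans_le (le_abs_self _)

/-- If `σ = 0` then `C = ±1` and `|N| = 2 |s|`, the edge of a band. In the gaps the rail relation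
can thus be solved for `d`. -/
theorem sinSol_one_ne_zero {L l : ℝ} (h : l ∈ resolventRegion L) : sinSol l 1 ≠ 0 := by
  intro h0
  change 2 * |sinSol l (L / 2)| < |discr L l| at h
  have h1 := cosSol_sq_add l 1
  rw [h0] at h1
  have h2 : |cosSol l 1| = 1 := by
    have h3 : cosSol l 1 ^ 2 = 1 := by linarith
    rw [← sq_abs] at h3
    exact (pow_eq_one_iff_of_nonneg (abs_nonneg _) two_ne_zero).1 h3
  rw [discr, h0, zero_mul, add_zero, abs_mul, abs_mul, h2, abs_two] at h
  linarith

/-! ### Functions of class `H²` on an interval: product rule and representation formula -/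

theorem absolutelyContinuousOnInterval_const {X : Type*} [PseudoMetricSpace X] (c : X) (a b : ℝ) :
    AbsolutelyContinuousOnInterval (fun _ : ℝ => c) a b :=
  ((LipschitzWith.const' (α := ℝ) (K := 0) c).lipschitzOnWith
    (s := uIcc a b)).absolutelyContinuousOnInterval

/-- The real and imaginary parts of the integrand have absolutely continuous primitives, which are
recombined as multiples of `1` and `I`. -/
theorem absolutelyContinuousOnInterval_primitive {g : ℝ → ℂ} {a b : ℝ}
    (hg : IntervalIntegrable g volume a b) :
    AbsolutelyContinuousOnInterval (fun x => ∫ t in a..x, g t) a b := by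
  have hre : IntervalIntegrable (fun t => (g t).re) volume a b :=
    ⟨hg.1.re, hg.2.re⟩
  have him : IntervalIntegrable (fun t => (g t).im) volume a b :=
    ⟨hg.1.im, hg.2.im⟩
  have h1 := (hre.absolutelyContinuousOnInterval_intervalIntegral
    (c := a) left_mem_uIcc).fun_smul (absolutelyContinuousOnInterval_const (1 : ℂ) a b)
  have h2 := (him.absolutelyContinuousOnInterval_intervalIntegral
    (c := a) left_mem_uIcc).fun_smul (absolutelyContinuousOnInterval_const Complex.I a b)
  have h3 := h1.fun_add h2
  rw [absolutelyContinuousOnInterval_iff] at h3 ⊢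
  intro ε hε
  obtain ⟨δ, hδ, h⟩ := h3 ε hε
  refine ⟨δ, hδ, fun E hE hE' => ?_⟩
  convert! h E hE hE' using 1
  have key : ∀ x ∈ uIcc a b, (∫ t in a..x, g t)
      = (∫ t in a..x, (g t).re) • (1 : ℂ) + (∫ t in a..x, (g t).im) • Complex.I := by
    intro x hx
    have hgx : IntervalIntegrable g volume a x := hg.mono_set (uIcc_subset_uIcc_left hx)
    have e1 := Complex.reCLM.intervalIntegral_comp_comm hgx
    have e2 := Complex.imCLM.intervalIntegral_comp_comm hgx
    simp only [Complex.reCLM_apply, Complex.imCLM_apply] at e1 e2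
    rw [e1, e2]
    apply Complex.ext <;> simp
  refine Finset.sum_congr rfl fun i hi => ?_
  have hmem := hE.1 i hi
  rw [key _ hmem.1, key _ hmem.2]

/-- The product rule for absolutely continuous functions, in integrated form. -/
theorem integral_mul_add_mul_of_primitive {g h U V : ℝ → ℂ} {a b : ℝ} (hab : a ≤ b)
    (hg : IntervalIntegrable g volume a b) (hh : IntervalIntegrable h volume a b)
    (hU : ∀ x ∈ Icc a b, U x = U a + ∫ t in a..x, g t)
    (hV : ∀ x ∈ Icc a b, V x = V a + ∫ t in a..x, h t) :
    ∫ t in a..b, (g t * V t + U t * h t) = U b * V b - U a * V a := by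
  set P : ℝ → ℂ := fun x => U a + ∫ t in a..x, g t with hP
  set Q : ℝ → ℂ := fun x => V a + ∫ t in a..x, h t with hQ
  have hPac : AbsolutelyContinuousOnInterval P a b :=
    (absolutelyContinuousOnInterval_const (U a) a b).fun_add
      (absolutelyContinuousOnInterval_primitive hg)
  have hQac : AbsolutelyContinuousOnInterval Q a b :=
    (absolutelyContinuousOnInterval_const (V a) a b).fun_add
      (absolutelyContinuousOnInterval_primitive hh)
  have hint : IntervalIntegrable (fun t => g t * Q t + P t * h t) volume a b :=
    (hg.mul_continuousOn hQac.continuousOn).add (hh.continuousOn_mul hPac.continuousOn)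
  -- The product minus the primitive of its formal derivative is absolutely continuous with
  -- derivative zero almost everywhere, hence constant.
  have hW := (hPac.fun_smul hQac).fun_sub (absolutelyContinuousOnInterval_primitive hint)
  have hW0 : ∀ᵐ x, x ∈ uIcc a b →
      HasDerivAt (fun x => P x • Q x - ∫ t in a..x, (g t * Q t + P t * h t)) 0 x := by
    filter_upwards [hg.ae_hasDerivAt_integral, hh.ae_hasDerivAt_integral,
      hint.ae_hasDerivAt_integral] with x h1 h2 h3 hx
    have d1 : HasDerivAt P (g x) x := (h1 hx a left_mem_uIcc).const_add _
    have d2 : HasDerivAt Q (h x) x := (h2 hx a left_mem_uIcc).const_add _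
    have d3 := (d1.mul d2).sub (h3 hx a left_mem_uIcc)
    convert! d3 using 1
    ring
  obtain ⟨C, hC⟩ := hW.const_of_ae_hasDerivAt_zero hW0
  have hCa := hC a left_mem_uIcc
  have hCb := hC b right_mem_uIcc
  have hcongr : ∫ t in a..b, (g t * V t + U t * h t) = ∫ t in a..b, (g t * Q t + P t * h t) := by
    refine intervalIntegral.integral_congr fun t ht => ?_
    rw [uIcc_of_le hab] at ht
    simp only [hP, hQ, hU t ht, hV t ht]
  have hPa : P a = U a := by simp [hP]
  have hQa : Q a = V a := by simp [hQ]
  have hPb : P b = U b := (hU b (right_mem_Icc.2 hab)).symm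
  have hQb : Q b = V b := (hV b (right_mem_Icc.2 hab)).symm
  rw [hcongr]
  simp only [smul_eq_mul, intervalIntegral.integral_same, hPa, hQa, hPb, hQb] at hCa hCb
  linear_combination hCa - hCb

theorem eq_add_integral_of_hasDerivAt {V h : ℝ → ℂ} (hV : ∀ x, HasDerivAt V (h x) x)
    (hh : Continuous h) (a x : ℝ) : V x = V a + ∫ t in a..x, h t := by
  rw [intervalIntegral.integral_eq_sub_of_hasDerivAt (fun t _ => hV t)
    (hh.intervalIntegrable _ _)]
  ring

theorem IsH2On.continuousOn {a b : ℝ} {u u' u'' : ℝ → ℂ} (h : IsH2On a b u u' u'') :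
    ContinuousOn u (Icc a b) := by
  rcases lt_or_ge b a with hab | hab
  · simp [Icc_eq_empty (not_le.2 hab)]
  have h1 : ContinuousOn (fun x => ∫ t in a..x, u' t) (uIcc a b) :=
    intervalIntegral.continuousOn_primitive_interval'
      (h.intervalIntegrable_fst (right_mem_Icc.2 hab)) left_mem_uIcc
  rw [uIcc_of_le hab] at h1
  exact (continuousOn_const.add h1).congr h.eq_self

theorem IsH2On.mono {a b a' b' : ℝ} {u u' u'' : ℝ → ℂ} (h : IsH2On a b u u' u'')
    (ha : a ≤ a') (hb : b' ≤ b) : IsH2On a' b' u u' u'' where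
  memLp := h.memLp.mono_measure (Measure.restrict_mono (Ioo_subset_Ioo ha hb) le_rfl)
  eq_deriv x hx := by
    have hx' : x ∈ Icc a b := ⟨ha.trans hx.1, hx.2.trans hb⟩
    have ha' : a' ∈ Icc a b := ⟨ha, (hx.1.trans hx.2).trans hb⟩
    rw [h.eq_deriv x hx', h.eq_deriv a' ha', add_assoc,
      intervalIntegral.integral_add_adjacent_intervals (h.intervalIntegrable_snd ha')
        ((h.intervalIntegrable_snd ha').symm.trans (h.intervalIntegrable_snd hx'))]
  eq_self x hx := by
    have hx' : x ∈ Icc a b := ⟨ha.trans hx.1, hx.2.trans hb⟩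
    have ha' : a' ∈ Icc a b := ⟨ha, (hx.1.trans hx.2).trans hb⟩
    rw [h.eq_self x hx', h.eq_self a' ha', add_assoc,
      intervalIntegral.integral_add_adjacent_intervals (h.intervalIntegrable_fst ha')
        ((h.intervalIntegrable_fst ha').symm.trans (h.intervalIntegrable_fst hx'))]

/-- A classical solution of class `C²` is of class `H²`. -/
theorem IsH2On.of_hasDerivAt {u u' u'' : ℝ → ℂ} (hu : ∀ x, HasDerivAt u (u' x) x)
    (hu' : ∀ x, HasDerivAt u' (u'' x) x) (hc : Continuous u'') (a b : ℝ) :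
    IsH2On a b u u' u'' where
  memLp := by
    have h1 : IsCompact (Icc a b) := isCompact_Icc
    obtain ⟨M, hM⟩ := h1.exists_bound_of_continuousOn hc.continuousOn
    refine MemLp.of_bound hc.aestronglyMeasurable M ?_
    rw [ae_restrict_iff' measurableSet_Ioo]
    exact Eventually.of_forall fun x hx => hM x (Ioo_subset_Icc_self hx)
  eq_deriv x _ := eq_add_integral_of_hasDerivAt hu' hc a x
  eq_self x _ := eq_add_integral_of_hasDerivAt hu
    (continuous_iff_continuousAt.2 fun x => (hu' x).continuousAt) a x

/-- Variation of parameters for `u''+ l u`. -/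
theorem IsH2On.eq_add_integral {a b : ℝ} {u u' u'' : ℝ → ℂ} (h : IsH2On a b u u' u'') (l : ℝ)
    {x : ℝ} (hx : x ∈ Icc a b) :
    u x = u a * cosSol l (x - a) + u' a * sinSol l (x - a)
      + ∫ t in a..x, (u'' t + l * u t) * sinSol l (x - t) := by
  have hC (t : ℝ) : HasDerivAt (fun t => (cosSol l (x - t) : ℂ)) (l * sinSol l (x - t) : ℂ) t := by
    have h1 := (hasDerivAt_cosSol l (x - t)).comp t ((hasDerivAt_id t).const_sub x)
    have h2 := h1.ofReal_comp
    simpa using h2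
  have hS (t : ℝ) : HasDerivAt (fun t => (sinSol l (x - t) : ℂ)) (-cosSol l (x - t) : ℂ) t := by
    have h1 := (hasDerivAt_sinSol l (x - t)).comp t ((hasDerivAt_id t).const_sub x)
    have h2 := h1.ofReal_comp
    simpa using h2
  have cC : Continuous fun t => (cosSol l (x - t) : ℂ) :=
    continuous_iff_continuousAt.2 fun t => (hC t).continuousAt
  have cS : Continuous fun t => (sinSol l (x - t) : ℂ) :=
    continuous_iff_continuousAt.2 fun t => (hS t).continuousAt
  have cS' : Continuous fun t => (l * sinSol l (x - t) : ℂ) := continuous_const.mul cS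
  have cC' : Continuous fun t => (-cosSol l (x - t) : ℂ) := cC.neg
  have hm := h.mono le_rfl hx.2
  have hxx : x ∈ Icc a x := ⟨hx.1, le_rfl⟩
  have i1 := hm.intervalIntegrable_fst hxx
  have i2 := hm.intervalIntegrable_snd hxx
  have e1 := integral_mul_add_mul_of_primitive hx.1 i1 (cS'.intervalIntegrable _ _) hm.eq_self
    (fun y _ => eq_add_integral_of_hasDerivAt hC cS' a y)
  have e2 := integral_mul_add_mul_of_primitive hx.1 i2 (cC'.intervalIntegrable _ _) hm.eq_deriv
    (fun y _ => eq_add_integral_of_hasDerivAt hS cC' a y)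
  have iu : IntervalIntegrable u volume a x :=
    hm.continuousOn.intervalIntegrable_of_Icc hx.1
  -- The kernel solves the equation in `t`, so the integrand is the sum of the derivatives of `u' t
  -- * sinSol l (x - t)` and `u t * cosSol l (x - t)`; the terms `u' t * cosSol l (x - t)` cancel.
  rw [intervalIntegral.integral_congr (g := fun t => (u'' t * sinSol l (x - t)
      + u' t * (-cosSol l (x - t))) + (u' t * cosSol l (x - t) + u t * (l * sinSol l (x - t))))
      (fun t _ => by ring), intervalIntegral.integral_add]
  · rw [e1, e2]
    simp
  · exact (i2.mul_continuousOn cS.continuousOn).add (i1.mul_continuousOn cC'.continuousOn)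
  · exact (i1.mul_continuousOn cC.continuousOn).add (iu.mul_continuousOn cS'.continuousOn)

/-- Variation of parameters for the derivative. -/
theorem IsH2On.deriv_eq_add_integral {a b : ℝ} {u u' u'' : ℝ → ℂ} (h : IsH2On a b u u' u'')
    (l : ℝ) {x : ℝ} (hx : x ∈ Icc a b) :
    u' x = -l * u a * sinSol l (x - a) + u' a * cosSol l (x - a)
      + ∫ t in a..x, (u'' t + l * u t) * cosSol l (x - t) := by
  have hC (t : ℝ) : HasDerivAt (fun t => (cosSol l (x - t) : ℂ)) (l * sinSol l (x - t) : ℂ) t := by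
    have h1 := (hasDerivAt_cosSol l (x - t)).comp t ((hasDerivAt_id t).const_sub x)
    have h2 := h1.ofReal_comp
    simpa using h2
  have hS (t : ℝ) : HasDerivAt (fun t => (-l * sinSol l (x - t) : ℂ))
      (l * cosSol l (x - t) : ℂ) t := by
    have h1 := (hasDerivAt_sinSol l (x - t)).comp t ((hasDerivAt_id t).const_sub x)
    have h2 := h1.ofReal_comp.const_mul (-l : ℂ)
    simpa using h2
  have cC : Continuous fun t => (cosSol l (x - t) : ℂ) :=
    continuous_iff_continuousAt.2 fun t => (hC t).continuousAt
  have cS : Continuous fun t => (-l * sinSol l (x - t) : ℂ) :=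
    continuous_iff_continuousAt.2 fun t => (hS t).continuousAt
  have cS' : Continuous fun t => (l * sinSol l (x - t) : ℂ) := by
    simpa only [neg_mul, neg_neg] using cS.fun_neg
  have cC' : Continuous fun t => (l * cosSol l (x - t) : ℂ) := continuous_const.mul cC
  have hm := h.mono le_rfl hx.2
  have hxx : x ∈ Icc a x := ⟨hx.1, le_rfl⟩
  have i1 := hm.intervalIntegrable_fst hxx
  have i2 := hm.intervalIntegrable_snd hxx
  have e1 := integral_mul_add_mul_of_primitive hx.1 i1 (cC'.intervalIntegrable _ _) hm.eq_self
    (fun y _ => eq_add_integral_of_hasDerivAt hS cC' a y)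
  have e2 := integral_mul_add_mul_of_primitive hx.1 i2 (cS'.intervalIntegrable _ _) hm.eq_deriv
    (fun y _ => eq_add_integral_of_hasDerivAt hC cS' a y)
  have iu : IntervalIntegrable u volume a x :=
    hm.continuousOn.intervalIntegrable_of_Icc hx.1
  rw [intervalIntegral.integral_congr (g := fun t => (u'' t * cosSol l (x - t)
      + u' t * (l * sinSol l (x - t))) + (u' t * (-l * sinSol l (x - t))
        + u t * (l * cosSol l (x - t))))
      (fun t _ => by ring), intervalIntegral.integral_add]
  · rw [e1, e2]
    simp
    ring
  · exact (i2.mul_continuousOn cC.continuousOn).add (i1.mul_continuousOn cS'.continuousOn)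
  · exact (i1.mul_continuousOn cS.continuousOn).add (iu.mul_continuousOn cC'.continuousOn)

theorem norm_integral_mul_le {a b : ℝ} {g : ℝ → ℂ} (hg : IntegrableOn g (Ioo a b))
    {k : ℝ → ℝ} {M : ℝ} {x : ℝ} (hx : x ∈ Icc a b) (hk : ∀ t ∈ Icc a b, |k t| ≤ M) :
    ‖∫ t in a..x, g t * k t‖ ≤ M * ∫ t in Ioo a b, ‖g t‖ := by
  have hM : 0 ≤ M := (abs_nonneg _).trans (hk a ⟨le_rfl, hx.1.trans hx.2⟩)
  have hg' : IntegrableOn g (Ioc a b) := by rwa [integrableOn_Ioc_iff_integrableOn_Ioo]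
  rw [← integral_Ioc_eq_integral_Ioo, ← integral_const_mul, intervalIntegral.integral_of_le hx.1]
  refine (norm_integral_le_of_norm_le (g := fun t => M * ‖g t‖)
    ((hg'.mono_set (Ioc_subset_Ioc_right hx.2)).norm.const_mul M) ?_).trans ?_
  · rw [ae_restrict_iff' measurableSet_Ioc]
    refine Eventually.of_forall fun t ht => ?_
    rw [norm_mul, Complex.norm_real, Real.norm_eq_abs, mul_comm]
    exact mul_le_mul_of_nonneg_right (hk t ⟨ht.1.le, ht.2.trans hx.2⟩) (norm_nonneg _)
  · refine setIntegral_mono_set (hg'.norm.const_mul M) ?_ ?_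
    · exact Eventually.of_forall fun t => mul_nonneg hM (norm_nonneg _)
    · exact (Ioc_subset_Ioc_right hx.2).eventuallyLE

/-- Pointwise bound of a primitive by `L¹` norms. -/
theorem norm_le_of_primitive {a b : ℝ} {v g : ℝ → ℂ} (hab : a < b)
    (hg : IntegrableOn g (Ioo a b)) (hvi : IntegrableOn v (Ioo a b))
    (hv : ∀ x ∈ Icc a b, v x = v a + ∫ t in a..x, g t) {x : ℝ} (hx : x ∈ Icc a b) :
    (b - a) * ‖v x‖ ≤ (∫ t in Ioo a b, ‖v t‖) + (b - a) * ∫ t in Ioo a b, ‖g t‖ := by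
  have hgi : IntervalIntegrable g volume a b := by
    rw [intervalIntegrable_iff_integrableOn_Ioo_of_le hab.le]; exact hg
  -- Integrating this bound over `y` replaces the value at `y` by the `L¹` norm of `v`.
  have key : ∀ y ∈ Icc a b, ‖v x‖ ≤ ‖v y‖ + ∫ t in Ioo a b, ‖g t‖ := by
    intro y hy
    have hax : IntervalIntegrable g volume a x :=
      hgi.mono_set (by rw [uIcc_of_le hab.le, uIcc_of_le hx.1]; exact Icc_subset_Icc_right hx.2)
    have hay : IntervalIntegrable g volume a y :=
      hgi.mono_set (by rw [uIcc_of_le hab.le, uIcc_of_le hy.1]; exact Icc_subset_Icc_right hy.2)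
    have e : v x = v y + ∫ t in y..x, g t := by
      rw [hv x hx, hv y hy, add_assoc, intervalIntegral.integral_add_adjacent_intervals hay
        (hay.symm.trans hax)]
    rw [e]
    refine (norm_add_le _ _).trans (add_le_add le_rfl ?_)
    refine intervalIntegral.norm_integral_le_integral_norm_uIoc.trans ?_
    rw [← integral_Ioc_eq_integral_Ioo]
    refine setIntegral_mono_set ?_ (Eventually.of_forall fun t => norm_nonneg _) ?_
    · rw [← intervalIntegrable_iff_integrableOn_Ioc_of_le hab.le]
      exact hgi.norm
    · refine LE.le.eventuallyLE ?_
      intro t ht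
      exact ⟨(le_min hy.1 hx.1).trans_lt ht.1, ht.2.trans (max_le hy.2 hx.2)⟩
  have h1 : ∫ _ in Ioo a b, ‖v x‖ ≤ ∫ y in Ioo a b, (‖v y‖ + ∫ t in Ioo a b, ‖g t‖) := by
    refine setIntegral_mono_on (by simp) (hvi.norm.add (by simp)) measurableSet_Ioo ?_
    exact fun y hy => key y (Ioo_subset_Icc_self hy)
  rw [integral_add hvi.norm (by simp)] at h1
  simpa [hab.le] using h1

/-! ### `L²` norms on the edges -/

theorem weight_pos {μ : ℝ} (hμ : 0 < μ) (e : Edge) : 0 < weight μ e := by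
  cases e with
  | rung j => simp only [weight]; split_ifs <;> linarith
  | rail s j => simp [weight]

theorem Edge.lo_lt_hi {L : ℝ} (hL : 0 < L) (e : Edge) : e.lo L < e.hi L := by
  cases e with
  | rung j => simp only [Edge.lo, Edge.hi]; linarith
  | rail s j => simp [Edge.lo, Edge.hi]

theorem ae_edgeMeasure_iff {L μ : ℝ} (hμ : 0 < μ) (e : Edge) {p : ℝ → Prop} :
    (∀ᵐ x ∂(edgeMeasure L μ e), p x) ↔
      ∀ᵐ x ∂(volume.restrict (Ioo (e.lo L) (e.hi L))), p x :=
  Measure.ae_ennreal_smul_measure_iff (by simpa using weight_pos hμ e)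

theorem ae_edgeMeasure_of_forall {L μ : ℝ} (hμ : 0 < μ) (e : Edge) {p : ℝ → Prop}
    (h : ∀ x ∈ Ioo (e.lo L) (e.hi L), p x) : ∀ᵐ x ∂(edgeMeasure L μ e), p x := by
  rw [ae_edgeMeasure_iff hμ, ae_restrict_iff' measurableSet_Ioo]
  exact Eventually.of_forall h

theorem edgeMeasure_univ {L μ : ℝ} (hμ : 0 < μ) (e : Edge) :
    edgeMeasure L μ e univ = ENNReal.ofReal (weight μ e * (e.hi L - e.lo L)) := by
  simp [edgeMeasure, ENNReal.ofReal_mul (weight_pos hμ e).le]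

instance isFiniteMeasure_edgeMeasure (L μ : ℝ) (e : Edge) : IsFiniteMeasure (edgeMeasure L μ e) :=
  ⟨by simp [edgeMeasure, ENNReal.mul_lt_top]⟩

/-- A quantity that depends only on the weight and the length of an edge is bounded. -/
theorem exists_edge_bound (L μ : ℝ) (k : ℝ → ℝ → ℝ) (hk : ∀ w m, 0 ≤ k w m) :
    ∃ K, 0 < K ∧ ∀ e : Edge, k (weight μ e) (e.hi L - e.lo L) ≤ K := by
  -- Only three pairs of weight and length occur: `(μ, L)`, `(1, L)` and `(1, 1)`. The added `1`
  -- makes the bound positive.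
  refine ⟨k μ (L / 2 - -L / 2) + k 1 (L / 2 - -L / 2) + k 1 1 + 1, ?_, fun e => ?_⟩
  · have h1 := hk μ (L / 2 - -L / 2)
    have h2 := hk 1 (L / 2 - -L / 2)
    have h3 := hk 1 1
    linarith
  · have h1 := hk μ (L / 2 - -L / 2)
    have h2 := hk 1 (L / 2 - -L / 2)
    have h3 := hk 1 1
    cases e with
    | rung j =>
      simp only [weight, Edge.lo, Edge.hi]
      split_ifs <;> linarith
    | rail s j =>
      simp only [weight, Edge.lo, Edge.hi, add_sub_cancel_left]
      linarith

theorem integral_edgeMeasure {L μ : ℝ} (hμ : 0 < μ) (e : Edge) (g : ℝ → ℝ) :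
    ∫ x, g x ∂(edgeMeasure L μ e) = weight μ e * ∫ x in Ioo (e.lo L) (e.hi L), g x := by
  rw [edgeMeasure, integral_smul_measure, ENNReal.toReal_ofReal (weight_pos hμ e).le, smul_eq_mul]

theorem integrableOn_edge {L μ : ℝ} (hμ : 0 < μ) (e : Edge) (g : Lp ℂ 2 (edgeMeasure L μ e)) :
    IntegrableOn g (Ioo (e.lo L) (e.hi L)) := by
  have h1 : Integrable g (edgeMeasure L μ e) := (Lp.memLp g).integrable (by norm_num)
  exact (integrable_smul_measure (by simpa using weight_pos hμ e) ENNReal.ofReal_ne_top).1 h1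

/-- The `L¹` norm on an edge is bounded by the `L²` norm. -/
theorem exists_integral_norm_le {L μ : ℝ} (hL : 0 < L) (hμ : 0 < μ) :
    ∃ K, 0 < K ∧ ∀ (e : Edge) (g : Lp ℂ 2 (edgeMeasure L μ e)),
      ∫ x in Ioo (e.lo L) (e.hi L), ‖g x‖ ≤ K * ‖g‖ := by
  -- The Cauchy–Schwarz inequality for the weighted measure gives `√(w m)`; dividing by `w` returns
  -- to Lebesgue measure.
  obtain ⟨K, hK, h⟩ := exists_edge_bound L μ (fun w m => √(w * m) / |w|)
    (fun w m => by positivity)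
  refine ⟨K, hK, fun e g => ?_⟩
  have hw := weight_pos hμ e
  have h1 : eLpNorm g 1 (edgeMeasure L μ e) ≤ _ :=
    eLpNorm_le_eLpNorm_mul_rpow_measure_univ (p := 1) (q := 2) (by norm_num)
      (Lp.memLp g).aestronglyMeasurable
  have hint : Integrable g (edgeMeasure L μ e) := (Lp.memLp g).integrable (by norm_num)
  have h2 : ∫ x, ‖g x‖ ∂(edgeMeasure L μ e)
      ≤ ‖g‖ * √(weight μ e * (e.hi L - e.lo L)) := by
    rw [integral_norm_eq_lintegral_enorm hint.aestronglyMeasurable, ← eLpNorm_one_eq_lintegral_enorm]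
    refine (ENNReal.toReal_mono ?_ h1).trans ?_
    · refine ENNReal.mul_ne_top (Lp.memLp g).2.ne ?_
      exact ENNReal.rpow_ne_top_of_nonneg (by norm_num) (measure_ne_top _ _)
    · have hpos : 0 ≤ weight μ e * (e.hi L - e.lo L) :=
        mul_nonneg hw.le (sub_nonneg.2 (e.lo_lt_hi hL).le)
      rw [ENNReal.toReal_mul, edgeMeasure_univ hμ, ← ENNReal.toReal_rpow,
        ENNReal.toReal_ofReal hpos, ← Lp.norm_def, Real.sqrt_eq_rpow]
      norm_num
  rw [integral_edgeMeasure hμ e (fun x => ‖g x‖)] at h2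
  have h3 := h e
  rw [abs_of_pos hw] at h3
  calc ∫ x in Ioo (e.lo L) (e.hi L), ‖g x‖
      ≤ ‖g‖ * √(weight μ e * (e.hi L - e.lo L)) / weight μ e := by
        rw [le_div_iff₀ hw]; linarith
    _ = √(weight μ e * (e.hi L - e.lo L)) / weight μ e * ‖g‖ := by ring
    _ ≤ K * ‖g‖ := mul_le_mul_of_nonneg_right h3 (norm_nonneg _)

/-- The `L²` norm on an edge is bounded by the supremum. -/
theorem exists_norm_le_of_bound {L : ℝ} (hL : 0 < L) {μ : ℝ} (hμ : 0 < μ) :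
    ∃ K, 0 < K ∧ ∀ (e : Edge) (g : Lp ℂ 2 (edgeMeasure L μ e)) (M : ℝ), 0 ≤ M →
      (∀ᵐ x ∂(edgeMeasure L μ e), ‖g x‖ ≤ M) → ‖g‖ ≤ K * M := by
  obtain ⟨K, hK, h⟩ := exists_edge_bound L μ (fun w m => √(w * m)) (fun w m => by positivity)
  refine ⟨K, hK, fun e g M hM hg => ?_⟩
  have h1 := Lp.norm_le_of_ae_bound hM hg
  have hpos : 0 ≤ weight μ e * (e.hi L - e.lo L) :=
    mul_nonneg (weight_pos hμ e).le (sub_nonneg.2 (e.lo_lt_hi hL).le)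
  have h2 : ((measureUnivNNReal (edgeMeasure L μ e) : ℝ)) = weight μ e * (e.hi L - e.lo L) := by
    rw [measureUnivNNReal, ENNReal.coe_toNNReal_eq_toReal, edgeMeasure_univ hμ,
      ENNReal.toReal_ofReal hpos]
  refine h1.trans (mul_le_mul_of_nonneg_right ?_ hM)
  refine le_trans (le_of_eq ?_) (h e)
  rw [h2, Real.sqrt_eq_rpow]
  norm_num

theorem summable_norm_sq {L μ : ℝ} (U : L2Graph L μ) : Summable fun e => ‖U e‖ ^ 2 := by
  have := (lp.memℓp U).summable (by norm_num)
  simpa using this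

theorem norm_sq_eq_tsum {L μ : ℝ} (U : L2Graph L μ) : ‖U‖ ^ 2 = ∑' e, ‖U e‖ ^ 2 := by
  have := lp.norm_rpow_eq_tsum (p := 2) (by norm_num) U
  simpa using this

/-! ### Traces of the elements of the domain -/

/-- A pointwise representative of an element of the graph of `antisymmetricOperator L μ`. -/
structure IsRepresentative {L μ : ℝ} (U F : antisymmetric L μ) (u u' u'' : Edge → ℝ → ℂ) :
    Prop where
  kirchhoff : IsKirchhoffFamily L μ u u' u''
  ae_eq : ∀ e, (U : L2Graph L μ) e =ᵐ[edgeMeasure L μ e] u e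
  ae_eq_deriv : ∃ d : L2Graph L μ, ∀ e, d e =ᵐ[edgeMeasure L μ e] u' e
  ae_eq_snd : ∀ e, (F : L2Graph L μ) e =ᵐ[edgeMeasure L μ e] -u'' e

theorem exists_isRepresentative {L μ : ℝ} {U F : antisymmetric L μ}
    (h : (U, F) ∈ (antisymmetricOperator L μ).graph) :
    ∃ u u' u'', IsRepresentative U F u u' u'' := by
  rw [mem_antisymmetricOperator_graph] at h
  obtain ⟨u, u', u'', h1, h2, h3, h4⟩ := h
  exact ⟨u, u', u'', h1, h2, h3, h4⟩

theorem eqOn_Icc_of_ae_edgeMeasure {L μ : ℝ} (hL : 0 < L) (hμ : 0 < μ) (e : Edge) {f g : ℝ → ℂ}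
    (hf : ContinuousOn f (Icc (e.lo L) (e.hi L))) (hg : ContinuousOn g (Icc (e.lo L) (e.hi L)))
    (h : ∀ᵐ x ∂(edgeMeasure L μ e), f x = g x) : EqOn f g (Icc (e.lo L) (e.hi L)) := by
  refine Measure.eqOn_Icc_of_ae_eq volume (e.lo_lt_hi hL).ne ?_ hf hg
  rw [← restrict_Ioo_eq_restrict_Icc]
  exact (ae_edgeMeasure_iff hμ e).1 h

section

variable {L μ : ℝ} {U F : antisymmetric L μ} {u u' u'' : Edge → ℝ → ℂ}

/-- Both sides are continuous, so the symmetry of the class `U`, given only almost everywhere, holds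
at every point, including the vertices. -/
theorem IsRepresentative.rung_odd (h : IsRepresentative U F u u' u'') (hL : 0 < L) (hμ : 0 < μ)
    (j : ℤ) {y : ℝ} (hy : y ∈ Icc (-L / 2) (L / 2)) : u (.rung j) (-y) = -u (.rung j) y := by
  have hc : ContinuousOn (u (.rung j)) (Icc (-L / 2) (L / 2)) :=
    (h.kirchhoff.isH2On (.rung j)).continuousOn
  have hc' : ContinuousOn (fun y => -u (.rung j) (-y)) (Icc (-L / 2) (L / 2)) := by
    refine (hc.comp continuousOn_neg fun y hy => ?_).neg
    have h1 := hy.1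
    have h2 := hy.2
    constructor <;> linarith
  have key : EqOn (u (.rung j)) (fun y => -u (.rung j) (-y)) (Icc (-L / 2) (L / 2)) := by
    refine eqOn_Icc_of_ae_edgeMeasure hL hμ (.rung j) hc hc' ?_
    filter_upwards [h.ae_eq (.rung j),
      (quasiMeasurePreserving_neg_rung L μ j).ae (h.ae_eq (.rung j)), U.2.1 j] with y h1 h2 h3
    rw [← h1, h3, h2]
  rw [key hy, neg_neg]

/-- Oddness leaves one Cauchy datum at the centre of a rung, the slope. For this reason the traces
on the rungs are taken there. -/
theorem IsRepresentative.rung_zero (h : IsRepresentative U F u u' u'') (hL : 0 < L) (hμ : 0 < μ)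
    (j : ℤ) : u (.rung j) 0 = 0 := by
  have := h.rung_odd hL hμ j (y := 0) ⟨by linarith, by linarith⟩
  rw [neg_zero] at this
  exact self_eq_neg.1 this

theorem IsRepresentative.rail_lower (h : IsRepresentative U F u u' u'') (hL : 0 < L) (hμ : 0 < μ)
    (j : ℤ) {x : ℝ} (hx : x ∈ Icc (j : ℝ) (j + 1)) :
    u (.rail .lower j) x = -u (.rail .upper j) x := by
  have hc : ContinuousOn (u (.rail .lower j)) (Icc (j : ℝ) (j + 1)) :=
    (h.kirchhoff.isH2On (.rail .lower j)).continuousOn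
  have hc' : ContinuousOn (fun x => -u (.rail .upper j) x) (Icc (j : ℝ) (j + 1)) :=
    (h.kirchhoff.isH2On (.rail .upper j)).continuousOn.neg
  refine eqOn_Icc_of_ae_edgeMeasure hL hμ (.rail .upper j) hc hc' ?_ hx
  have h3 : ∀ᵐ x ∂(edgeMeasure L μ (.rail .upper j)),
    (U : L2Graph L μ) (.rail .lower j) x = u (.rail .lower j) x := h.ae_eq (.rail .lower j)
  filter_upwards [h.ae_eq (.rail .upper j), h3, U.2.2 j] with x h1 h2 h3
  rw [← h1, ← h2, h3, neg_neg]

/-- `u'' + l u` agrees a.e. with `-(F - l U)`. -/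
theorem IsRepresentative.ae_eq_defect (h : IsRepresentative U F u u' u'') (l : ℂ) (e : Edge) :
    ∀ᵐ x ∂(edgeMeasure L μ e),
      u'' e x + l * u e x = -((F - l • U : antisymmetric L μ) : L2Graph L μ) e x := by
  have h3 : ∀ᵐ x ∂(edgeMeasure L μ e), ((F - l • U : antisymmetric L μ) : L2Graph L μ) e x
      = (F : L2Graph L μ) e x - l * (U : L2Graph L μ) e x := by
    filter_upwards [Lp.coeFn_sub ((F : L2Graph L μ) e) (l • (U : L2Graph L μ) e),
      Lp.coeFn_smul l ((U : L2Graph L μ) e)] with x h1 h2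
    have h4 : ((F - l • U : antisymmetric L μ) : L2Graph L μ) e
      = (F : L2Graph L μ) e - l • (U : L2Graph L μ) e := rfl
    rw [h4, h1, Pi.sub_apply, h2, Pi.smul_apply, smul_eq_mul]
  filter_upwards [h.ae_eq e, h.ae_eq_snd e, h3] with x h1 h2 h3
  rw [h3, h1, h2, Pi.neg_apply]
  ring

/-- The `L²` norm of `F - l U` on an edge. -/
noncomputable def defect (l : ℂ) (U F : antisymmetric L μ) (e : Edge) : ℝ :=
  ‖((F - l • U : antisymmetric L μ) : L2Graph L μ) e‖

theorem defect_nonneg (l : ℂ) (U F : antisymmetric L μ) (e : Edge) : 0 ≤ defect l U F e :=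
  norm_nonneg _

end

/-- Bounds for the fundamental system on the edges. -/
theorem exists_bound_sol (L l : ℝ) :
    ∃ M, 0 < M ∧ ∀ x, |x| ≤ L + 1 → |cosSol l x| ≤ M ∧ |sinSol l x| ≤ M := by
  obtain ⟨M₁, h₁⟩ := (isCompact_Icc (a := -(L + 1)) (b := L + 1)).exists_bound_of_continuousOn
    (continuous_cosSol l).continuousOn
  obtain ⟨M₂, h₂⟩ := (isCompact_Icc (a := -(L + 1)) (b := L + 1)).exists_bound_of_continuousOn
    (continuous_sinSol l).continuousOn
  refine ⟨max (max M₁ M₂) 1, by positivity, fun x hx => ?_⟩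
  have hx' := abs_le.1 hx
  exact ⟨(h₁ x hx').trans ((le_max_left _ _).trans (le_max_left _ _)),
    (h₂ x hx').trans ((le_max_right _ _).trans (le_max_left _ _))⟩

/-- On an edge, an element of the domain is close to the solution of `-u'' = l u` with the same
Cauchy data. -/
theorem exists_edge_estimate {L μ : ℝ} (hL : 0 < L) (hμ : 0 < μ) (l : ℝ) :
    ∃ K, 0 < K ∧ ∀ (U F : antisymmetric L μ) (u u' u'' : Edge → ℝ → ℂ),
      IsRepresentative U F u u' u'' → ∀ (e : Edge) (a x : ℝ), e.lo L ≤ a → a ≤ x → x ≤ e.hi L →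
      ‖u e x - (u e a * cosSol l (x - a) + u' e a * sinSol l (x - a))‖ ≤ K * defect l U F e ∧
      ‖u' e x - (-l * u e a * sinSol l (x - a) + u' e a * cosSol l (x - a))‖
        ≤ K * defect l U F e := by
  obtain ⟨M, hM, hMb⟩ := exists_bound_sol L l
  obtain ⟨K, hK, hKb⟩ := exists_integral_norm_le hL hμ
  refine ⟨M * K, mul_pos hM hK, fun U F u u' u'' h e a x ha hax hx => ?_⟩
  have hH := (h.kirchhoff.isH2On e).mono ha le_rfl
  have hxI : x ∈ Icc a (e.hi L) := ⟨hax, hx⟩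
  have hlen : ∀ t ∈ Icc a x, |x - t| ≤ L + 1 := by
    intro t ht
    rw [abs_of_nonneg (sub_nonneg.2 ht.2)]
    have h1 : e.hi L - e.lo L ≤ L + 1 := by
      cases e with
      | rung j => simp only [Edge.lo, Edge.hi]; linarith
      | rail s j => simp only [Edge.lo, Edge.hi]; linarith
    linarith [ht.1]
  set D := ((F - (l : ℂ) • U : antisymmetric L μ) : L2Graph L μ) e with hD
  have hae : ∀ᵐ t ∂(volume.restrict (Ioo (e.lo L) (e.hi L))), u'' e t + l * u e t = -D t :=
    (ae_edgeMeasure_iff hμ e).1 (h.ae_eq_defect l e)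
  have hint : IntegrableOn D (Ioo (e.lo L) (e.hi L)) := integrableOn_edge hμ e D
  have hint' : IntegrableOn (fun t => u'' e t + l * u e t) (Ioo (e.lo L) (e.hi L)) :=
    hint.neg.congr (hae.mono fun t ht => ht.symm)
  have hL1 : ∫ t in Ioo a x, ‖u'' e t + l * u e t‖ ≤ K * defect l U F e := by
    refine (setIntegral_mono_set hint'.norm (Eventually.of_forall fun t => norm_nonneg _)
      (Ioo_subset_Ioo ha hx).eventuallyLE).trans ?_
    rw [integral_congr_ae (g := fun t => ‖D t‖) (hae.mono fun t ht => by simp only [ht, norm_neg])]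
    exact hKb e D
  have hi2 : IntegrableOn (fun t => u'' e t + l * u e t) (Ioo a x) :=
    hint'.mono_set (Ioo_subset_Ioo ha hx)
  have hxx : x ∈ Icc a x := ⟨hax, le_rfl⟩
  constructor
  · rw [hH.eq_add_integral l hxI, add_sub_cancel_left]
    refine (norm_integral_mul_le hi2 hxx fun t ht => (hMb _ (hlen t ht)).2).trans ?_
    rw [mul_assoc]
    exact mul_le_mul_of_nonneg_left hL1 hM.le
  · rw [hH.deriv_eq_add_integral l hxI, add_sub_cancel_left]
    refine (norm_integral_mul_le hi2 hxx fun t ht => (hMb _ (hlen t ht)).1).trans ?_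
    rw [mul_assoc]
    exact mul_le_mul_of_nonneg_left hL1 hM.le

/-- Square summable bounds for the traces. -/
theorem exists_trace_bound {L μ : ℝ} (hL : 0 < L) (hμ : 0 < μ) {U F : antisymmetric L μ}
    {u u' u'' : Edge → ℝ → ℂ} (h : IsRepresentative U F u u' u'') :
    ∃ k : Edge → ℝ, Summable (fun e => k e ^ 2) ∧
      ∀ e, ∀ x ∈ Icc (e.lo L) (e.hi L), ‖u e x‖ ≤ k e ∧ ‖u' e x‖ ≤ k e := by
  obtain ⟨K, hK, hKb⟩ := exists_integral_norm_le hL hμ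
  obtain ⟨d, hd⟩ := h.ae_eq_deriv
  -- `c` bounds the inverse lengths of the edges, which appear when `norm_le_of_primitive` is
  -- divided by the length.
  obtain ⟨c, hc, hcb⟩ := exists_edge_bound L μ (fun _ m => |m|⁻¹) (fun _ m => by positivity)
  set A : Edge → ℝ := fun e => ‖(U : L2Graph L μ) e‖
  set B : Edge → ℝ := fun e => ‖d e‖
  set G : Edge → ℝ := fun e => ‖(F : L2Graph L μ) e‖
  have hA : Summable fun e => A e ^ 2 := summable_norm_sq _
  have hB : Summable fun e => B e ^ 2 := summable_norm_sq _
  have hG : Summable fun e => G e ^ 2 := summable_norm_sq _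
  have nA (e) : 0 ≤ A e := norm_nonneg _
  have nB (e) : 0 ≤ B e := norm_nonneg _
  have nG (e) : 0 ≤ G e := norm_nonneg _
  have gen : ∀ (e : Edge) (v g : ℝ → ℂ) (V W : Lp ℂ 2 (edgeMeasure L μ e)),
      (∀ᵐ x ∂(edgeMeasure L μ e), ‖V x‖ = ‖v x‖) → (∀ᵐ x ∂(edgeMeasure L μ e), ‖W x‖ = ‖g x‖) →
      IntegrableOn v (Ioo (e.lo L) (e.hi L)) → IntegrableOn g (Ioo (e.lo L) (e.hi L)) →
      (∀ x ∈ Icc (e.lo L) (e.hi L), v x = v (e.lo L) + ∫ t in (e.lo L)..x, g t) →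
      ∀ x ∈ Icc (e.lo L) (e.hi L), ‖v x‖ ≤ c * K * ‖V‖ + K * ‖W‖ := by
    intro e v g V W hV hW hvi hgi hv x hx
    have h1 := norm_le_of_primitive (e.lo_lt_hi hL) hgi hvi hv hx
    rw [ae_edgeMeasure_iff hμ] at hV hW
    rw [← integral_congr_ae hV, ← integral_congr_ae hW] at h1
    have hlen : 0 < e.hi L - e.lo L := sub_pos.2 (e.lo_lt_hi hL)
    have h2 := hcb e
    simp only [abs_of_pos hlen] at h2
    have h3 : ‖v x‖ ≤ (e.hi L - e.lo L)⁻¹ * (K * ‖V‖) + K * ‖W‖ := by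
      refine le_of_mul_le_mul_left (h1.trans ?_) hlen
      rw [mul_add, mul_inv_cancel_left₀ hlen.ne']
      exact add_le_add (hKb e V) (mul_le_mul_of_nonneg_left (hKb e W) hlen.le)
    refine h3.trans (add_le_add ?_ le_rfl)
    rw [mul_assoc]
    exact mul_le_mul_of_nonneg_right h2 (by positivity)
  refine ⟨fun e => (c * K + K) * (A e + B e + G e), ?_, fun e x hx => ?_⟩
  · refine Summable.of_nonneg_of_le (fun e => sq_nonneg _) (fun e => ?_)
      (((hA.add hB).add hG).mul_left (3 * (c * K + K) ^ 2))
    rw [mul_pow, mul_comm (3 : ℝ), mul_assoc]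
    refine mul_le_mul_of_nonneg_left ?_ (sq_nonneg _)
    nlinarith [sq_nonneg (A e - B e), sq_nonneg (A e - G e), sq_nonneg (B e - G e)]
  have hH := h.kirchhoff.isH2On e
  have hcu : IntegrableOn (u e) (Ioo (e.lo L) (e.hi L)) :=
    (hH.continuousOn.integrableOn_Icc).mono_set Ioo_subset_Icc_self
  have hcu' : IntegrableOn (u' e) (Ioo (e.lo L) (e.hi L)) :=
    (hH.continuousOn_fst.integrableOn_Icc).mono_set Ioo_subset_Icc_self
  have hcu'' : IntegrableOn (u'' e) (Ioo (e.lo L) (e.hi L)) := hH.memLp.integrable (by norm_num)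
  have e1 : ∀ᵐ x ∂(edgeMeasure L μ e), ‖(U : L2Graph L μ) e x‖ = ‖u e x‖ :=
    (h.ae_eq e).mono fun x hx => by rw [hx]
  have e2 : ∀ᵐ x ∂(edgeMeasure L μ e), ‖d e x‖ = ‖u' e x‖ := (hd e).mono fun x hx => by rw [hx]
  have e3 : ∀ᵐ x ∂(edgeMeasure L μ e), ‖(F : L2Graph L μ) e x‖ = ‖u'' e x‖ :=
    (h.ae_eq_snd e).mono fun x hx => by rw [hx, Pi.neg_apply, norm_neg]
  have hcK : 0 < c * K := mul_pos hc hK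
  constructor
  · refine (gen e _ _ _ _ e1 e2 hcu hcu' hH.eq_self x hx).trans ?_
    change c * K * A e + K * B e ≤ _
    nlinarith [nA e, nB e, nG e, mul_nonneg hcK.le (nB e), mul_nonneg hK.le (nA e),
      mul_nonneg hcK.le (nG e), mul_nonneg hK.le (nG e)]
  · refine (gen e _ _ _ _ e2 e3 hcu' hcu'' hH.eq_deriv x hx).trans ?_
    change c * K * B e + K * G e ≤ _
    nlinarith [nA e, nB e, nG e, mul_nonneg hcK.le (nA e), mul_nonneg hK.le (nB e),
      mul_nonneg hcK.le (nG e), mul_nonneg hK.le (nA e)]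

/-- The `L²` norm of `F - l U` on the `j`-th rung and the upper rail to its right. -/
noncomputable def cellDefect {L μ : ℝ} (l : ℂ) (U F : antisymmetric L μ) (j : ℤ) : ℝ :=
  defect l U F (.rung j) + defect l U F (.rail .upper j)

theorem cellDefect_nonneg {L μ : ℝ} (l : ℂ) (U F : antisymmetric L μ) (j : ℤ) :
    0 ≤ cellDefect l U F j := add_nonneg (defect_nonneg _ _ _ _) (defect_nonneg _ _ _ _)

/-- Approximate transfer relations between the derivative `b j` at the centre of the `j`-th rung,
the value `p j` at the upper vertex `j` and the right derivative `d j` there. -/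
structure IsCellData {L μ : ℝ} (l K : ℝ) (v U F : antisymmetric L μ) (b p d : ℤ → ℂ) : Prop where
  vertex : ∀ j, ‖p j - sinSol l (L / 2) * b j‖ ≤ K * cellDefect l U F j
  rail : ∀ j, ‖p (j + 1) - (p j * cosSol l 1 + d j * sinSol l 1)‖ ≤ K * cellDefect l U F j
  kirchhoff : ∀ j, ‖d j - (-l * p (j - 1) * sinSol l 1 + d (j - 1) * cosSol l 1)
    - weight μ (.rung j) * (cosSol l (L / 2) * b j)‖
      ≤ K * (cellDefect l U F j + cellDefect l U F (j - 1))
  norm_rung : ∀ j, ‖(U : L2Graph L μ) (.rung j)‖ ≤ K * (‖b j‖ + cellDefect l U F j)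
  norm_rail : ∀ s j, ‖(U : L2Graph L μ) (.rail s j)‖ ≤ K * (‖p j‖ + ‖d j‖ + cellDefect l U F j)
  summable_b : Summable fun j => ‖b j‖ ^ 2
  summable_d : Summable fun j => ‖d j‖ ^ 2
  functional : ‖inner ℂ v U - b 0‖ ≤ K * cellDefect l U F 0

theorem rung_injective : Function.Injective Edge.rung := fun _ _ h => by simpa using h

theorem rail_injective (s : Side) : Function.Injective (Edge.rail s) := fun _ _ h => by
  simpa using h

open Classical in
/-- The odd solution of `-u'' = l u` on the rung `0`, extended by zero. -/
theorem exists_rungVector {L μ : ℝ} (hL : 0 < L) (hμ : 0 < μ) (l : ℝ) :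
    ∃ (V : antisymmetric L μ) (a : Lp ℂ 2 (edgeMeasure L μ (.rung 0))),
      (∀ᵐ y ∂(edgeMeasure L μ (.rung 0)), a y = sinSol l y) ∧ a ≠ 0 ∧
      ∀ U : antisymmetric L μ, inner ℂ V U = inner ℂ a ((U : L2Graph L μ) (.rung 0)) := by
  have hmem : MemLp (fun y : ℝ => (sinSol l y : ℂ)) 2 (edgeMeasure L μ (.rung 0)) := by
    obtain ⟨M, -, hM⟩ := exists_bound_sol L l
    refine MemLp.of_bound
      (Complex.continuous_ofReal.comp (continuous_sinSol l)).aestronglyMeasurable M ?_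
    refine ae_edgeMeasure_of_forall hμ _ fun y hy => ?_
    rw [Complex.norm_real]
    refine (hM y ?_).2
    rw [abs_le]
    simp only [Edge.lo, Edge.hi, mem_Ioo] at hy
    constructor <;> linarith [hy.1, hy.2]
  set a : Lp ℂ 2 (edgeMeasure L μ (.rung 0)) := hmem.toLp _ with ha
  have ha1 : ∀ᵐ y ∂(edgeMeasure L μ (.rung 0)), a y = sinSol l y := hmem.coeFn_toLp
  set V : L2Graph L μ := lp.single 2 (Edge.rung 0) a with hV
  have hV0 : V (.rung 0) = a := by simp [hV]
  have hVne : ∀ e, e ≠ Edge.rung 0 → V e = 0 := by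
    intro e he
    rw [hV, lp.single_apply_ne _ _ _ he]
  have hmemV : V ∈ antisymmetric L μ := by
    refine ⟨fun j => ?_, fun j => ?_⟩
    · by_cases hj : j = 0
      · subst hj
        rw [hV0]
        filter_upwards [ha1, (quasiMeasurePreserving_neg_rung L μ 0).ae ha1] with y h1 h2
        rw [h1, h2, sinSol_neg, Complex.ofReal_neg, neg_neg]
      · rw [hVne _ (by simpa using hj)]
        have h0 := Lp.coeFn_zero ℂ 2 (edgeMeasure L μ (.rung j))
        filter_upwards [h0, (quasiMeasurePreserving_neg_rung L μ j).ae h0] with y h1 h2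
        rw [h1, h2]
        simp
    · rw [hVne (.rail .upper j) (by simp), hVne (.rail .lower j) (by simp)]
      have h0 := Lp.coeFn_zero ℂ 2 (edgeMeasure L μ (.rail .upper j))
      have h0' : ∀ᵐ x ∂(edgeMeasure L μ (.rail .upper j)),
        (0 : Lp ℂ 2 (edgeMeasure L μ (.rail .lower j))) x = 0 :=
        Lp.coeFn_zero ℂ 2 (edgeMeasure L μ (.rail .lower j))
      filter_upwards [h0, h0'] with y h1 h2
      rw [h1, h2]
      simp
  refine ⟨⟨V, hmemV⟩, a, ha1, fun h0 => ?_, fun U => ?_⟩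
  · rw [h0] at ha1
    have h2 := Lp.coeFn_zero ℂ 2 (edgeMeasure L μ (.rung 0))
    have h3 : EqOn (fun y : ℝ => (sinSol l y : ℂ)) (fun _ => 0)
        (Icc ((Edge.rung 0).lo L) ((Edge.rung 0).hi L)) := by
      refine eqOn_Icc_of_ae_edgeMeasure hL hμ (.rung 0)
        (Complex.continuous_ofReal.comp (continuous_sinSol l)).continuousOn continuousOn_const ?_
      filter_upwards [ha1, h2] with y h1 h2
      rw [← h1, h2]
      rfl
    have h4 : sinSol l =ᶠ[𝓝 0] fun _ => 0 := by
      have : Icc ((Edge.rung 0).lo L) ((Edge.rung 0).hi L) ∈ 𝓝 (0 : ℝ) :=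
        Icc_mem_nhds (by simp only [Edge.lo]; linarith) (by simp only [Edge.hi]; linarith)
      filter_upwards [this] with y hy
      simpa using h3 hy
    have h5 := (hasDerivAt_sinSol l 0).unique
      ((hasDerivAt_const (0 : ℝ) (0 : ℝ)).congr_of_eventuallyEq h4)
    simp at h5
  · rw [Submodule.coe_inner]
    exact lp.inner_single_left _ _ _


/-- The edge estimate is used from the centre of each rung to its upper end and along each upper
rail from its left end; the vertex conditions link the two, and the lower rails follow by symmetry.
On rung `0` the function `U` is close to `b 0` times the odd solution `a`, so pairing with `a`
recovers `b 0`. -/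
theorem exists_isCellData {L μ : ℝ} (hL : 0 < L) (hμ : 0 < μ) (l : ℝ) :
    ∃ (K : ℝ) (v : antisymmetric L μ), 0 < K ∧ ∀ U F : antisymmetric L μ,
      (U, F) ∈ (antisymmetricOperator L μ).graph → ∃ b p d, IsCellData l K v U F b p d := by
  obtain ⟨K₁, hK₁, hest⟩ := exists_edge_estimate hL hμ l
  obtain ⟨M, hM, hMb⟩ := exists_bound_sol L l
  obtain ⟨K₂, hK₂, hnorm⟩ := exists_norm_le_of_bound hL hμ
  obtain ⟨V, a, ha, ha0, hV⟩ := exists_rungVector hL hμ l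
  have hapos : 0 < ‖a‖ := norm_pos_iff.2 ha0
  -- One constant serves all the fields: the three summands are for the relations at the vertices
  -- and on the rails, for the edge norms, and for the functional.
  set K : ℝ := K₁ * (1 + μ + 1) + K₂ * (M + K₁) + K₂ * K₁ / ‖a‖ with hK
  have t1 : 0 < K₁ * (1 + μ + 1) := by positivity
  have t2 : 0 < K₂ * (M + K₁) := by positivity
  have t3 : 0 < K₂ * K₁ / ‖a‖ := by positivity
  have hKpos : 0 < K := by positivity
  -- The factor `‖a‖⁻²` normalises the functional: it sends `b • a` on rung `0` to `b`.
  refine ⟨K, ((‖a‖ : ℂ) ^ 2)⁻¹ • V, hKpos, fun U F hUF => ?_⟩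
  obtain ⟨u, u', u'', h⟩ := exists_isRepresentative hUF
  obtain ⟨k, hk, hkb⟩ := exists_trace_bound hL hμ h
  set φ : ℤ → ℝ := cellDefect l U F with hφ
  have φ0 (j) : 0 ≤ φ j := cellDefect_nonneg _ _ _ _
  have r0 (j) : 0 ≤ defect l U F (.rung j) := defect_nonneg _ _ _ _
  have r1 (j) : 0 ≤ defect l U F (.rail .upper j) := defect_nonneg _ _ _ _
  have φr (j) : defect l U F (.rung j) ≤ φ j := le_add_of_nonneg_right (r1 j)
  have φu (j) : defect l U F (.rail .upper j) ≤ φ j := le_add_of_nonneg_left (r0 j)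
  have m0 (j : ℤ) : (0 : ℝ) ∈ Icc ((Edge.rung j).lo L) ((Edge.rung j).hi L) := by
    simp only [Edge.lo, Edge.hi]; constructor <;> linarith
  have mL (j : ℤ) : L / 2 ∈ Icc ((Edge.rung j).lo L) ((Edge.rung j).hi L) := by
    simp only [Edge.lo, Edge.hi]; constructor <;> linarith
  have mj (s : Side) (j : ℤ) : (j : ℝ) ∈ Icc ((Edge.rail s j).lo L) ((Edge.rail s j).hi L) := by
    simp [Edge.lo, Edge.hi]
  -- estimates on the rungs
  have rung_est : ∀ j, ∀ y ∈ Icc (0 : ℝ) (L / 2),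
      ‖u (.rung j) y - u' (.rung j) 0 * sinSol l y‖ ≤ K₁ * φ j ∧
      ‖u' (.rung j) y - u' (.rung j) 0 * cosSol l y‖ ≤ K₁ * φ j := by
    intro j y hy
    have h1 := hest U F u u' u'' h (.rung j) 0 y (m0 j).1 hy.1 hy.2
    simp only [h.rung_zero hL hμ j, sub_zero, zero_mul, mul_zero, zero_add] at h1
    have h2 := mul_le_mul_of_nonneg_left (φr j) hK₁.le
    exact ⟨h1.1.trans h2, h1.2.trans h2⟩
  have rung_est' : ∀ j, ∀ y ∈ Icc (-L / 2) (L / 2),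
      ‖u (.rung j) y - u' (.rung j) 0 * sinSol l y‖ ≤ K₁ * φ j := by
    intro j y hy
    rcases le_total 0 y with h0 | h0
    · exact (rung_est j y ⟨h0, hy.2⟩).1
    · have h1 := (rung_est j (-y) ⟨by linarith, by linarith [hy.1]⟩).1
      rw [h.rung_odd hL hμ j hy, sinSol_neg, Complex.ofReal_neg, mul_neg, ← neg_sub', norm_neg] at h1
      exact h1
  have rail_est : ∀ j : ℤ, ∀ x ∈ Icc (j : ℝ) (j + 1),
      ‖u (.rail .upper j) x - (u (.rail .upper j) j * cosSol l (x - j)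
        + u' (.rail .upper j) j * sinSol l (x - j))‖ ≤ K₁ * φ j ∧
      ‖u' (.rail .upper j) x - (-l * u (.rail .upper j) j * sinSol l (x - j)
        + u' (.rail .upper j) j * cosSol l (x - j))‖ ≤ K₁ * φ j := by
    intro j x hx
    have h1 := hest U F u u' u'' h (.rail .upper j) j x le_rfl hx.1 hx.2
    have h2 := mul_le_mul_of_nonneg_left (φu j) hK₁.le
    exact ⟨h1.1.trans h2, h1.2.trans h2⟩
  have vert (j : ℤ) : u (.rail .upper j) j = u (.rung j) (L / 2) := by
    simpa [Side.sign] using h.kirchhoff.continuous_right .upper j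
  have vert' (j : ℤ) : u (.rail .upper (j - 1)) j = u (.rail .upper j) j := by
    rw [vert]
    simpa [Side.sign] using h.kirchhoff.continuous_left .upper j
  have hL2 : L / 2 ∈ Icc (0 : ℝ) (L / 2) := ⟨by linarith, le_rfl⟩
  refine ⟨fun j => u' (.rung j) 0, fun j => u (.rail .upper j) j, fun j => u' (.rail .upper j) j,
    ⟨fun j => ?_, fun j => ?_, fun j => ?_, fun j => ?_, fun s j => ?_, ?_, ?_, ?_⟩⟩
  · have h1 := (rung_est j (L / 2) hL2).1
    rw [vert, mul_comm]
    refine h1.trans (mul_le_mul_of_nonneg_right ?_ (φ0 j))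
    nlinarith
  · have h1 := (rail_est j (j + 1) ⟨by linarith, le_rfl⟩).1
    have h2 := vert' (j + 1)
    rw [add_sub_cancel_right] at h2
    rw [← h2]
    push_cast
    rw [add_sub_cancel_left] at h1
    refine h1.trans (mul_le_mul_of_nonneg_right ?_ (φ0 j))
    nlinarith
  · have h1 := (rail_est (j - 1) j ⟨by push_cast; linarith, by push_cast; linarith⟩).2
    have h2 := (rung_est j (L / 2) hL2).2
    have h3 := h.kirchhoff.kirchhoff .upper j
    simp only [Side.sign, weight, Complex.ofReal_one, one_mul] at h3
    have e : (j : ℝ) - ((j - 1 : ℤ) : ℝ) = 1 := by push_cast; ring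
    rw [e] at h1
    have hw : ‖((weight μ (.rung j) : ℝ) : ℂ)‖ ≤ 1 + μ := by
      rw [Complex.norm_real, Real.norm_of_nonneg (weight_pos hμ _).le]
      simp only [weight]
      split_ifs <;> linarith
    have key : u' (.rail .upper j) j - (-l * u (.rail .upper (j - 1)) ((j - 1 : ℤ) : ℝ) * sinSol l 1
          + u' (.rail .upper (j - 1)) ((j - 1 : ℤ) : ℝ) * cosSol l 1)
        - weight μ (.rung j) * (cosSol l (L / 2) * u' (.rung j) 0)
        = (u' (.rail .upper (j - 1)) j - (-l * u (.rail .upper (j - 1)) ((j - 1 : ℤ) : ℝ)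
            * sinSol l 1 + u' (.rail .upper (j - 1)) ((j - 1 : ℤ) : ℝ) * cosSol l 1))
          + weight μ (.rung j)
            * (u' (.rung j) (L / 2) - u' (.rung j) 0 * cosSol l (L / 2)) := by
      simp only [weight]
      linear_combination h3
    rw [key]
    refine (norm_add_le _ _).trans ?_
    rw [norm_mul]
    have h4 := mul_le_mul hw h2 (norm_nonneg _) (by positivity)
    refine (add_le_add h1 h4).trans ?_
    have h5 : K₁ * (1 + μ + 1) * (φ j + φ (j - 1)) ≤ K * (φ j + φ (j - 1)) :=
      mul_le_mul_of_nonneg_right (by linarith) (add_nonneg (φ0 _) (φ0 _))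
    refine le_trans ?_ h5
    nlinarith [mul_nonneg hK₁.le (φ0 j), mul_nonneg (mul_nonneg hK₁.le hμ.le) (φ0 (j - 1)),
      mul_nonneg hK₁.le (φ0 (j - 1)), mul_nonneg (mul_nonneg hK₁.le hμ.le) (φ0 j)]
  · refine (hnorm (.rung j) _ (M * ‖u' (.rung j) 0‖ + K₁ * φ j) ?_ ?_).trans ?_
    · have := φ0 j; positivity
    · filter_upwards [h.ae_eq (.rung j), ae_edgeMeasure_of_forall (L := L) hμ (.rung j)
        (fun y hy => rung_est' j y (Ioo_subset_Icc_self hy)),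
        ae_edgeMeasure_of_forall (L := L) hμ (.rung j) (fun y hy => hy)] with y h1 h2 h3
      simp only [Edge.lo, Edge.hi, mem_Ioo] at h3
      rw [h1]
      have h4 : ‖u' (.rung j) 0 * sinSol l y‖ ≤ M * ‖u' (.rung j) 0‖ := by
        rw [norm_mul, Complex.norm_real, mul_comm]
        refine mul_le_mul_of_nonneg_right (hMb y ?_).2 (norm_nonneg _)
        rw [abs_le]; constructor <;> linarith
      have h5 := norm_le_norm_add_norm_sub' (u (.rung j) y) (u' (.rung j) 0 * sinSol l y)
      linarith
    · have h1 : K₂ * (M + K₁) * (‖u' (.rung j) 0‖ + φ j) ≤ K * (‖u' (.rung j) 0‖ + φ j) :=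
        mul_le_mul_of_nonneg_right (by linarith) (add_nonneg (norm_nonneg _) (φ0 _))
      refine le_trans ?_ h1
      rw [mul_assoc]
      refine mul_le_mul_of_nonneg_left ?_ hK₂.le
      nlinarith [mul_nonneg hM.le (φ0 j), mul_nonneg hK₁.le (norm_nonneg (u' (.rung j) 0))]
  · set p := u (.rail .upper j) j
    set d := u' (.rail .upper j) j
    have pt : ∀ x ∈ Ioo (j : ℝ) (j + 1), ‖u (.rail .upper j) x‖ ≤ M * (‖p‖ + ‖d‖) + K₁ * φ j := by
      intro x hx
      have h1 := (rail_est j x (Ioo_subset_Icc_self hx)).1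
      have hx' : |x - j| ≤ L + 1 := by
        rw [abs_le]; constructor <;> linarith [hx.1, hx.2]
      have h4 : ‖p * cosSol l (x - j) + d * sinSol l (x - j)‖ ≤ M * (‖p‖ + ‖d‖) := by
        refine (norm_add_le _ _).trans ?_
        rw [norm_mul, norm_mul, Complex.norm_real, Complex.norm_real]
        have := mul_le_mul_of_nonneg_left (hMb _ hx').1 (norm_nonneg p)
        have := mul_le_mul_of_nonneg_left (hMb _ hx').2 (norm_nonneg d)
        simp only [Real.norm_eq_abs]
        linarith
      have h5 := norm_le_norm_add_norm_sub' (u (.rail .upper j) x)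
        (p * cosSol l (x - j) + d * sinSol l (x - j))
      linarith
    have pt' : ∀ x ∈ Ioo (j : ℝ) (j + 1), ‖u (.rail s j) x‖ ≤ M * (‖p‖ + ‖d‖) + K₁ * φ j := by
      intro x hx
      cases s with
      | upper => exact pt x hx
      | lower =>
        rw [h.rail_lower hL hμ j (Ioo_subset_Icc_self hx), norm_neg]
        exact pt x hx
    refine (hnorm (.rail s j) _ (M * (‖p‖ + ‖d‖) + K₁ * φ j) ?_ ?_).trans ?_
    · have := φ0 j; positivity
    · filter_upwards [h.ae_eq (.rail s j),
        ae_edgeMeasure_of_forall (L := L) hμ (.rail s j) pt'] with x h1 h2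
      rwa [h1]
    · have h1 : K₂ * (M + K₁) * (‖p‖ + ‖d‖ + φ j) ≤ K * (‖p‖ + ‖d‖ + φ j) :=
        mul_le_mul_of_nonneg_right (by linarith)
          (add_nonneg (add_nonneg (norm_nonneg _) (norm_nonneg _)) (φ0 _))
      refine le_trans ?_ h1
      rw [mul_assoc]
      refine mul_le_mul_of_nonneg_left ?_ hK₂.le
      nlinarith [mul_nonneg hM.le (φ0 j), mul_nonneg hK₁.le (norm_nonneg p),
        mul_nonneg hK₁.le (norm_nonneg d)]
  · exact Summable.of_nonneg_of_le (fun j => sq_nonneg _)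
      (fun j => pow_le_pow_left₀ (norm_nonneg _) (hkb _ _ (m0 j)).2 2)
      (hk.comp_injective rung_injective)
  · exact Summable.of_nonneg_of_le (fun j => sq_nonneg _)
      (fun j => pow_le_pow_left₀ (norm_nonneg _) (hkb _ _ (mj .upper j)).2 2)
      (hk.comp_injective (rail_injective .upper))
  · set U₀ := (U : L2Graph L μ) (.rung 0)
    set b := u' (.rung 0) 0
    have h1 : ‖U₀ - b • a‖ ≤ K₂ * (K₁ * φ 0) := by
      refine hnorm _ _ _ (mul_nonneg hK₁.le (φ0 0)) ?_
      filter_upwards [h.ae_eq (.rung 0), ha, Lp.coeFn_sub U₀ (b • a), Lp.coeFn_smul b a,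
        ae_edgeMeasure_of_forall (L := L) hμ (.rung 0)
          (fun y hy => rung_est' 0 y (Ioo_subset_Icc_self hy))] with y h1 h2 h3 h4 h5
      rw [h3, Pi.sub_apply, h4, Pi.smul_apply, h1, h2]
      exact h5
    have h2 : inner ℂ (((‖a‖ : ℂ) ^ 2)⁻¹ • V) U - b
        = ((‖a‖ : ℂ) ^ 2)⁻¹ * inner ℂ a (U₀ - b • a) := by
      have e : inner ℂ (((‖a‖ : ℂ) ^ 2)⁻¹ • V) U
          = (starRingEnd ℂ) (((‖a‖ : ℂ) ^ 2)⁻¹) * inner ℂ V U := inner_smul_left V U _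
      rw [e, hV, inner_sub_right, inner_smul_right, inner_self_eq_norm_sq_to_K]
      have : (‖a‖ : ℂ) ≠ 0 := by exact_mod_cast hapos.ne'
      simp only [map_inv₀, map_pow, Complex.conj_ofReal]
      field_simp
      simp only [Complex.coe_algebraMap, mul_comm b]
      rfl
    rw [h2, norm_mul, norm_inv, norm_pow, Complex.norm_real, norm_norm]
    have h3 : ‖inner ℂ a (U₀ - b • a)‖ ≤ ‖a‖ * (K₂ * (K₁ * φ 0)) :=
      (norm_inner_le_norm _ _).trans (mul_le_mul_of_nonneg_left h1 hapos.le)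
    calc (‖a‖ ^ 2)⁻¹ * ‖inner ℂ a (U₀ - b • a)‖
        ≤ (‖a‖ ^ 2)⁻¹ * (‖a‖ * (K₂ * (K₁ * φ 0))) :=
          mul_le_mul_of_nonneg_left h3 (by positivity)
      _ = K₂ * K₁ / ‖a‖ * φ 0 := by field_simp
      _ ≤ K * φ 0 := mul_le_mul_of_nonneg_right (by linarith) (φ0 0)

/-! ### The estimate outside the essential spectrum -/

theorem add_add_add_sq_le (x y z w : ℝ) :
    (x + y + z + w) ^ 2 ≤ 4 * (x ^ 2 + y ^ 2 + z ^ 2 + w ^ 2) := by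
  linear_combination sq_nonneg (x - y) + sq_nonneg (x - z) + sq_nonneg (x - w)
    + sq_nonneg (y - z) + sq_nonneg (y - w) + sq_nonneg (z - w)

theorem summable_shift {f : ℤ → ℝ} (hf : Summable f) (k : ℤ) : Summable fun j => f (j + k) :=
  hf.comp_injective (add_left_injective k)

theorem tsum_shift (f : ℤ → ℝ) (k : ℤ) : ∑' j, f (j + k) = ∑' j, f j :=
  (Equiv.addRight k).tsum_eq f

/-- A three term recurrence with dominant diagonal is bounded below in `ℓ²`. -/
theorem tsum_sq_le_of_dominant {a r : ℤ → ℝ} {n t : ℝ} (ht : 0 ≤ t) (htn : 2 * t < n)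
    (ha : Summable fun j => a j ^ 2) (hr : Summable fun j => r j ^ 2) (ha0 : ∀ j, 0 ≤ a j)
    (h : ∀ j, n * a j ≤ t * (a (j + 1) + a (j - 1)) + r j) :
    ∑' j, a j ^ 2 ≤ (∑' j, r j ^ 2) / (n - 2 * t) ^ 2 := by
  have hδ : 0 < n - 2 * t := by linarith
  have h1 := summable_shift ha 1
  have h2 := summable_shift ha (-1)
  -- The inequality is multiplied by `(n - 2 t) a j` and the products are split by `2 x y ≤ x² +
  -- y²`. The bracket is the discrete Laplacian of `a²`, whose sum over `ℤ` vanishes.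
  have key : ∀ j, (n - 2 * t) ^ 2 * a j ^ 2 ≤
      (n - 2 * t) * t * (a (j + 1) ^ 2 + a (j + -1) ^ 2 - 2 * a j ^ 2) + r j ^ 2 := by
    intro j
    have e1 : (n - 2 * t) * a j * (n * a j)
        ≤ (n - 2 * t) * a j * (t * (a (j + 1) + a (j + -1)) + r j) :=
      mul_le_mul_of_nonneg_left (h j) (mul_nonneg hδ.le (ha0 j))
    nlinarith [mul_nonneg (mul_nonneg hδ.le ht) (sq_nonneg (a j - a (j + 1))),
      mul_nonneg (mul_nonneg hδ.le ht) (sq_nonneg (a j - a (j + -1))),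
      sq_nonneg ((n - 2 * t) * a j - r j)]
  have hsum : Summable fun j => (n - 2 * t) * t * (a (j + 1) ^ 2 + a (j + -1) ^ 2 - 2 * a j ^ 2)
      + r j ^ 2 := ((((h1.add h2).sub (ha.mul_left 2)).mul_left _)).add hr
  have e := Summable.tsum_le_tsum key (ha.mul_left _) hsum
  rw [tsum_mul_left, Summable.tsum_add (((h1.add h2).sub (ha.mul_left 2)).mul_left _) hr,
    tsum_mul_left, Summable.tsum_sub (h1.add h2) (ha.mul_left 2), Summable.tsum_add h1 h2,
    tsum_mul_left, tsum_shift (fun j => a j ^ 2) 1, tsum_shift (fun j => a j ^ 2) (-1)] at e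
  rw [le_div_iff₀ (by positivity)]
  linarith

/-- The edges: one rung and two rails for every `j`. -/
def edgeEquiv : ℤ ⊕ (ℤ ⊕ ℤ) ≃ Edge where
  toFun
    | .inl j => .rung j
    | .inr (.inl j) => .rail .upper j
    | .inr (.inr j) => .rail .lower j
  invFun
    | .rung j => .inl j
    | .rail .upper j => .inr (.inl j)
    | .rail .lower j => .inr (.inr j)
  left_inv := by rintro (j | j | j) <;> rfl
  right_inv := by rintro (j | ⟨_ | _, j⟩) <;> rfl

theorem summable_edge {f : Edge → ℝ} (h₁ : Summable fun j => f (.rung j))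
    (h₂ : ∀ s, Summable fun j => f (.rail s j)) : Summable f := by
  rw [← edgeEquiv.summable_iff]
  exact Summable.sum _ h₁ (Summable.sum _ (h₂ .upper) (h₂ .lower))

theorem tsum_edge {f : Edge → ℝ} (hf : Summable f) :
    ∑' e, f e = ∑' j, f (.rung j) + (∑' j, f (.rail .upper j) + ∑' j, f (.rail .lower j)) := by
  have h₁ := (hf.comp_injective rung_injective).hasSum
  have h₂ := (hf.comp_injective (rail_injective .upper)).hasSum
  have h₃ := (hf.comp_injective (rail_injective .lower)).hasSum
  rw [← edgeEquiv.tsum_eq]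
  exact (HasSum.sum (f := fun x => f (edgeEquiv x)) h₁ (HasSum.sum h₂ h₃)).tsum_eq

theorem tsum_cellDefect_sq {L μ : ℝ} (l : ℂ) (U F : antisymmetric L μ) :
    (Summable fun j => cellDefect l U F j ^ 2) ∧
      ∑' j, cellDefect l U F j ^ 2 ≤ 2 * ‖F - l • U‖ ^ 2 := by
  have h := summable_norm_sq ((F - l • U : antisymmetric L μ) : L2Graph L μ)
  have h₁ : Summable fun j => defect l U F (.rung j) ^ 2 := h.comp_injective rung_injective
  have h₂ : Summable fun j => defect l U F (.rail .upper j) ^ 2 :=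
    h.comp_injective (rail_injective .upper)
  have h₃ : Summable fun j => defect l U F (.rail .lower j) ^ 2 :=
    h.comp_injective (rail_injective .lower)
  have hle : ∀ j, cellDefect l U F j ^ 2 ≤
      2 * (defect l U F (.rung j) ^ 2 + defect l U F (.rail .upper j) ^ 2) := fun j => by
    unfold cellDefect
    nlinarith [sq_nonneg (defect l U F (.rung j) - defect l U F (.rail .upper j))]
  have hs : Summable fun j => cellDefect l U F j ^ 2 :=
    Summable.of_nonneg_of_le (fun j => sq_nonneg _) hle ((h₁.add h₂).mul_left 2)
  refine ⟨hs, (hs.tsum_le_tsum hle ((h₁.add h₂).mul_left 2)).trans ?_⟩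
  rw [tsum_mul_left, h₁.tsum_add h₂]
  have e : ‖F - l • U‖ ^ 2 = ∑' e, defect l U F e ^ 2 := norm_sq_eq_tsum _
  have e3 : 0 ≤ ∑' j, defect l U F (.rail .lower j) ^ 2 := tsum_nonneg fun j => sq_nonneg _
  rw [e, tsum_edge (f := fun e => defect l U F e ^ 2) h]
  change _ ≤ 2 * (∑' j, defect l U F (.rung j) ^ 2 + (∑' j, defect l U F (.rail .upper j) ^ 2
    + ∑' j, defect l U F (.rail .lower j) ^ 2))
  linarith

theorem norm_ofReal_mul_le (x : ℝ) (z : ℂ) {y : ℝ} (h : ‖z‖ ≤ y) : ‖(x : ℂ) * z‖ ≤ |x| * y := by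
  rw [norm_mul, Complex.norm_real]
  exact mul_le_mul_of_nonneg_left h (abs_nonneg _)

/-- The recurrence satisfied by the derivatives at the centres of the rungs. -/
theorem IsCellData.norm_recurrence_le {L μ l K : ℝ} {v U F : antisymmetric L μ}
    {b p d : ℤ → ℂ} (h : IsCellData l K v U F b p d) (hK : 0 ≤ K) (j : ℤ) :
    ‖sinSol l (L / 2) * (b (j + 1) + b (j - 1)) - (2 * cosSol l 1 * sinSol l (L / 2)
      + weight μ (.rung j) * sinSol l 1 * cosSol l (L / 2)) * b j‖
      ≤ K * (3 * |cosSol l 1| + |sinSol l 1| + 2) *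
        (cellDefect l U F (j - 1) + cellDefect l U F j + cellDefect l U F (j + 1)) := by
  set φ := cellDefect (l : ℂ) U F
  have φ0 (j) : 0 ≤ φ j := cellDefect_nonneg _ _ _ _
  have hcs : (cosSol l 1 : ℂ) ^ 2 + l * (sinSol l 1 : ℂ) ^ 2 = 1 := by
    exact_mod_cast cosSol_sq_add l 1
  have α₀ := h.vertex j
  have α₁ := h.vertex (j + 1)
  have α₂ := h.vertex (j - 1)
  have β₀ := h.rail j
  have β₁ := h.rail (j - 1)
  rw [sub_add_cancel] at β₁
  have γ := h.kirchhoff j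
  -- This combination of the transfer relations eliminates `p` and `d`. The slopes on the rail to
  -- the left cancel against each other, and `C² + l σ² = 1` disposes of the remaining `p (j - 1)`.
  have e : (sinSol l (L / 2) : ℂ) * (b (j + 1) + b (j - 1)) - (2 * cosSol l 1 * sinSol l (L / 2)
      + weight μ (.rung j) * sinSol l 1 * cosSol l (L / 2)) * b j
      = ((2 * cosSol l 1 : ℝ) : ℂ) * (p j - sinSol l (L / 2) * b j)
        + ((sinSol l 1 : ℝ) : ℂ) * (d j - (-l * p (j - 1) * sinSol l 1 + d (j - 1) * cosSol l 1)
          - weight μ (.rung j) * (cosSol l (L / 2) * b j))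
        + ((-cosSol l 1 : ℝ) : ℂ) * (p j - (p (j - 1) * cosSol l 1 + d (j - 1) * sinSol l 1))
        + (p (j + 1) - (p j * cosSol l 1 + d j * sinSol l 1))
        - (p (j - 1) - sinSol l (L / 2) * b (j - 1))
        - (p (j + 1) - sinSol l (L / 2) * b (j + 1)) := by
    push_cast
    linear_combination (-p (j - 1)) * hcs
  rw [e]
  have n1 := norm_ofReal_mul_le (2 * cosSol l 1) _ α₀
  have n2 := norm_ofReal_mul_le (sinSol l 1) _ γ
  have n3 := norm_ofReal_mul_le (-cosSol l 1) _ β₁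
  rw [abs_mul, abs_two] at n1
  rw [abs_neg] at n3
  refine (norm_sub_le_of_le (norm_sub_le_of_le (norm_add_le_of_le (norm_add_le_of_le
    (norm_add_le_of_le n1 n2) n3) β₀) α₂) α₁).trans ?_
  have c0 := abs_nonneg (cosSol l 1)
  have s0 := abs_nonneg (sinSol l 1)
  set C := |cosSol l 1|
  set S := |sinSol l 1|
  have q0 := mul_nonneg hK (φ0 j)
  have q1 := mul_nonneg hK (φ0 (j - 1))
  have q2 := mul_nonneg hK (φ0 (j + 1))
  have : K * (3 * C + S + 2) * (φ (j - 1) + φ j + φ (j + 1)) - (2 * C * (K * φ j)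
      + S * (K * (φ j + φ (j - 1))) + C * (K * φ (j - 1)) + K * φ j + K * φ (j - 1)
      + K * φ (j + 1)) = C * (K * φ j) + (2 * C + 1) * (K * φ (j - 1))
        + (3 * C + S + 1) * (K * φ (j + 1)) + K * φ j := by ring
  have : 0 ≤ C * (K * φ j) + (2 * C + 1) * (K * φ (j - 1))
        + (3 * C + S + 1) * (K * φ (j + 1)) + K * φ j := by positivity
  linarith

/-- Outside the essential spectrum the traces are controlled by `F - l U` and a functional. -/
theorem exists_tsum_sq_le {L μ : ℝ} {l : ℝ} (hl : l ∈ resolventRegion L) {K : ℝ} (hK : 0 < K) :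
    ∃ KA : ℝ, 0 ≤ KA ∧ ∀ (v U F : antisymmetric L μ) (b p d : ℤ → ℂ),
      IsCellData l K v U F b p d →
      ∑' j, ‖b j‖ ^ 2 ≤ KA * (‖F - (l : ℂ) • U‖ ^ 2 + ‖inner ℂ v U‖ ^ 2) := by
  set s := sinSol l (L / 2) with hs
  set c := cosSol l (L / 2) with hc
  set C := cosSol l 1 with hC
  set σ := sinSol l 1 with hσ
  have hl' : 2 * |s| < |discr L l| := hl
  set N := discr L l with hN
  set K₁ := K * (3 * |C| + |σ| + 2) with hK₁
  have hK₁0 : 0 ≤ K₁ := by positivity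
  -- The amount by which the recurrence at rung `0` differs from the periodic one. That term is
  -- treated as a source on the right-hand side, where `b 0` is controlled by the functional and the
  -- defect.
  set m := |(1 - μ) * σ * c| with hm
  set δ := |N| - 2 * |s| with hδ
  have hδ0 : 0 < δ := by linarith
  set KA := (4 * (9 * K₁ ^ 2 * 2) + 4 * (m ^ 2 * 2 * (1 + 2 * K ^ 2))) / δ ^ 2 with hKA
  refine ⟨KA, by positivity, fun v U F b p d h => ?_⟩
  set φ := cellDefect (l : ℂ) U F with hφ
  have φ0 (j) : 0 ≤ φ j := cellDefect_nonneg _ _ _ _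
  obtain ⟨hφs, hφle⟩ := tsum_cellDefect_sq (l : ℂ) U F
  change Summable (fun j => φ j ^ 2) at hφs
  change ∑' j, φ j ^ 2 ≤ _ at hφle
  generalize hD : ‖F - (l : ℂ) • U‖ ^ 2 = D at hφle ⊢
  generalize hB : ‖inner ℂ v U‖ ^ 2 = B
  have hD0 : 0 ≤ D := hD ▸ sq_nonneg _
  have hB0 : 0 ≤ B := hB ▸ sq_nonneg _
  have hφj (j) : φ j ^ 2 ≤ 2 * D := (hφs.le_tsum j fun i _ => sq_nonneg _).trans hφle
  -- From `‖b 0‖ ≤ ‖⟨v, U⟩‖ + K φ 0`, the inequality `(x + y)² ≤ 2 x² + 2 y²` and `φ 0² ≤ 2 D`.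
  have hb0 : ‖b 0‖ ^ 2 ≤ 2 * B + 4 * K ^ 2 * D := by
    have h1 : ‖b 0‖ ≤ ‖inner ℂ v U‖ + K * φ 0 := by
      have := norm_le_norm_add_norm_sub (inner ℂ v U) (b 0)
      linarith [h.functional]
    have h2 : ‖b 0‖ ^ 2 ≤ (‖inner ℂ v U‖ + K * φ 0) ^ 2 :=
      pow_le_pow_left₀ (norm_nonneg _) h1 2
    have h3 := mul_le_mul_of_nonneg_left (hφj 0) (sq_nonneg K)
    rw [← hB]
    nlinarith [sq_nonneg (‖inner ℂ v U‖ - K * φ 0)]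
  -- the recurrence with constant coefficients
  set δ₀ : ℤ → ℝ := fun j => if j = 0 then m * ‖b 0‖ else 0 with hδ₀
  have hδ₀s : HasSum (fun j => δ₀ j ^ 2) ((m * ‖b 0‖) ^ 2) := by
    have := hasSum_ite_eq (0 : ℤ) ((m * ‖b 0‖) ^ 2)
    refine this.congr_fun fun j => ?_
    simp only [hδ₀]
    split_ifs <;> simp
  set r : ℤ → ℝ := fun j => K₁ * (φ (j + -1) + φ j + φ (j + 1)) + δ₀ j with hr
  have hrec : ∀ j, |N| * ‖b j‖ ≤ |s| * (‖b (j + 1)‖ + ‖b (j - 1)‖) + r j := by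
    intro j
    have h1 := h.norm_recurrence_le hK.le j
    have h2 : (N : ℂ) * b j = s * b (j + 1) + s * b (j - 1) - (s * (b (j + 1) + b (j - 1))
        - (2 * C * s + weight μ (.rung j) * σ * c) * b j)
        + (((1 - weight μ (.rung j)) * σ * c : ℝ) : ℂ) * b j := by
      simp only [hN, discr]
      push_cast
      ring
    have h3 : ‖(((1 - weight μ (.rung j)) * σ * c : ℝ) : ℂ) * b j‖ ≤ δ₀ j := by
      rw [norm_mul, Complex.norm_real]
      by_cases hj : j = 0
      · simp [hδ₀, hj, weight, hm]
      · simp [hδ₀, hj, weight]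
    have h4 : |N| * ‖b j‖ = ‖(N : ℂ) * b j‖ := by rw [norm_mul, Complex.norm_real]; rfl
    rw [h4, h2]
    refine (norm_add_le_of_le (norm_sub_le_of_le (norm_add_le_of_le
      (norm_ofReal_mul_le s _ le_rfl) (norm_ofReal_mul_le s _ le_rfl)) h1) h3).trans ?_
    simp only [hr, ← sub_eq_add_neg]
    apply le_of_eq
    ring
  have hrs : ∀ j, r j ^ 2 ≤ 4 * (K₁ ^ 2 * φ (j + -1) ^ 2 + K₁ ^ 2 * φ j ^ 2
      + K₁ ^ 2 * φ (j + 1) ^ 2 + δ₀ j ^ 2) := by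
    intro j
    have h1 := add_add_add_sq_le (K₁ * φ (j + -1)) (K₁ * φ j) (K₁ * φ (j + 1)) (δ₀ j)
    simp only [hr, ← mul_pow]
    rwa [mul_add, mul_add]
  have s1 := (summable_shift hφs (-1)).mul_left (K₁ ^ 2)
  have s2 := hφs.mul_left (K₁ ^ 2)
  have s3 := (summable_shift hφs 1).mul_left (K₁ ^ 2)
  have hrsum : Summable fun j => 4 * (K₁ ^ 2 * φ (j + -1) ^ 2 + K₁ ^ 2 * φ j ^ 2
      + K₁ ^ 2 * φ (j + 1) ^ 2 + δ₀ j ^ 2) :=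
    (((s1.add s2).add s3).add hδ₀s.summable).mul_left 4
  have hrsum' : Summable fun j => r j ^ 2 :=
    Summable.of_nonneg_of_le (fun j => sq_nonneg _) hrs hrsum
  have hAle : ∑' j, ‖b j‖ ^ 2 ≤ KA * (D + B) := by
    have h1 := tsum_sq_le_of_dominant (abs_nonneg s) hl' h.summable_b hrsum'
      (fun j => norm_nonneg _) hrec
    refine h1.trans ?_
    rw [hKA, div_mul_eq_mul_div]
    refine div_le_div_of_nonneg_right ?_ (sq_nonneg _)
    refine (hrsum'.tsum_le_tsum hrs hrsum).trans ?_
    rw [tsum_mul_left, ((s1.add s2).add s3).tsum_add hδ₀s.summable, (s1.add s2).tsum_add s3,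
      s1.tsum_add s2, tsum_mul_left, tsum_mul_left, tsum_mul_left,
      tsum_shift (fun j => φ j ^ 2), tsum_shift (fun j => φ j ^ 2), hδ₀s.tsum_eq, mul_pow]
    have h2 := mul_le_mul_of_nonneg_left hφle (sq_nonneg K₁)
    have h3 := mul_le_mul_of_nonneg_left hb0 (sq_nonneg m)
    have h4 := mul_nonneg (sq_nonneg K₁) hD0
    have h5 := mul_nonneg (sq_nonneg K₁) hB0
    have h6 := mul_nonneg (sq_nonneg m) hD0
    have h7 := mul_nonneg (mul_nonneg (sq_nonneg m) (sq_nonneg K)) hB0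
    linear_combination 12 * h2 + 4 * h3 + 48 * h4 + 72 * h5 + 8 * h6 + 16 * h7
  exact hAle

/-- The slopes `b` alone control `U` up to the defect: the vertex relation yields `p`, and since `σ
≠ 0` the rail relation can be solved for `d j` in terms of `p j` and `p (j + 1)`. The data of the
edges over `j` are then dominated by quantities at `j` and `j + 1`. -/
theorem exists_norm_sq_le {L μ l : ℝ} (hσ0 : sinSol l 1 ≠ 0) {K : ℝ} (hK : 0 < K) :
    ∃ K' : ℝ, 0 ≤ K' ∧ ∀ (v U F : antisymmetric L μ) (b p d : ℤ → ℂ),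
      IsCellData l K v U F b p d →
      ‖U‖ ^ 2 ≤ K' * (∑' j, ‖b j‖ ^ 2 + ∑' j, cellDefect l U F j ^ 2) := by
  set s := sinSol l (L / 2) with hs
  set C := cosSol l 1 with hC
  set σ := sinSol l 1 with hσ
  have hσpos : 0 < |σ| := abs_pos.2 hσ0
  set K₂ := K * (1 + |s| + K + 1 + (|s| + K + |C| * (|s| + K) + K) / |σ|) with hK₂
  have hK₂0 : 0 ≤ K₂ := by positivity
  refine ⟨3 * (K₂ ^ 2 * (4 * 2)), by positivity, fun v U F b p d h => ?_⟩
  set φ := cellDefect (l : ℂ) U F with hφ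
  have φ0 (j) : 0 ≤ φ j := cellDefect_nonneg _ _ _ _
  obtain ⟨hφs, -⟩ := tsum_cellDefect_sq (l : ℂ) U F
  change Summable (fun j => φ j ^ 2) at hφs
  set A := ∑' j, ‖b j‖ ^ 2 with hA
  -- the norm on the edges
  set g : ℤ → ℝ := fun j => ‖b j‖ + ‖b (j + 1)‖ + (φ j + φ (j + 1)) with hg
  have hg0 (j) : 0 ≤ g j := by
    have := φ0 j; have := φ0 (j + 1); positivity
  have hbg (j) : ‖b j‖ ≤ g j := by
    have := φ0 j; have := φ0 (j + 1); have := norm_nonneg (b (j + 1)); simp only [hg]; linarith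
  have hbg' (j) : ‖b (j + 1)‖ ≤ g j := by
    have := φ0 j; have := φ0 (j + 1); have := norm_nonneg (b j); simp only [hg]; linarith
  have hφg (j) : φ j ≤ g j := by
    have := φ0 (j + 1); have := norm_nonneg (b j); have := norm_nonneg (b (j + 1))
    simp only [hg]; linarith
  have hφg' (j) : φ (j + 1) ≤ g j := by
    have := φ0 j; have := norm_nonneg (b j); have := norm_nonneg (b (j + 1))
    simp only [hg]; linarith
  have hp : ∀ j, ‖p j‖ ≤ |s| * ‖b j‖ + K * φ j := by
    intro j
    have h1 := norm_le_norm_add_norm_sub' (p j) (s * b j)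
    have h2 := norm_ofReal_mul_le s (b j) le_rfl
    linarith [h.vertex j]
  have hp1 (j) : ‖p j‖ ≤ (|s| + K) * g j := by
    have h2 := mul_le_mul_of_nonneg_left (hbg j) (abs_nonneg s)
    have h3 := mul_le_mul_of_nonneg_left (hφg j) hK.le
    linarith [hp j]
  have hp2 (j) : ‖p (j + 1)‖ ≤ (|s| + K) * g j := by
    have h2 := mul_le_mul_of_nonneg_left (hbg' j) (abs_nonneg s)
    have h3 := mul_le_mul_of_nonneg_left (hφg' j) hK.le
    linarith [hp (j + 1)]
  have hd : ∀ j, ‖d j‖ ≤ (|s| + K + |C| * (|s| + K) + K) / |σ| * g j := by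
    intro j
    rw [div_mul_eq_mul_div, le_div_iff₀ hσpos]
    have e : (σ : ℂ) * d j = p (j + 1) - C * p j
        - (p (j + 1) - (p j * C + d j * σ)) := by ring
    have e1 : ‖(σ : ℂ) * d j‖ ≤ (|s| + K) * g j + |C| * ((|s| + K) * g j) + K * g j := by
      rw [e]
      refine norm_sub_le_of_le (norm_sub_le_of_le (hp2 j) (norm_ofReal_mul_le C _ (hp1 j))) ?_
      exact (h.rail j).trans (mul_le_mul_of_nonneg_left (hφg j) hK.le)
    rw [norm_mul, Complex.norm_real, Real.norm_eq_abs] at e1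
    linarith
  have hQ : 0 ≤ (|s| + K + |C| * (|s| + K) + K) / |σ| := by positivity
  have hrung : ∀ j, ‖(U : L2Graph L μ) (.rung j)‖ ≤ K₂ * g j := by
    intro j
    refine (h.norm_rung j).trans ?_
    rw [hK₂, mul_assoc]
    refine mul_le_mul_of_nonneg_left ?_ hK.le
    have h1 : ‖b j‖ + φ j ≤ g j := by
      have := φ0 (j + 1); have := norm_nonneg (b (j + 1)); simp only [hg]; linarith
    nlinarith [mul_nonneg (abs_nonneg s) (hg0 j), mul_nonneg hK.le (hg0 j), mul_nonneg hQ (hg0 j),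
      hg0 j]
  have hrail : ∀ t j, ‖(U : L2Graph L μ) (.rail t j)‖ ≤ K₂ * g j := by
    intro t j
    refine (h.norm_rail t j).trans ?_
    rw [hK₂, mul_assoc]
    refine mul_le_mul_of_nonneg_left ?_ hK.le
    have := hd j
    have := hp1 j
    have := hφg j
    nlinarith [hg0 j]
  have hgs : ∀ j, (K₂ * g j) ^ 2 ≤ K₂ ^ 2 * (4 * (‖b j‖ ^ 2 + ‖b (j + 1)‖ ^ 2
      + (φ j ^ 2 + φ (j + 1) ^ 2))) := by
    intro j
    rw [mul_pow]
    refine mul_le_mul_of_nonneg_left ?_ (sq_nonneg _)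
    have h1 := add_add_add_sq_le ‖b j‖ ‖b (j + 1)‖ (φ j) (φ (j + 1))
    simp only [hg]
    linear_combination h1
  have z1 := h.summable_b
  have z2 := summable_shift z1 1
  have z3 := summable_shift hφs 1
  have hgsum : HasSum (fun j => K₂ ^ 2 * (4 * (‖b j‖ ^ 2 + ‖b (j + 1)‖ ^ 2
      + (φ j ^ 2 + φ (j + 1) ^ 2)))) (K₂ ^ 2 * (4 * (A + A + (∑' j, φ j ^ 2 + ∑' j, φ j ^ 2)))) := by
    refine HasSum.mul_left _ (HasSum.mul_left _ (HasSum.add (HasSum.add z1.hasSum ?_)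
      (HasSum.add hφs.hasSum ?_)))
    · rw [hA, ← tsum_shift (fun j => ‖b j‖ ^ 2) 1]; exact z2.hasSum
    · rw [← tsum_shift (fun j => φ j ^ 2) 1]; exact z3.hasSum
  have hbound : ∀ f : ℤ → Edge, (∀ j, ‖(U : L2Graph L μ) (f j)‖ ≤ K₂ * g j) →
      ∑' j, ‖(U : L2Graph L μ) (f j)‖ ^ 2
        ≤ K₂ ^ 2 * (4 * (A + A + (∑' j, φ j ^ 2 + ∑' j, φ j ^ 2))) := by
    intro f hf
    have hle : ∀ j, ‖(U : L2Graph L μ) (f j)‖ ^ 2 ≤ _ :=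
      fun j => (pow_le_pow_left₀ (norm_nonneg _) (hf j) 2).trans (hgs j)
    rw [← hgsum.tsum_eq]
    exact (Summable.of_nonneg_of_le (fun j => sq_nonneg _) hle hgsum.summable).tsum_le_tsum hle
      hgsum.summable
  have hfin : ‖U‖ ^ 2 ≤ 3 * (K₂ ^ 2 * (4 * (A + A + (∑' j, φ j ^ 2 + ∑' j, φ j ^ 2)))) := by
    have e : ‖U‖ ^ 2 = ∑' e, ‖(U : L2Graph L μ) e‖ ^ 2 := norm_sq_eq_tsum _
    rw [e, tsum_edge (summable_norm_sq _)]
    have e1 := hbound Edge.rung hrung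
    have e2 := hbound (Edge.rail .upper) (hrail .upper)
    have e3 := hbound (Edge.rail .lower) (hrail .lower)
    linarith
  refine hfin.trans (le_of_eq ?_)
  ring

/-- Outside the essential spectrum the operator is bounded below up to a rank one term. -/
theorem exists_resolvent_estimate {L μ : ℝ} (hL : 0 < L) (hμ : 0 < μ) {l : ℝ}
    (hl : l ∈ resolventRegion L) :
    ∃ (K : ℝ) (v : antisymmetric L μ), ∀ U F : antisymmetric L μ,
      (U, F) ∈ (antisymmetricOperator L μ).graph →
      ‖U‖ ^ 2 ≤ K * (‖F - (l : ℂ) • U‖ ^ 2 + ‖inner ℂ v U‖ ^ 2) := by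
  obtain ⟨K, v, hK, hcell⟩ := exists_isCellData (μ := μ) hL hμ l
  obtain ⟨KA, hKA, hA⟩ := exists_tsum_sq_le (μ := μ) hl hK
  obtain ⟨K', hK', hU⟩ := exists_norm_sq_le (L := L) (μ := μ) (sinSol_one_ne_zero hl) hK
  refine ⟨K' * (KA + 2), v, fun U F hUF => ?_⟩
  obtain ⟨b, p, d, h⟩ := hcell U F hUF
  refine (hU v U F b p d h).trans ?_
  rw [mul_assoc]
  refine mul_le_mul_of_nonneg_left ?_ hK'
  have h1 := hA v U F b p d h
  have h2 := (tsum_cellDefect_sq (l : ℂ) U F).2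
  have h3 := sq_nonneg ‖inner ℂ v U‖
  linarith

/-! ### Construction of elements of the domain -/

theorem exists_L2Graph {L μ : ℝ} (hL : 0 < L) (hμ : 0 < μ) {g : Edge → ℝ → ℂ} {k : Edge → ℝ}
    (hg : ∀ e, Continuous (g e)) (hk : Summable fun e => k e ^ 2)
    (hgk : ∀ e, ∀ x ∈ Icc (e.lo L) (e.hi L), ‖g e x‖ ≤ k e) :
    ∃ G : L2Graph L μ, ∀ e, G e =ᵐ[edgeMeasure L μ e] g e := by
  obtain ⟨K, hK, hKb⟩ := exists_norm_le_of_bound hL hμ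
  have hae : ∀ e, ∀ᵐ x ∂(edgeMeasure L μ e), ‖g e x‖ ≤ k e := fun e =>
    ae_edgeMeasure_of_forall hμ e fun x hx => hgk e x (Ioo_subset_Icc_self hx)
  have hmem : ∀ e, MemLp (g e) 2 (edgeMeasure L μ e) := fun e =>
    MemLp.of_bound (hg e).aestronglyMeasurable (k e) (hae e)
  have hk0 : ∀ e, 0 ≤ k e := fun e =>
    (norm_nonneg _).trans (hgk e (e.lo L) (left_mem_Icc.2 (e.lo_lt_hi hL).le))
  have hb : ∀ e, ‖(hmem e).toLp (g e)‖ ≤ K * k e := fun e => by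
    refine hKb e _ (k e) (hk0 e) ?_
    filter_upwards [hae e, (hmem e).coeFn_toLp] with x h1 h2
    rwa [h2]
  refine ⟨⟨fun e => (hmem e).toLp (g e), ?_⟩, fun e => (hmem e).coeFn_toLp⟩
  refine memℓp_gen ?_
  have h2 : (2 : ℝ≥0∞).toReal = (2 : ℕ) := by norm_num
  simp only [h2, Real.rpow_natCast]
  refine Summable.of_nonneg_of_le (fun e => sq_nonneg _)
    (fun e => pow_le_pow_left₀ (norm_nonneg _) (hb e) 2) ?_
  simp only [mul_pow]
  exact hk.mul_left _

/-- A cubic cutoff function on the `j`-th rail with values `χ j` and `χ (j + 1)` at the vertices. -/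
noncomputable def cutoff (χ : ℤ → ℝ) (j : ℤ) (x : ℝ) : ℝ :=
  χ j + (χ (j + 1) - χ j) * (3 * (x - j) ^ 2 - 2 * (x - j) ^ 3)

/-- The derivative of `cutoff`. -/
noncomputable def cutoff' (χ : ℤ → ℝ) (j : ℤ) (x : ℝ) : ℝ :=
  (χ (j + 1) - χ j) * (6 * (x - j) - 6 * (x - j) ^ 2)

/-- The second derivative of `cutoff`. -/
noncomputable def cutoff'' (χ : ℤ → ℝ) (j : ℤ) (x : ℝ) : ℝ :=
  (χ (j + 1) - χ j) * (6 - 12 * (x - j))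

theorem hasDerivAt_cutoff (χ : ℤ → ℝ) (j : ℤ) (x : ℝ) :
    HasDerivAt (cutoff χ j) (cutoff' χ j x) x := by
  have h1 : HasDerivAt (fun x : ℝ => x - j) 1 x := (hasDerivAt_id' x).sub_const _
  have h2 := ((((h1.pow 2).const_mul 3).sub ((h1.pow 3).const_mul 2)).const_mul
    (χ (j + 1) - χ j)).const_add (χ j)
  convert! h2 using 1
  simp only [cutoff']
  ring

theorem hasDerivAt_cutoff' (χ : ℤ → ℝ) (j : ℤ) (x : ℝ) :
    HasDerivAt (cutoff' χ j) (cutoff'' χ j x) x := by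
  have h1 : HasDerivAt (fun x : ℝ => x - j) 1 x := (hasDerivAt_id' x).sub_const _
  have h2 := ((h1.const_mul 6).sub ((h1.pow 2).const_mul 6)).const_mul (χ (j + 1) - χ j)
  convert! h2 using 1
  simp only [cutoff'']
  ring

theorem cutoff_bounds (χ : ℤ → ℝ) (j : ℤ) {x : ℝ} (hx : x ∈ Icc (j : ℝ) (j + 1)) :
    |cutoff χ j x| ≤ |χ j| + |χ (j + 1)| ∧ |cutoff' χ j x| ≤ 6 * (|χ j| + |χ (j + 1)|) ∧
      |cutoff'' χ j x| ≤ 6 * (|χ j| + |χ (j + 1)|) := by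
  set t := x - j with ht
  have t0 : 0 ≤ t := by linarith [hx.1]
  have t1 : t ≤ 1 := by linarith [hx.2]
  have hsub : |χ (j + 1) - χ j| ≤ |χ j| + |χ (j + 1)| := by
    simpa [sub_eq_add_neg, add_comm] using abs_add_le (χ (j + 1)) (-χ j)
  have gen : ∀ z : ℝ, |z| ≤ 6 → |(χ (j + 1) - χ j) * z| ≤ 6 * (|χ j| + |χ (j + 1)|) := by
    intro z hz
    rw [abs_mul, mul_comm (6 : ℝ)]
    exact mul_le_mul hsub hz (abs_nonneg _) (by positivity)
  refine ⟨?_, gen _ ?_, gen _ ?_⟩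
  · have h0 : 0 ≤ 3 * t ^ 2 - 2 * t ^ 3 := by nlinarith [sq_nonneg t]
    have h1 : 3 * t ^ 2 - 2 * t ^ 3 ≤ 1 := by
      nlinarith [mul_nonneg (sq_nonneg (1 - t)) (by linarith : 0 ≤ 1 + 2 * t)]
    have e : cutoff χ j x = (1 - (3 * t ^ 2 - 2 * t ^ 3)) * χ j
        + (3 * t ^ 2 - 2 * t ^ 3) * χ (j + 1) := by simp only [cutoff]; ring
    rw [e]
    refine (abs_add_le _ _).trans ?_
    rw [abs_mul, abs_mul, abs_of_nonneg h0, abs_of_nonneg (sub_nonneg.2 h1)]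
    nlinarith [abs_nonneg (χ j), abs_nonneg (χ (j + 1))]
  · rw [abs_le]; constructor <;> nlinarith
  · rw [abs_le]; constructor <;> linarith

/-- The solution on the `j`-th upper rail with Cauchy data `s b j`, `d j`. -/
noncomputable def railSol (L l : ℝ) (b d : ℤ → ℂ) (j : ℤ) (x : ℝ) : ℂ :=
  sinSol l (L / 2) * b j * cosSol l (x - j) + d j * sinSol l (x - j)

/-- The derivative of `railSol`. -/
noncomputable def railSol' (L l : ℝ) (b d : ℤ → ℂ) (j : ℤ) (x : ℝ) : ℂ :=
  -l * (sinSol l (L / 2) * b j) * sinSol l (x - j) + d j * cosSol l (x - j)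

theorem hasDerivAt_cosSol_sub (l a x : ℝ) :
    HasDerivAt (fun x => (cosSol l (x - a) : ℂ)) (-l * sinSol l (x - a) : ℂ) x := by
  have h1 := (hasDerivAt_cosSol l (x - a)).comp x ((hasDerivAt_id' x).sub_const a)
  simpa using h1.ofReal_comp

theorem hasDerivAt_sinSol_sub (l a x : ℝ) :
    HasDerivAt (fun x => (sinSol l (x - a) : ℂ)) (cosSol l (x - a) : ℂ) x := by
  have h1 := (hasDerivAt_sinSol l (x - a)).comp x ((hasDerivAt_id' x).sub_const a)
  simpa using h1.ofReal_comp

theorem hasDerivAt_railSol (L l : ℝ) (b d : ℤ → ℂ) (j : ℤ) (x : ℝ) :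
    HasDerivAt (railSol L l b d j) (railSol' L l b d j x) x := by
  have h := ((hasDerivAt_cosSol_sub l j x).const_mul (sinSol l (L / 2) * b j)).add
    ((hasDerivAt_sinSol_sub l j x).const_mul (d j))
  convert! h using 1
  simp only [railSol']
  ring

theorem hasDerivAt_railSol' (L l : ℝ) (b d : ℤ → ℂ) (j : ℤ) (x : ℝ) :
    HasDerivAt (railSol' L l b d j) (-l * railSol L l b d j x) x := by
  have h := ((hasDerivAt_sinSol_sub l j x).const_mul (-l * (sinSol l (L / 2) * b j))).add
    ((hasDerivAt_cosSol_sub l j x).const_mul (d j))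
  convert! h using 1
  simp only [railSol]
  ring

/-- The cut off family of solutions. -/
noncomputable def trial (L l : ℝ) (χ : ℤ → ℝ) (b d : ℤ → ℂ) : Edge → ℝ → ℂ
  | .rung j, y => χ j * b j * sinSol l y
  | .rail s j, x => s.sign * (cutoff χ j x * railSol L l b d j x)

/-- The derivative of `trial`. -/
noncomputable def trial' (L l : ℝ) (χ : ℤ → ℝ) (b d : ℤ → ℂ) : Edge → ℝ → ℂ
  | .rung j, y => χ j * b j * cosSol l y
  | .rail s j, x => s.sign * (cutoff' χ j x * railSol L l b d j x
      + cutoff χ j x * railSol' L l b d j x)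

/-- The commutator of the operator with the cutoff. -/
noncomputable def trialDefect (L l : ℝ) (χ : ℤ → ℝ) (b d : ℤ → ℂ) : Edge → ℝ → ℂ
  | .rung _, _ => 0
  | .rail s j, x => s.sign * (cutoff'' χ j x * railSol L l b d j x
      + 2 * (cutoff' χ j x * railSol' L l b d j x))

theorem hasDerivAt_trial (L l : ℝ) (χ : ℤ → ℝ) (b d : ℤ → ℂ) (e : Edge) (x : ℝ) :
    HasDerivAt (trial L l χ b d e) (trial' L l χ b d e x) x := by
  cases e with
  | rung j => exact (hasDerivAt_sinSol l x).ofReal_comp.const_mul _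
  | rail s j =>
    exact ((hasDerivAt_cutoff χ j x).ofReal_comp.mul (hasDerivAt_railSol L l b d j x)).const_mul _

theorem hasDerivAt_trial' (L l : ℝ) (χ : ℤ → ℝ) (b d : ℤ → ℂ) (e : Edge) (x : ℝ) :
    HasDerivAt (trial' L l χ b d e) (trialDefect L l χ b d e x - l * trial L l χ b d e x) x := by
  cases e with
  | rung j =>
    have h := (hasDerivAt_cosSol l x).ofReal_comp.const_mul (χ j * b j : ℂ)
    convert! h using 1
    simp only [trialDefect, trial]
    push_cast
    ring
  | rail s j =>
    have h := (((hasDerivAt_cutoff' χ j x).ofReal_comp.mul (hasDerivAt_railSol L l b d j x)).add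
      ((hasDerivAt_cutoff χ j x).ofReal_comp.mul (hasDerivAt_railSol' L l b d j x))).const_mul
      (s.sign : ℂ)
    convert! h using 1
    simp only [trialDefect, trial]
    ring

theorem continuous_trial (L l : ℝ) (χ : ℤ → ℝ) (b d : ℤ → ℂ) (e : Edge) :
    Continuous (trial L l χ b d e) :=
  continuous_iff_continuousAt.2 fun x => (hasDerivAt_trial L l χ b d e x).continuousAt

theorem continuous_trialDefect (L l : ℝ) (χ : ℤ → ℝ) (b d : ℤ → ℂ) (e : Edge) :
    Continuous (trialDefect L l χ b d e) := by
  cases e with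
  | rung j => exact continuous_const
  | rail s j =>
    have h1 : Continuous (railSol L l b d j) :=
      continuous_iff_continuousAt.2 fun x => (hasDerivAt_railSol L l b d j x).continuousAt
    have h2 : Continuous (railSol' L l b d j) :=
      continuous_iff_continuousAt.2 fun x => (hasDerivAt_railSol' L l b d j x).continuousAt
    have h3 : Continuous fun x => (cutoff' χ j x : ℂ) := by unfold cutoff'; fun_prop
    have h4 : Continuous fun x => (cutoff'' χ j x : ℂ) := by unfold cutoff''; fun_prop
    exact continuous_const.mul ((h4.mul h1).add (continuous_const.mul (h3.mul h2)))

/-- The size of the trial family on an edge. -/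
noncomputable def trialSize (χ : ℤ → ℝ) (b d : ℤ → ℂ) : Edge → ℝ
  | .rung j => (|χ j| + |χ (j + 1)|) * (‖b j‖ + ‖d j‖)
  | .rail _ j => (|χ j| + |χ (j + 1)|) * (‖b j‖ + ‖d j‖)

theorem Side.norm_sign (s : Side) : ‖(s.sign : ℂ)‖ = 1 := by
  cases s <;> simp [Side.sign]

theorem exists_trial_bound {L : ℝ} (hL : 0 < L) (l : ℝ) :
    ∃ M, 0 < M ∧ ∀ χ b d (e : Edge), ∀ x ∈ Icc (e.lo L) (e.hi L),
      ‖trial L l χ b d e x‖ ≤ M * trialSize χ b d e ∧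
      ‖trial' L l χ b d e x‖ ≤ M * trialSize χ b d e ∧
      ‖trialDefect L l χ b d e x‖ ≤ M * trialSize χ b d e := by
  obtain ⟨M, hM, hMb⟩ := exists_bound_sol L l
  set s := sinSol l (L / 2)
  set Q := M * (1 + |s|) * (1 + |l|) with hQ
  have hQ0 : 0 < Q := by positivity
  have hMQ : M ≤ Q := by
    rw [hQ, mul_assoc]
    refine le_mul_of_one_le_right hM.le ?_
    nlinarith [abs_nonneg s, abs_nonneg l, mul_nonneg (abs_nonneg s) (abs_nonneg l)]
  refine ⟨18 * Q, by positivity, fun χ b d e x hx => ?_⟩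
  cases e with
  | rung j =>
    simp only [Edge.lo, Edge.hi] at hx
    have hx' : |x| ≤ L + 1 := by rw [abs_le]; constructor <;> linarith [hx.1, hx.2]
    have h1 : |χ j| * ‖b j‖ ≤ trialSize χ b d (.rung j) := by
      simp only [trialSize]
      exact mul_le_mul (le_add_of_nonneg_right (abs_nonneg _))
        (le_add_of_nonneg_right (norm_nonneg _)) (norm_nonneg _) (by positivity)
    have gen : ∀ z : ℝ, |z| ≤ M → ‖(χ j * b j * z : ℂ)‖ ≤ 18 * Q * trialSize χ b d (.rung j) := by
      intro z hz
      rw [norm_mul, norm_mul, Complex.norm_real, Complex.norm_real, mul_comm (18 * Q)]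
      exact mul_le_mul h1 (by rw [Real.norm_eq_abs]; linarith) (norm_nonneg _)
        (le_trans (by positivity) h1)
    refine ⟨gen _ (hMb x hx').2, gen _ (hMb x hx').1, ?_⟩
    simp only [trialDefect, norm_zero]
    exact mul_nonneg (by positivity) (le_trans (by positivity) h1)
  | rail t j =>
    simp only [Edge.lo, Edge.hi] at hx
    have hx' : |x - j| ≤ L + 1 := by rw [abs_le]; constructor <;> linarith [hx.1, hx.2]
    obtain ⟨c0, c1, c2⟩ := cutoff_bounds χ j hx
    obtain ⟨m1, m2⟩ := hMb _ hx'
    set a := |χ j| + |χ (j + 1)| with ha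
    have ha0 : 0 ≤ a := by positivity
    set w := ‖b j‖ + ‖d j‖ with hw
    have hw0 : 0 ≤ w := by positivity
    have hbw : ‖b j‖ ≤ w := le_add_of_nonneg_right (norm_nonneg _)
    have hdw : ‖d j‖ ≤ w := le_add_of_nonneg_left (norm_nonneg _)
    have sl : 0 ≤ |s| * |l| := by positivity
    have hMw : 0 ≤ M * w := by positivity
    have r1 : ‖railSol L l b d j x‖ ≤ Q * w := by
      refine (norm_add_le _ _).trans ?_
      rw [norm_mul, norm_mul, norm_mul, Complex.norm_real, Complex.norm_real, Complex.norm_real]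
      have e1 : |s| * ‖b j‖ * |cosSol l (x - j)| ≤ |s| * w * M := by gcongr
      have e2 : ‖d j‖ * |sinSol l (x - j)| ≤ w * M := by gcongr
      simp only [Real.norm_eq_abs]
      refine (add_le_add e1 e2).trans ?_
      rw [hQ]
      have := abs_nonneg l
      have : 0 ≤ M * w * (|l| + |s| * |l|) := by positivity
      linarith
    have r2 : ‖railSol' L l b d j x‖ ≤ Q * w := by
      refine (norm_add_le _ _).trans ?_
      rw [norm_mul, norm_mul, norm_mul, norm_mul, norm_neg, Complex.norm_real, Complex.norm_real,
        Complex.norm_real, Complex.norm_real]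
      have e1 : |l| * (|s| * ‖b j‖) * |sinSol l (x - j)| ≤ |l| * (|s| * w) * M := by gcongr
      have e2 : ‖d j‖ * |cosSol l (x - j)| ≤ w * M := by gcongr
      simp only [Real.norm_eq_abs]
      refine (add_le_add e1 e2).trans ?_
      rw [hQ]
      have : 0 ≤ M * w * (|l| + |s|) := by positivity
      linarith
    have prod : ∀ (y : ℝ) (z : ℂ) (k : ℝ), 0 ≤ k → |y| ≤ k * a → ‖z‖ ≤ Q * w →
        ‖(y : ℂ) * z‖ ≤ k * (Q * (a * w)) := by
      intro y z k hk hy hz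
      rw [norm_mul, Complex.norm_real]
      refine (mul_le_mul hy hz (norm_nonneg _) (by positivity)).trans (le_of_eq (by ring))
    have p00 := prod (cutoff χ j x) _ 1 (by norm_num) (by linarith) r1
    have p01 := prod (cutoff χ j x) _ 1 (by norm_num) (by linarith) r2
    have p10 := prod _ _ 6 (by norm_num) c1 r1
    have p11 := prod _ _ 6 (by norm_num) c1 r2
    have p20 := prod _ _ 6 (by norm_num) c2 r1
    have haw : 0 ≤ Q * (a * w) := by positivity
    have hsz : trialSize χ b d (.rail t j) = a * w := rfl
    rw [hsz, mul_assoc]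
    refine ⟨?_, ?_, ?_⟩
    · simp only [trial]
      rw [norm_mul, Side.norm_sign, one_mul]
      linarith
    · simp only [trial']
      rw [norm_mul, Side.norm_sign, one_mul]
      refine (norm_add_le_of_le p10 p01).trans ?_
      linarith
    · simp only [trialDefect]
      rw [norm_mul, Side.norm_sign, one_mul]
      refine (norm_add_le_of_le p20 (?_ : _ ≤ 2 * (6 * (Q * (a * w))))).trans ?_
      · rw [norm_mul, Complex.norm_ofNat]
        linarith
      · linarith

theorem summable_trialSize {χ : ℤ → ℝ} {b d : ℤ → ℂ}
    (h : Summable fun j => ((|χ j| + |χ (j + 1)|) * (‖b j‖ + ‖d j‖)) ^ 2) :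
    Summable fun e => trialSize χ b d e ^ 2 :=
  summable_edge h fun _ => h

/-- The trial family defines an element of the domain. -/
theorem exists_trial {L μ : ℝ} (hL : 0 < L) (hμ : 0 < μ) (l : ℝ) {χ : ℤ → ℝ} {b d : ℤ → ℂ}
    (hb : ∀ j, sinSol l (L / 2) * b (j + 1)
      = sinSol l (L / 2) * b j * cosSol l 1 + d j * sinSol l 1)
    (hd : ∀ j, χ j * (d j - railSol' L l b d (j - 1) j
      - weight μ (.rung j) * (cosSol l (L / 2) * b j)) = 0)
    (hs : Summable fun j => ((|χ j| + |χ (j + 1)|) * (‖b j‖ + ‖d j‖)) ^ 2) :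
    ∃ U F : antisymmetric L μ, (U, F) ∈ (antisymmetricOperator L μ).graph ∧
      (∀ e, (U : L2Graph L μ) e =ᵐ[edgeMeasure L μ e] trial L l χ b d e) ∧
      ∀ e, ((F - (l : ℂ) • U : antisymmetric L μ) : L2Graph L μ) e
        =ᵐ[edgeMeasure L μ e] -trialDefect L l χ b d e := by
  obtain ⟨M, hM, hMb⟩ := exists_trial_bound hL l
  have hk : Summable fun e => (M * trialSize χ b d e) ^ 2 := by
    simp only [mul_pow]
    exact (summable_trialSize hs).mul_left _
  obtain ⟨U, hU⟩ := exists_L2Graph (μ := μ) hL hμ (continuous_trial L l χ b d) hk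
    fun e x hx => (hMb χ b d e x hx).1
  obtain ⟨d₁, hd₁⟩ := exists_L2Graph (μ := μ) hL hμ (g := trial' L l χ b d)
    (fun e => continuous_iff_continuousAt.2 fun x => (hasDerivAt_trial' L l χ b d e x).continuousAt)
    hk fun e x hx => (hMb χ b d e x hx).2.1
  obtain ⟨D, hD⟩ := exists_L2Graph (μ := μ) hL hμ (continuous_trialDefect L l χ b d) hk
    fun e x hx => (hMb χ b d e x hx).2.2
  have hUa : U ∈ antisymmetric L μ := by
    refine ⟨fun j => ?_, fun j => ?_⟩
    · filter_upwards [hU (.rung j), (quasiMeasurePreserving_neg_rung L μ j).ae (hU (.rung j))]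
        with y h1 h2
      rw [h1, h2]
      simp [trial, sinSol_neg]
    · have h0 : ∀ᵐ x ∂(edgeMeasure L μ (.rail .upper j)), U (.rail .lower j) x
        = trial L l χ b d (.rail .lower j) x := hU (.rail .lower j)
      filter_upwards [hU (.rail .upper j), h0] with y h1 h2
      rw [h1, h2]
      simp [trial, Side.sign]
  have hDa : D ∈ antisymmetric L μ := by
    refine ⟨fun j => ?_, fun j => ?_⟩
    · filter_upwards [hD (.rung j), (quasiMeasurePreserving_neg_rung L μ j).ae (hD (.rung j))]
        with y h1 h2
      rw [h1, h2]
      simp [trialDefect]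
    · have h0 : ∀ᵐ x ∂(edgeMeasure L μ (.rail .upper j)), D (.rail .lower j) x
        = trialDefect L l χ b d (.rail .lower j) x := hD (.rail .lower j)
      filter_upwards [hD (.rail .upper j), h0] with y h1 h2
      rw [h1, h2]
      simp only [trialDefect, Side.sign]
      push_cast
      ring
  refine ⟨⟨U, hUa⟩, (l : ℂ) • ⟨U, hUa⟩ - ⟨D, hDa⟩, ?_, hU, fun e => ?_⟩
  · rw [mem_antisymmetricOperator_graph]
    refine ⟨trial L l χ b d, trial' L l χ b d,
      fun e x => trialDefect L l χ b d e x - l * trial L l χ b d e x, ⟨fun e => ?_, fun s j => ?_,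
        fun s j => ?_, fun s j => ?_⟩, hU, ⟨d₁, hd₁⟩, fun e => ?_⟩
    · exact IsH2On.of_hasDerivAt (hasDerivAt_trial L l χ b d e) (hasDerivAt_trial' L l χ b d e)
        ((continuous_trialDefect L l χ b d e).sub
          (continuous_const.mul (continuous_trial L l χ b d e))) _ _
    · have : sinSol l (s.sign * (L / 2)) = s.sign * sinSol l (L / 2) := by
        cases s <;> simp [Side.sign, sinSol_neg]
      simp only [trial, cutoff, railSol, this]
      simp
      ring
    · have : sinSol l (s.sign * (L / 2)) = s.sign * sinSol l (L / 2) := by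
        cases s <;> simp [Side.sign, sinSol_neg]
      have h1 := hb (j - 1)
      rw [sub_add_cancel] at h1
      have e : (j : ℝ) - ((j - 1 : ℤ) : ℝ) = 1 := by push_cast; ring
      simp only [trial, cutoff, railSol, this, e, sub_add_cancel]
      push_cast
      linear_combination (-(s.sign : ℂ) * χ j) * h1
    -- The cubic cutoff has zero slope at both ends of a rail, so the slopes at a vertex are `χ j`
    -- times those of the uncut solutions. This is why the Kirchhoff relation is only required after
    -- multiplication by `χ j`.
    · have hc : cosSol l (s.sign * (L / 2)) = cosSol l (L / 2) := by
        cases s <;> simp [Side.sign, cosSol_neg]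
      have e : (j : ℝ) - ((j - 1 : ℤ) : ℝ) = 1 := by push_cast; ring
      have h1 := hd j
      simp only [railSol', e] at h1
      simp only [trial', cutoff, cutoff', railSol, railSol', hc, e, sub_add_cancel, sub_self,
        cosSol_zero_right, sinSol_zero_right]
      simp only [weight] at h1 ⊢
      push_cast at h1 ⊢
      linear_combination (s.sign : ℂ) * h1
    · have h1 : (((l : ℂ) • ⟨U, hUa⟩ - ⟨D, hDa⟩ : antisymmetric L μ) : L2Graph L μ) e
        = (l : ℂ) • U e - D e := rfl
      change ((((l : ℂ) • ⟨U, hUa⟩ - ⟨D, hDa⟩ : antisymmetric L μ) : L2Graph L μ) e : ℝ → ℂ)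
        =ᵐ[edgeMeasure L μ e] _
      rw [h1]
      filter_upwards [Lp.coeFn_sub ((l : ℂ) • U e) (D e), Lp.coeFn_smul (l : ℂ) (U e), hU e, hD e]
        with x h1 h2 h3 h4
      rw [h1, Pi.sub_apply, h2, Pi.smul_apply, h3, h4, Pi.neg_apply, smul_eq_mul]
      ring
  · rw [sub_sub_cancel_left]
    have h1 : ((-⟨D, hDa⟩ : antisymmetric L μ) : L2Graph L μ) e = -D e := rfl
    rw [h1]
    filter_upwards [Lp.coeFn_neg (D e), hD e] with x h1 h2
    rw [h1, Pi.neg_apply, Pi.neg_apply, h2]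

/-! ### Singular sequences in the bands -/

theorem exists_unimodular_add_inv {g : ℝ} (h : |g| ≤ 1) :
    ∃ q : ℂ, ‖q‖ = 1 ∧ q + q⁻¹ = 2 * g := by
  refine ⟨Complex.exp (Real.arccos g * Complex.I), Complex.norm_exp_ofReal_mul_I _, ?_⟩
  rw [← Complex.exp_neg, ← neg_mul, ← Complex.two_cos, ← Complex.ofReal_cos,
    Real.cos_arccos (abs_le.1 h).1 (abs_le.1 h).2]

/-- For `s ≠ 0` the number `N / (2 s)` lies in `[-1, 1]` and is the cosine of the phase of `q`. If
`s = 0`, the band condition forces `N = 0` and the choice of `q` is immaterial. -/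
theorem exists_unimodular_discr {L l : ℝ} (hl : l ∉ resolventRegion L) :
    ∃ q : ℂ, ‖q‖ = 1 ∧ sinSol l (L / 2) * (q + q⁻¹) = discr L l := by
  have hN : |discr L l| ≤ 2 * |sinSol l (L / 2)| := not_lt.1 hl
  by_cases h0 : sinSol l (L / 2) = 0
  · rw [h0, abs_zero, mul_zero] at hN
    refine ⟨1, norm_one, ?_⟩
    rw [abs_nonpos_iff.1 hN, h0]
    simp
  · obtain ⟨q, h1, h2⟩ := exists_unimodular_add_inv (g := discr L l / (2 * sinSol l (L / 2))) (by
      rw [abs_div, abs_mul, abs_two]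
      exact div_le_one_of_le₀ hN (by positivity))
    refine ⟨q, h1, ?_⟩
    have h0' : (sinSol l (L / 2) : ℂ) ≠ 0 := by exact_mod_cast h0
    rw [h2]
    push_cast
    field_simp

/-- Data `b q ^ j`, `d q ^ j` satisfy the unperturbed relations exactly when `(b, d)` lies in the
kernel of a two by two matrix. Its determinant is `N - s (q + q⁻¹)`, which vanishes for a suitable
`q` on the unit circle. -/
theorem exists_bloch {L l : ℝ} (hl : l ∉ resolventRegion L) :
    ∃ q b d : ℂ, ‖q‖ = 1 ∧ (b ≠ 0 ∨ d ≠ 0) ∧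
      sinSol l (L / 2) * (q * b) = sinSol l (L / 2) * b * cosSol l 1 + d * sinSol l 1 ∧
      d - q⁻¹ * (-l * (sinSol l (L / 2) * b) * sinSol l 1 + d * cosSol l 1)
        - cosSol l (L / 2) * b = 0 := by
  set s := sinSol l (L / 2) with hs
  set c := cosSol l (L / 2) with hc
  set C := cosSol l 1 with hC
  set σ := sinSol l 1 with hσ
  obtain ⟨q, hq1, hq⟩ := exists_unimodular_discr hl
  rw [← hs] at hq
  have hq0 : q ≠ 0 := by
    rintro rfl
    simp at hq1
  have hcs : (C : ℂ) ^ 2 + l * (σ : ℂ) ^ 2 = 1 := by exact_mod_cast cosSol_sq_add l 1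
  have hdet : (!![(s * (C - q) : ℂ), σ; l * σ * s * q⁻¹ - c, 1 - q⁻¹ * C]).det = 0 := by
    rw [Matrix.det_fin_two_of]
    have e : (discr L l : ℂ) = 2 * C * s + σ * c := by simp [discr, hs, hc, hC, hσ]
    rw [e] at hq
    have hqq : q * q⁻¹ = 1 := mul_inv_cancel₀ hq0
    linear_combination -hq + (-s * q⁻¹) * hcs + (s * C) * hqq
  obtain ⟨v, hv0, hv⟩ := Matrix.exists_mulVec_eq_zero_iff.2 hdet
  have h1 := congrFun hv 0
  have h2 := congrFun hv 1
  simp [Matrix.mulVec, dotProduct, Fin.sum_univ_two] at h1 h2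
  refine ⟨q, v 0, v 1, hq1, ?_, ?_, ?_⟩
  · by_contra! h
    refine hv0 ?_
    funext i
    fin_cases i
    · exact h.1
    · exact h.2
  · linear_combination -h1
  · linear_combination h2

theorem norm_sq_eq_integral {L μ : ℝ} (hμ : 0 < μ) (e : Edge) {G : Lp ℂ 2 (edgeMeasure L μ e)}
    {g : ℝ → ℂ} (h : G =ᵐ[edgeMeasure L μ e] g) :
    ‖G‖ ^ 2 = weight μ e * ∫ x in Ioo (e.lo L) (e.hi L), ‖g x‖ ^ 2 := by
  rw [← integral_edgeMeasure hμ, ← integral_congr_ae (f := fun x => ‖G x‖ ^ 2)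
    (h.mono fun x hx => by simp only [hx])]
  have h1 := inner_self_eq_norm_sq_to_K (𝕜 := ℂ) G
  rw [L2.inner_def] at h1
  simp only [inner_self_eq_norm_sq_to_K] at h1
  have h2 : ∫ x, ((‖G x‖ : ℂ)) ^ 2 ∂(edgeMeasure L μ e) = (‖G‖ : ℂ) ^ 2 := h1
  norm_cast at h2
  exact h2.symm

theorem integral_norm_sq_pos {g g' : ℝ → ℂ} (hg : ∀ x, HasDerivAt g (g' x) x) {a b x₀ : ℝ}
    (hx₀ : x₀ ∈ Ioo a b) (h : g x₀ ≠ 0 ∨ g' x₀ ≠ 0) : 0 < ∫ x in Ioo a b, ‖g x‖ ^ 2 := by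
  have hc : Continuous g := continuous_iff_continuousAt.2 fun x => (hg x).continuousAt
  have hint : IntegrableOn (fun x => ‖g x‖ ^ 2) (Ioo a b) :=
    ((hc.norm.pow 2).integrableOn_Icc).mono_set Ioo_subset_Icc_self
  refine lt_of_le_of_ne (integral_nonneg fun x => sq_nonneg _) fun h0 => ?_
  have h1 := (integral_eq_zero_iff_of_nonneg (fun x => sq_nonneg _) hint).1 h0.symm
  have h2 : EqOn g 0 (Icc a b) := by
    refine Measure.eqOn_Icc_of_ae_eq volume (hx₀.1.trans hx₀.2).ne ?_ hc.continuousOn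
      continuousOn_const
    rw [← restrict_Ioo_eq_restrict_Icc]
    exact h1.mono fun x hx => by simpa using hx
  have h3 : g =ᶠ[𝓝 x₀] fun _ => 0 := by
    filter_upwards [Ioo_mem_nhds hx₀.1 hx₀.2] with x hx using h2 (Ioo_subset_Icc_self hx)
  rcases h with h | h
  · exact h (h2 (Ioo_subset_Icc_self hx₀))
  · exact h ((hg x₀).unique ((hasDerivAt_const x₀ (0 : ℂ)).congr_of_eventuallyEq h3))

theorem tendsto_inner_of_orthonormal {H : Type*} [NormedAddCommGroup H] [InnerProductSpace ℂ H]
    {e : ℕ → H} (he : Orthonormal ℂ e) (v : H) :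
    Tendsto (fun n => inner ℂ v (e n)) atTop (𝓝 0) := by
  have h1 := (he.inner_products_summable (x := v)).tendsto_atTop_zero
  rw [tendsto_zero_iff_norm_tendsto_zero]
  have h2 := h1.sqrt
  simp only [Real.sqrt_zero, Real.sqrt_sq (norm_nonneg _)] at h2
  refine h2.congr fun n => ?_
  rw [norm_inner_symm]

/-- Orthogonal approximate eigenvectors form a singular sequence. -/
theorem mem_essentialSpectrumPMap_of_orthogonal {H : Type*} [NormedAddCommGroup H]
    [InnerProductSpace ℂ H] {A : H →ₗ.[ℂ] H} {z : ℂ} {U F : ℕ → H}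
    (hg : ∀ n, (U n, F n) ∈ A.graph) (h0 : ∀ n, U n ≠ 0)
    (ho : Pairwise fun n m => inner ℂ (U n) (U m) = 0)
    (ht : Tendsto (fun n => ‖F n - z • U n‖ / ‖U n‖) atTop (𝓝 0)) :
    z ∈ LinearPMap.essentialSpectrumPMap A := by
  have hg' : ∀ n, ((‖U n‖ : ℂ)⁻¹ • U n, (‖U n‖ : ℂ)⁻¹ • F n) ∈ A.graph := fun n =>
    A.graph.smul_mem _ (hg n)
  choose y hy1 hy2 using fun n => (LinearPMap.mem_graph_iff A).1 (hg' n)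
  have hnorm : ∀ n, ‖((‖U n‖ : ℂ)⁻¹ • U n : H)‖ = 1 := fun n => by
    rw [norm_smul, norm_inv, Complex.norm_real, norm_norm, inv_mul_cancel₀ (norm_ne_zero_iff.2 (h0 n))]
  have hon : Orthonormal ℂ fun n => ((‖U n‖ : ℂ)⁻¹ • U n : H) := by
    refine ⟨hnorm, fun n m hnm => ?_⟩
    change inner ℂ ((‖U n‖ : ℂ)⁻¹ • U n) ((‖U m‖ : ℂ)⁻¹ • U m) = 0
    rw [inner_smul_left, inner_smul_right, ho hnm, mul_zero, mul_zero]
  refine ⟨y, ⟨1, one_pos, fun n => ?_⟩, fun v => ?_, ?_⟩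
  · rw [hy1 n, hnorm n]
  · simp only [hy1]
    exact tendsto_inner_of_orthonormal hon v
  · rw [tendsto_zero_iff_norm_tendsto_zero]
    refine ht.congr fun n => ?_
    rw [hy2 n, hy1 n, smul_comm, ← smul_sub, norm_smul, norm_inv, Complex.norm_real, norm_norm,
      div_eq_inv_mul]

/-- The indicator of a block of vertices. -/
def block (n : ℕ) (j : ℤ) : ℝ :=
  if ((n : ℤ) + 1) ^ 2 < j ∧ j ≤ ((n : ℤ) + 1) ^ 2 + n + 2 then 1 else 0

theorem block_zero (n : ℕ) : block n 0 = 0 :=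
  if_neg fun h => absurd h.1 (not_lt.2 (sq_nonneg _))

theorem abs_block_le (n : ℕ) (j : ℤ) : |block n j| ≤ 1 := by
  unfold block; split_ifs <;> simp

/-- The `n`-th block starts just after `(n + 1)²` and has `n + 2` vertices, fewer than the distance
`2 n + 3` between consecutive squares. So different blocks meet disjoint sets of cells, which gives
orthogonality. -/
theorem block_support {n : ℕ} {j : ℤ} (h : block n j ≠ 0 ∨ block n (j + 1) ≠ 0) :
    ((n : ℤ) + 1) ^ 2 ≤ j ∧ j < ((n : ℤ) + 2) ^ 2 := by
  have gen : ∀ i : ℤ, block n i ≠ 0 → ((n : ℤ) + 1) ^ 2 < i ∧ i ≤ ((n : ℤ) + 1) ^ 2 + n + 2 := by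
    intro i hi
    by_contra h
    exact hi (if_neg h)
  rcases h with h | h
  · have h1 := gen j h
    exact ⟨h1.1.le, by nlinarith [h1.2]⟩
  · have h1 := gen (j + 1) h
    exact ⟨by linarith [h1.1], by nlinarith [h1.2]⟩

theorem block_disjoint {n m : ℕ} {j : ℤ} (hn : block n j ≠ 0 ∨ block n (j + 1) ≠ 0)
    (hm : block m j ≠ 0 ∨ block m (j + 1) ≠ 0) : n = m := by
  have h1 := block_support hn
  have h2 := block_support hm
  by_contra hnm
  rcases Nat.lt_or_gt_of_ne hnm with h | h
  · have : (n : ℤ) + 2 ≤ m + 1 := by exact_mod_cast Nat.succ_le_succ h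
    nlinarith [h1.2, h2.1]
  · have : (m : ℤ) + 2 ≤ n + 1 := by exact_mod_cast Nat.succ_le_succ h
    nlinarith [h1.1, h2.2]

theorem block_eq {n : ℕ} {j : ℤ} (h1 : j ≠ ((n : ℤ) + 1) ^ 2)
    (h2 : j ≠ ((n : ℤ) + 1) ^ 2 + n + 2) : block n (j + 1) = block n j := by
  unfold block
  have : (((n : ℤ) + 1) ^ 2 < j + 1 ∧ j + 1 ≤ ((n : ℤ) + 1) ^ 2 + n + 2) ↔
      (((n : ℤ) + 1) ^ 2 < j ∧ j ≤ ((n : ℤ) + 1) ^ 2 + n + 2) := by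
    generalize ((n : ℤ) + 1) ^ 2 = a at *
    omega
  simp only [this]

theorem block_eq_one {n : ℕ} {j : ℤ}
    (hj : j ∈ Finset.Ioc (((n : ℤ) + 1) ^ 2) (((n : ℤ) + 1) ^ 2 + n + 1)) :
    block n j = 1 ∧ block n (j + 1) = 1 := by
  rw [Finset.mem_Ioc] at hj
  exact ⟨if_pos ⟨hj.1, by linarith⟩, if_pos ⟨by linarith, by linarith⟩⟩

/-- A Bloch solution is cut off to the `n`-th block. The commutator with the cutoff lives on the
rails at the two ends of the block, so the defect stays bounded, while the square of the norm is at
least `(n + 1) m` because each interior cell contributes the same amount `m`. All blocks avoid rung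
`0`, hence the value of `μ` plays no role. -/
theorem mem_essentialSpectrum_of_notMem {L μ : ℝ} (hL : 0 < L) (hμ : 0 < μ) {l : ℝ}
    (hl : l ∉ resolventRegion L) :
    (l : ℂ) ∈ LinearPMap.essentialSpectrumPMap (antisymmetricOperator L μ) := by
  obtain ⟨q, b₀, d₀, hq, hbd, e1, e2⟩ := exists_bloch hl
  have hq0 : q ≠ 0 := by rintro rfl; simp at hq
  have hqn (j : ℤ) : ‖q ^ j‖ = 1 := by rw [norm_zpow, hq, one_zpow]
  set b : ℤ → ℂ := fun j => b₀ * q ^ j with hb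
  set d : ℤ → ℂ := fun j => d₀ * q ^ j with hd
  have hbn (j) : ‖b j‖ = ‖b₀‖ := by simp only [hb]; rw [norm_mul, hqn, mul_one]
  have hdn (j) : ‖d j‖ = ‖d₀‖ := by simp only [hd]; rw [norm_mul, hqn, mul_one]
  have hsz (n : ℕ) (e : Edge) : trialSize (block n) b d e ≤ 2 * (‖b₀‖ + ‖d₀‖) := by
    have gen : ∀ j, (|block n j| + |block n (j + 1)|) * (‖b j‖ + ‖d j‖) ≤ 2 * (‖b₀‖ + ‖d₀‖) := by
      intro j
      rw [hbn, hdn]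
      refine mul_le_mul_of_nonneg_right ?_ (by positivity)
      linarith [abs_block_le n j, abs_block_le n (j + 1)]
    cases e <;> exact gen _
  have hex : ∀ n : ℕ, ∃ U F : antisymmetric L μ, (U, F) ∈ (antisymmetricOperator L μ).graph ∧
      (∀ e, (U : L2Graph L μ) e =ᵐ[edgeMeasure L μ e] trial L l (block n) b d e) ∧
      ∀ e, ((F - (l : ℂ) • U : antisymmetric L μ) : L2Graph L μ) e
        =ᵐ[edgeMeasure L μ e] -trialDefect L l (block n) b d e := by
    intro n
    refine exists_trial hL hμ l (fun j => ?_) (fun j => ?_) ?_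
    · simp only [hb, hd]
      rw [zpow_add_one₀ hq0]
      linear_combination q ^ j * e1
    · by_cases hj : j = 0
      · rw [hj, block_zero]; simp
      · have e : (j : ℝ) - ((j - 1 : ℤ) : ℝ) = 1 := by push_cast; ring
        simp only [hb, hd, railSol', weight, if_neg hj, e]
        rw [zpow_sub_one₀ hq0]
        push_cast
        linear_combination (block n j * q ^ j) * e2
    · refine summable_of_ne_finset_zero (s := Finset.Ico (((n : ℤ) + 1) ^ 2) (((n : ℤ) + 2) ^ 2))
        fun j hj => ?_
      have h1 : block n j = 0 ∧ block n (j + 1) = 0 := by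
        by_contra! h
        refine hj (Finset.mem_Ico.2 (block_support ?_))
        by_cases h0 : block n j = 0
        · exact Or.inr (h h0)
        · exact Or.inl h0
      rw [h1.1, h1.2]
      simp
  choose U F hUF hU hD using hex
  obtain ⟨M, hM, hMb⟩ := exists_trial_bound hL l
  obtain ⟨K₂, hK₂, hnorm⟩ := exists_norm_le_of_bound hL hμ
  set K₃ := K₂ * (M * (2 * (‖b₀‖ + ‖d₀‖))) with hK₃
  have hK₃0 : 0 ≤ K₃ := by positivity
  -- the defect is bounded
  have hdef : ∀ n, ‖F n - (l : ℂ) • U n‖ ≤ 2 * K₃ := by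
    intro n
    set D := ((F n - (l : ℂ) • U n : antisymmetric L μ) : L2Graph L μ) with hDd
    have z : ∀ e, (∀ x, trialDefect L l (block n) b d e x = 0) → ‖D e‖ ^ 2 = 0 := by
      intro e he
      have : D e = 0 := by
        refine Lp.ext ?_
        filter_upwards [hD n e, Lp.coeFn_zero ℂ 2 (edgeMeasure L μ e)] with x h1 h2
        rw [h2, h1, Pi.neg_apply, he x]
        simp
      rw [this]; simp
    have bd : ∀ e, ‖D e‖ ^ 2 ≤ K₃ ^ 2 := by
      intro e
      refine pow_le_pow_left₀ (norm_nonneg _) (hnorm e _ (M * (2 * (‖b₀‖ + ‖d₀‖))) (by positivity)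
        ?_) 2
      filter_upwards [hD n e, ae_edgeMeasure_of_forall (L := L) hμ e fun x hx =>
        (hMb (block n) b d e x (Ioo_subset_Icc_self hx)).2.2] with x h1 h2
      rw [h1, Pi.neg_apply, norm_neg]
      exact h2.trans (mul_le_mul_of_nonneg_left (hsz n e) hM.le)
    have hrail : ∀ s, ∑' j, ‖D (.rail s j)‖ ^ 2 ≤ 2 * K₃ ^ 2 := by
      intro s
      rw [tsum_eq_sum (s := {((n : ℤ) + 1) ^ 2, ((n : ℤ) + 1) ^ 2 + n + 2})]
      · refine (Finset.sum_le_card_nsmul _ _ _ fun j _ => bd _).trans ?_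
        rw [nsmul_eq_mul]
        refine mul_le_mul_of_nonneg_right ?_ (sq_nonneg _)
        exact_mod_cast Finset.card_le_two
      · intro j hj
        simp only [Finset.mem_insert, Finset.mem_singleton, not_or] at hj
        refine z _ fun x => ?_
        simp [trialDefect, cutoff', cutoff'', block_eq hj.1 hj.2]
    have hrung : ∑' j, ‖D (.rung j)‖ ^ 2 = 0 := by
      rw [tsum_congr fun j => z (.rung j) fun x => rfl, tsum_zero]
    have e : ‖F n - (l : ℂ) • U n‖ ^ 2 = ∑' e, ‖D e‖ ^ 2 := norm_sq_eq_tsum D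
    rw [tsum_edge (summable_norm_sq D), hrung] at e
    have h1 := hrail .upper
    have h2 := hrail .lower
    -- Two rails carry the commutator on each side of the ladder, so the square is at most `4 K₃²`.
    refine abs_le_of_sq_le_sq' ?_ (by positivity) |>.2
    rw [e, mul_pow]
    linarith
  -- the norm of the trial function grows
  set m := (∫ y in Ioo (-L / 2) (L / 2), ‖b₀ * sinSol l y‖ ^ 2)
    + ∫ x in Ioo (0 : ℝ) 1, ‖sinSol l (L / 2) * b₀ * cosSol l x + d₀ * sinSol l x‖ ^ 2 with hm
  have hm0 : 0 < m := by
    have p1 : 0 ≤ ∫ y in Ioo (-L / 2) (L / 2), ‖b₀ * sinSol l y‖ ^ 2 :=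
      integral_nonneg fun x => sq_nonneg _
    have p2 : 0 ≤ ∫ x in Ioo (0 : ℝ) 1,
        ‖sinSol l (L / 2) * b₀ * cosSol l x + d₀ * sinSol l x‖ ^ 2 :=
      integral_nonneg fun x => sq_nonneg _
    have hS (x : ℝ) := (hasDerivAt_sinSol l x).ofReal_comp
    by_cases hb0 : b₀ = 0
    · have hd0 : d₀ ≠ 0 := hbd.resolve_left (not_not.2 hb0)
      refine add_pos_of_nonneg_of_pos p1 ?_
      simp only [hb0, mul_zero, zero_mul, zero_add]
      refine integral_norm_sq_pos (fun x => (hS x).const_mul d₀) (x₀ := 1 / 2)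
        ⟨by norm_num, by norm_num⟩ ?_
      by_contra! h
      have h1 := cosSol_sq_add l (1 / 2)
      have h2 : sinSol l (1 / 2) = 0 := by simpa [hd0] using h.1
      have h3 : cosSol l (1 / 2) = 0 := by simpa [hd0] using h.2
      rw [h2, h3] at h1
      simp at h1
    · refine add_pos_of_pos_of_nonneg (integral_norm_sq_pos (fun x => (hS x).const_mul b₀)
        (x₀ := 0) ⟨by linarith, by linarith⟩ (Or.inr ?_)) p2
      simpa using hb0
  have hlow : ∀ n : ℕ, ((n : ℝ) + 1) * m ≤ ‖U n‖ ^ 2 := by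
    intro n
    have e : ‖U n‖ ^ 2 = ∑' e, ‖(U n : L2Graph L μ) e‖ ^ 2 := norm_sq_eq_tsum _
    have hs := summable_norm_sq (U n : L2Graph L μ)
    rw [e, tsum_edge hs]
    have hs1 : Summable fun j => ‖(U n : L2Graph L μ) (.rung j)‖ ^ 2 :=
      hs.comp_injective rung_injective
    have hs2 : Summable fun j => ‖(U n : L2Graph L μ) (.rail .upper j)‖ ^ 2 :=
      hs.comp_injective (rail_injective .upper)
    set S := Finset.Ioc (((n : ℤ) + 1) ^ 2) (((n : ℤ) + 1) ^ 2 + n + 1) with hS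
    have hcard : ((S.card : ℕ) : ℝ) = n + 1 := by
      rw [hS, Int.card_Ioc]
      have : ((n : ℤ) + 1) ^ 2 + n + 1 - ((n : ℤ) + 1) ^ 2 = ((n + 1 : ℕ) : ℤ) := by
        push_cast; ring
      rw [this, Int.toNat_natCast]
      push_cast
      rfl
    have l1 := hs1.sum_le_tsum S fun j _ => sq_nonneg _
    have l2 := hs2.sum_le_tsum S fun j _ => sq_nonneg _
    have l3 : 0 ≤ ∑' j, ‖(U n : L2Graph L μ) (.rail .lower j)‖ ^ 2 :=
      tsum_nonneg fun j => sq_nonneg _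
    have k1 : ∀ j ∈ S, ‖(U n : L2Graph L μ) (.rung j)‖ ^ 2
        = ∫ y in Ioo (-L / 2) (L / 2), ‖b₀ * sinSol l y‖ ^ 2 := by
      intro j hj
      have hj0 : j ≠ 0 := by
        rw [hS, Finset.mem_Ioc] at hj
        exact ((sq_nonneg _).trans_lt hj.1).ne'
      rw [norm_sq_eq_integral hμ _ (hU n _)]
      simp only [weight, if_neg hj0, one_mul, trial, (block_eq_one hj).1, Edge.lo, Edge.hi, norm_mul,
        hbn]
      simp
    have k2 : ∀ j ∈ S, ‖(U n : L2Graph L μ) (.rail .upper j)‖ ^ 2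
        = ∫ x in Ioo (0 : ℝ) 1,
          ‖sinSol l (L / 2) * b₀ * cosSol l x + d₀ * sinSol l x‖ ^ 2 := by
      intro j hj
      rw [norm_sq_eq_integral hμ _ (hU n _)]
      have pt : ∀ x : ℝ, ‖trial L l (block n) b d (.rail .upper j) x‖
          = ‖sinSol l (L / 2) * b₀ * cosSol l (x - j) + d₀ * sinSol l (x - j)‖ := by
        intro x
        have : trial L l (block n) b d (.rail .upper j) x = q ^ j *
            (sinSol l (L / 2) * b₀ * cosSol l (x - j) + d₀ * sinSol l (x - j)) := by
          simp only [trial, cutoff, (block_eq_one hj).1, (block_eq_one hj).2, railSol, hb, hd,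
            Side.sign]
          push_cast
          ring
        rw [this, norm_mul, hqn, one_mul]
      simp only [pt, weight, one_mul, Edge.lo, Edge.hi]
      rw [← integral_Ioc_eq_integral_Ioo, ← integral_Ioc_eq_integral_Ioo,
        ← intervalIntegral.integral_of_le (by linarith),
        ← intervalIntegral.integral_of_le (by norm_num),
        intervalIntegral.integral_comp_sub_right (fun x : ℝ =>
          ‖sinSol l (L / 2) * b₀ * cosSol l x + d₀ * sinSol l x‖ ^ 2) (j : ℝ)]
      simp
    rw [Finset.sum_congr rfl k1, Finset.sum_const, nsmul_eq_mul, hcard] at l1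
    rw [Finset.sum_congr rfl k2, Finset.sum_const, nsmul_eq_mul, hcard] at l2
    rw [hm, mul_add]
    linarith
  have hUpos : ∀ n, 0 < ‖U n‖ := by
    intro n
    have h1 : 0 < ((n : ℝ) + 1) * m := by positivity
    refine lt_of_le_of_ne (norm_nonneg _) fun h0 => ?_
    have h2 := h1.trans_le (hlow n)
    rw [← h0] at h2
    simp at h2
  refine mem_essentialSpectrumPMap_of_orthogonal hUF (fun n => norm_pos_iff.1 (hUpos n)) ?_ ?_
  · intro n m hnm
    have e : inner ℂ (U n) (U m)
      = ∑' e, inner ℂ ((U n : L2Graph L μ) e) ((U m : L2Graph L μ) e) := by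
      rw [Submodule.coe_inner]; exact lp.inner_eq_tsum _ _
    have hz : ∀ (n : ℕ) (e : Edge), (∀ x, trial L l (block n) b d e x = 0) →
        (U n : L2Graph L μ) e = 0 := by
      intro n e he
      refine Lp.ext ?_
      filter_upwards [hU n e, Lp.coeFn_zero ℂ 2 (edgeMeasure L μ e)] with x h1 h2
      rw [h2, h1, he x]
      rfl
    have hz' : ∀ (n : ℕ) (j : ℤ), ¬ (block n j ≠ 0 ∨ block n (j + 1) ≠ 0) →
        (U n : L2Graph L μ) (.rung j) = 0 ∧ ∀ s, (U n : L2Graph L μ) (.rail s j) = 0 := by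
      intro n j h
      push Not at h
      refine ⟨hz _ _ fun x => ?_, fun s => hz _ _ fun x => ?_⟩
      · simp [trial, h.1]
      · simp [trial, cutoff, h.1, h.2]
    have hj : ∀ j : ℤ, ¬ (block n j ≠ 0 ∨ block n (j + 1) ≠ 0) ∨
        ¬ (block m j ≠ 0 ∨ block m (j + 1) ≠ 0) := by
      intro j
      by_contra! h
      exact hnm (block_disjoint h.1 h.2)
    rw [e]
    convert tsum_zero with e
    cases e with
    | rung j =>
      rcases hj j with h | h
      · rw [(hz' n j h).1, inner_zero_left]
      · rw [(hz' m j h).1, inner_zero_right]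
    | rail s j =>
      rcases hj j with h | h
      · rw [(hz' n j h).2 s, inner_zero_left]
      · rw [(hz' m j h).2 s, inner_zero_right]
  · have hlim : Tendsto (fun n : ℕ => 2 * K₃ / √(((n : ℝ) + 1) * m)) atTop (𝓝 0) := by
      refine Tendsto.div_atTop tendsto_const_nhds ?_
      refine Real.tendsto_sqrt_atTop.comp ?_
      exact (tendsto_atTop_add_const_right _ _ tendsto_natCast_atTop_atTop).atTop_mul_const hm0
    refine squeeze_zero (fun n => by positivity) (fun n => ?_) hlim
    have h1 : 0 < √(((n : ℝ) + 1) * m) := Real.sqrt_pos.2 (by positivity)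
    refine div_le_div₀ (by positivity) (hdef n) h1 ?_
    exact Real.sqrt_le_iff.2 ⟨norm_nonneg _, hlow n⟩

/-- Along a singular sequence the defect tends to zero in norm and the functional tends to zero by
weak convergence, so the resolvent estimate would force the norms to zero. -/
theorem notMem_essentialSpectrum_of_mem {L μ : ℝ} (hL : 0 < L) (hμ : 0 < μ) {l : ℝ}
    (hl : l ∈ resolventRegion L) :
    (l : ℂ) ∉ LinearPMap.essentialSpectrumPMap (antisymmetricOperator L μ) := by
  rintro ⟨u, ⟨c, hc, hcu⟩, hw, ht⟩
  obtain ⟨K, v, h⟩ := exists_resolvent_estimate hL hμ hl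
  have h1 : Tendsto (fun n => K * (‖antisymmetricOperator L μ (u n) - (l : ℂ) • (u n : _)‖ ^ 2
      + ‖inner ℂ v (u n : antisymmetric L μ)‖ ^ 2)) atTop (𝓝 (K * (0 ^ 2 + 0 ^ 2))) := by
    refine Tendsto.const_mul K (Tendsto.add ?_ ?_)
    · simpa using (ht.norm).pow 2
    · simpa using ((hw v).norm).pow 2
  have h2 : ∀ n, c ^ 2 ≤ K * (‖antisymmetricOperator L μ (u n) - (l : ℂ) • (u n : _)‖ ^ 2
      + ‖inner ℂ v (u n : antisymmetric L μ)‖ ^ 2) := fun n =>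
    (pow_le_pow_left₀ hc.le (hcu n) 2).trans
      (h _ _ ((antisymmetricOperator L μ).mem_graph (u n)))
  have h3 := ge_of_tendsto' h1 h2
  simp only [ne_eq, OfNat.ofNat_ne_zero, not_false_eq_true, zero_pow, add_zero, mul_zero] at h3
  nlinarith

theorem mem_essentialSpectrum_iff {L μ : ℝ} (hL : 0 < L) (hμ : 0 < μ) (l : ℝ) :
    (l : ℂ) ∈ LinearPMap.essentialSpectrumPMap (antisymmetricOperator L μ)
      ↔ l ∉ resolventRegion L :=
  ⟨fun h hl => notMem_essentialSpectrum_of_mem hL hμ hl h, mem_essentialSpectrum_of_notMem hL hμ⟩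

/-! ### Eigenvalues -/

theorem isEigenvaluePMap_iff {H : Type*} [NormedAddCommGroup H] [InnerProductSpace ℂ H]
    (A : H →ₗ.[ℂ] H) (z : ℂ) :
    A.IsEigenvaluePMap z ↔ ∃ u : H, u ≠ 0 ∧ (u, z • u) ∈ A.graph := by
  constructor
  · rintro ⟨u, hu, h⟩
    exact ⟨u, hu, h ▸ A.mem_graph u⟩
  · rintro ⟨u, hu, h⟩
    obtain ⟨y, h1, h2⟩ := (LinearPMap.mem_graph_iff A).1 h
    refine ⟨y, ?_, ?_⟩
    · rwa [h1]
    · rw [h2, h1]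

/-- By the resolvent estimate, an eigenfunction orthogonal to `v` vanishes. The functional `⟨v, ·⟩`
is therefore injective on the eigenspace. -/
theorem finrank_eigenspace_eq_one {L μ : ℝ} (hL : 0 < L) (hμ : 0 < μ) {l : ℝ}
    (hl : l ∈ resolventRegion L) (h : (antisymmetricOperator L μ).IsEigenvaluePMap (l : ℂ)) :
    Module.finrank ℂ ((antisymmetricOperator L μ).eigenspacePMap (l : ℂ)) = 1 := by
  obtain ⟨K, v, hK⟩ := exists_resolvent_estimate hL hμ hl
  obtain ⟨u, hu, hug⟩ := (isEigenvaluePMap_iff _ _).1 h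
  set E := (antisymmetricOperator L μ).eigenspacePMap (l : ℂ)
  have hinj : ∀ w ∈ E, inner ℂ v w = 0 → w = 0 := by
    intro w hw h0
    have h1 := hK w ((l : ℂ) • w) hw
    rw [h0, sub_self] at h1
    simpa using h1
  refine finrank_eq_one_iff'.2 ⟨⟨u, hug⟩, fun h0 => hu (congrArg Subtype.val h0), fun w => ?_⟩
  have hne : inner ℂ v u ≠ 0 := fun h0 => hu (hinj u hug h0)
  refine ⟨inner ℂ v w.1 / inner ℂ v u, Subtype.ext ?_⟩
  change (inner ℂ v w.1 / inner ℂ v u) • u = w.1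
  have h1 : (inner ℂ v w.1 / inner ℂ v u) • u - w.1 ∈ E :=
    E.sub_mem (E.smul_mem _ hug) w.2
  have h2 : inner ℂ v ((inner ℂ v w.1 / inner ℂ v u) • u)
      = inner ℂ v w.1 / inner ℂ v u * inner ℂ v u := inner_smul_right v u _
  have h2 := hinj _ h1 (by rw [inner_sub_right, h2, div_mul_cancel₀ _ hne, sub_self])
  exact sub_eq_zero.1 h2

/-- The exact transfer relations satisfied by an eigenfunction. -/
structure IsEigenData (L μ l : ℝ) (b d : ℤ → ℂ) : Prop where
  rail : ∀ j, sinSol l (L / 2) * b (j + 1)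
    = sinSol l (L / 2) * b j * cosSol l 1 + d j * sinSol l 1
  kirchhoff : ∀ j, d j - (-l * (sinSol l (L / 2) * b (j - 1)) * sinSol l 1
    + d (j - 1) * cosSol l 1) - weight μ (.rung j) * (cosSol l (L / 2) * b j) = 0
  summable_b : Summable fun j => ‖b j‖ ^ 2
  summable_d : Summable fun j => ‖d j‖ ^ 2

/-- For `F = l U` the defect is zero, so the approximate transfer relations become equalities; the
norm bounds then show that `U` vanishes if `b` and `d` do. -/
theorem exists_isEigenData {L μ : ℝ} (hL : 0 < L) (hμ : 0 < μ) {l : ℝ} {U : antisymmetric L μ}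
    (hU : U ≠ 0) (hg : (U, (l : ℂ) • U) ∈ (antisymmetricOperator L μ).graph) :
    ∃ b d : ℤ → ℂ, IsEigenData L μ l b d ∧ ¬ (b = 0 ∧ d = 0) := by
  obtain ⟨K, v, hK, hcell⟩ := exists_isCellData (μ := μ) hL hμ l
  obtain ⟨b, p, d, h⟩ := hcell U _ hg
  have h0 (j) : cellDefect (l : ℂ) U ((l : ℂ) • U) j = 0 := by
    simp [cellDefect, defect]
  have hp (j) : p j = sinSol l (L / 2) * b j := by
    have := h.vertex j
    rw [h0, mul_zero] at this
    exact sub_eq_zero.1 (norm_le_zero_iff.1 this)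
  have hr (j) : p (j + 1) = p j * cosSol l 1 + d j * sinSol l 1 := by
    have := h.rail j
    rw [h0, mul_zero] at this
    exact sub_eq_zero.1 (norm_le_zero_iff.1 this)
  refine ⟨b, d, ⟨fun j => ?_, fun j => ?_, h.summable_b, h.summable_d⟩, ?_⟩
  · rw [← hp, ← hp, hr]
  · have := h.kirchhoff j
    rw [h0, h0, add_zero, mul_zero] at this
    rw [← hp]
    exact norm_le_zero_iff.1 this
  · rintro ⟨rfl, rfl⟩
    refine hU (Subtype.ext (lp.ext (funext fun e => ?_)))
    rw [ZeroMemClass.coe_zero, lp.coeFn_zero, Pi.zero_apply, ← norm_le_zero_iff]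
    cases e with
    | rung j =>
      have := h.norm_rung j
      rw [h0] at this
      simpa using this
    | rail s j =>
      have := h.norm_rail s j
      rw [h0, hp] at this
      simpa using this

/-- The trial family with constant cutoff `1` has no commutator, so it solves the eigenvalue
equation exactly. -/
theorem isEigenvalue_of_isEigenData {L μ : ℝ} (hL : 0 < L) (hμ : 0 < μ) {l : ℝ} {b d : ℤ → ℂ}
    (h : IsEigenData L μ l b d) :
    ∃ U : antisymmetric L μ, (U, (l : ℂ) • U) ∈ (antisymmetricOperator L μ).graph ∧
      ∀ e, (U : L2Graph L μ) e =ᵐ[edgeMeasure L μ e] trial L l (fun _ => 1) b d e := by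
  have hd : ∀ j, ((1 : ℝ) : ℂ) * (d j - railSol' L l b d (j - 1) j
      - weight μ (.rung j) * (cosSol l (L / 2) * b j)) = 0 := by
    intro j
    have e : (j : ℝ) - ((j - 1 : ℤ) : ℝ) = 1 := by push_cast; ring
    have h4 := h.kirchhoff j
    simp only [railSol', e]
    rw [h4, mul_zero]
  have hs : Summable fun j => ((|(1 : ℝ)| + |(1 : ℝ)|) * (‖b j‖ + ‖d j‖)) ^ 2 := by
    refine Summable.of_nonneg_of_le (fun j => sq_nonneg _) (fun j => ?_)
      ((h.summable_b.add h.summable_d).mul_left 8)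
    simp only [abs_one]
    nlinarith [sq_nonneg (‖b j‖ - ‖d j‖)]
  obtain ⟨U, F, h1, h2, h3⟩ := exists_trial hL hμ l (χ := fun _ => 1) h.rail hd hs
  refine ⟨U, ?_, h2⟩
  have : F = (l : ℂ) • U := by
    rw [← sub_eq_zero]
    refine Subtype.ext (lp.ext (funext fun e => Lp.ext ?_))
    filter_upwards [h3 e, Lp.coeFn_zero ℂ 2 (edgeMeasure L μ e)] with x h4 h5
    rw [h4, ZeroMemClass.coe_zero, lp.coeFn_zero, Pi.zero_apply, h5]
    cases e <;> simp [trialDefect, cutoff', cutoff'']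
  rwa [this] at h1

/-- An eigenfunction is nonzero if its traces are. -/
theorem ne_zero_of_ae_eq_trial {L μ l : ℝ} (hL : 0 < L) (hμ : 0 < μ) {b d : ℤ → ℂ} {j : ℤ}
    (hb : b j ≠ 0) {U : antisymmetric L μ}
    (hU : ∀ e, (U : L2Graph L μ) e =ᵐ[edgeMeasure L μ e] trial L l (fun _ => 1) b d e) :
    U ≠ 0 := by
  rintro rfl
  have h1 := norm_sq_eq_integral hμ _ (hU (.rung j))
  have h2 : 0 < ∫ x in Ioo (-L / 2) (L / 2), ‖trial L l (fun _ => 1) b d (.rung j) x‖ ^ 2 :=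
    integral_norm_sq_pos (fun x => hasDerivAt_trial L l (fun _ => 1) b d (.rung j) x) (x₀ := 0)
      ⟨by linarith, by linarith⟩ (Or.inr (by simpa [trial'] using hb))
  have h3 := mul_pos (weight_pos hμ (.rung j)) h2
  rw [ZeroMemClass.coe_zero, lp.coeFn_zero, Pi.zero_apply, norm_zero] at h1
  simp only [Edge.lo, Edge.hi] at h1
  simp [← h1] at h3

theorem IsEigenData.recurrence {L μ l : ℝ} {b d : ℤ → ℂ} (h : IsEigenData L μ l b d) (j : ℤ) :
    sinSol l (L / 2) * (b (j + 1) + b (j - 1)) = (2 * cosSol l 1 * sinSol l (L / 2)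
      + weight μ (.rung j) * sinSol l 1 * cosSol l (L / 2)) * b j := by
  have hcs : (cosSol l 1 : ℂ) ^ 2 + l * (sinSol l 1 : ℂ) ^ 2 = 1 := by
    exact_mod_cast cosSol_sq_add l 1
  have h1 := h.rail j
  have h2 := h.rail (j - 1)
  rw [sub_add_cancel] at h2
  have h3 := h.kirchhoff j
  linear_combination h1 - cosSol l 1 * h2 + sinSol l 1 * h3
    - sinSol l (L / 2) * b (j - 1) * hcs

/-- A decaying solution of a three term recurrence is a geometric sequence. -/
theorem eq_mul_of_recurrence {a : ℕ → ℂ} {g q : ℂ} (hq0 : q ≠ 0) (hq1 : ‖q‖ ≤ 1)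
    (hq : q + q⁻¹ = 2 * g) (ha : Tendsto a atTop (𝓝 0))
    (h : ∀ n, a (n + 2) + a n = 2 * g * a (n + 1)) (n : ℕ) : a (n + 1) = q * a n := by
  -- Since `q` and `q⁻¹` are the characteristic roots, `D` is geometric with ratio `q⁻¹`, so its
  -- norm cannot decrease; as it tends to zero it vanishes. The argument includes `|q| = 1` and the
  -- double roots `q = ±1`.
  set D : ℕ → ℂ := fun n => a (n + 1) - q * a n with hD
  have hqq : q * q⁻¹ = 1 := mul_inv_cancel₀ hq0
  have h1 : ∀ n, q * D (n + 1) = D n := by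
    intro n
    simp only [hD]
    linear_combination q * h n - q * a (n + 1) * hq + a (n + 1) * hqq
  have h2 : ∀ n k, ‖D n‖ ≤ ‖D (n + k)‖ := by
    intro n k
    induction k with
    | zero => exact le_rfl
    | succ k ih =>
      refine ih.trans ?_
      rw [← h1 (n + k), norm_mul, ← add_assoc]
      exact mul_le_of_le_one_left (norm_nonneg _) hq1
  have h3 : Tendsto (fun k => ‖D (n + k)‖) atTop (𝓝 0) := by
    have h4 : Tendsto D atTop (𝓝 (0 - q * 0)) :=
      ((tendsto_add_atTop_iff_nat 1).2 ha).sub (ha.const_mul q)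
    rw [mul_zero, sub_zero] at h4
    have h5 := ((tendsto_add_atTop_iff_nat n).2 h4).norm
    rw [norm_zero] at h5
    refine h5.congr fun k => by rw [add_comm]
  have h4 := ge_of_tendsto' h3 (h2 n)
  exact sub_eq_zero.1 (norm_le_zero_iff.1 h4)

theorem tendsto_zero_of_summable_sq {b : ℤ → ℂ} (h : Summable fun j => ‖b j‖ ^ 2)
    {f : ℕ → ℤ} (hf : Function.Injective f) : Tendsto (fun n => b (f n)) atTop (𝓝 0) := by
  have h1 := (h.comp_injective hf).tendsto_atTop_zero
  have h2 := h1.sqrt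
  rw [Real.sqrt_zero] at h2
  rw [tendsto_zero_iff_norm_tendsto_zero]
  refine h2.congr fun n => ?_
  simp [Real.sqrt_sq (norm_nonneg _)]

/-- Decay of the traces of an eigenfunction on both half ladders. -/
theorem IsEigenData.geometric {L μ l : ℝ} {b d : ℤ → ℂ} (h : IsEigenData L μ l b d) {q : ℂ}
    (hs : sinSol l (L / 2) ≠ 0) (hq0 : q ≠ 0) (hq1 : ‖q‖ ≤ 1)
    (hq : sinSol l (L / 2) * (q + q⁻¹) = discr L l) (n : ℕ) :
    b (n + 1) = q * b n ∧ b (-(n + 1)) = q * b (-n) := by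
  have hs' : (sinSol l (L / 2) : ℂ) ≠ 0 := by exact_mod_cast hs
  have hrec : ∀ j : ℤ, j ≠ 0 → b (j + 1) + b (j - 1) = 2 * ((q + q⁻¹) / 2) * b j := by
    intro j hj
    have h1 := h.recurrence j
    simp only [weight, if_neg hj] at h1
    refine mul_left_cancel₀ hs' ?_
    rw [h1]
    have h2 : (discr L l : ℂ) = 2 * cosSol l 1 * sinSol l (L / 2)
      + sinSol l 1 * cosSol l (L / 2) := by simp [discr]
    rw [h2] at hq
    push_cast
    linear_combination -b j * hq
  constructor
  · have h1 := eq_mul_of_recurrence (a := fun n : ℕ => b n) (g := (q + q⁻¹) / 2) hq0 hq1 (by ring)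
      (tendsto_zero_of_summable_sq h.summable_b Nat.cast_injective) (fun n => ?_) n
    · simpa using h1
    · have h2 := hrec (n + 1) (by positivity)
      rw [add_sub_cancel_right] at h2
      push_cast
      rw [← h2]
      ring_nf
  · have h1 := eq_mul_of_recurrence (a := fun n : ℕ => b (-n)) (g := (q + q⁻¹) / 2) hq0 hq1 (by ring)
      (tendsto_zero_of_summable_sq h.summable_b (f := fun n : ℕ => -(n : ℤ))
        fun n m hnm => by simpa using hnm) (fun n => ?_) n
    · simpa using h1
    · have h2 := hrec (-(n + 1)) (by rw [neg_ne_zero]; positivity)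
      push_cast
      rw [← h2]
      ring_nf

theorem eq_zero_of_norm_eq {a : ℕ → ℂ} (h : ∀ n, ‖a (n + 1)‖ = ‖a n‖)
    (ha : Tendsto a atTop (𝓝 0)) (n : ℕ) : a n = 0 := by
  have h1 : ∀ k, ‖a k‖ = ‖a 0‖ := by
    intro k
    induction k with
    | zero => rfl
    | succ k ih => rw [h, ih]
  have h2 : Tendsto (fun k => ‖a k‖) atTop (𝓝 ‖a 0‖) := by simp only [h1]; exact tendsto_const_nhds
  have h3 := tendsto_nhds_unique h2 (by simpa using ha.norm)
  rw [← norm_eq_zero, h1, h3]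

theorem eq_zero_of_norm_eq_int {b : ℤ → ℂ} (h : ∀ j, ‖b (j + 1)‖ = ‖b j‖)
    (hb : Summable fun j => ‖b j‖ ^ 2) : b = 0 := by
  funext j
  have h1 := eq_zero_of_norm_eq (a := fun n : ℕ => b (j + n)) (fun n => ?_)
    (tendsto_zero_of_summable_sq hb fun n m hnm => by simpa using hnm) 0
  · simpa using h1
  · have := h (j + n)
    rwa [add_assoc] at this

/-- `sinSol` and `cosSol` have no common zero. -/
theorem cosSol_ne_zero_of_sinSol_eq_zero {l x : ℝ} (h : sinSol l x = 0) : cosSol l x ≠ 0 := by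
  intro h1
  have h2 := cosSol_sq_add l x
  rw [h, h1] at h2
  norm_num at h2

theorem IsEigenData.d_eq_zero {L μ l : ℝ} {d : ℤ → ℂ} (h : IsEigenData L μ l 0 d)
    (hσ : sinSol l 1 ≠ 0) : d = 0 := by
  funext j
  have h1 := h.rail j
  simp only [Pi.zero_apply, mul_zero, zero_mul, zero_add] at h1
  exact (mul_eq_zero.1 h1.symm).resolve_right (by exact_mod_cast hσ)

theorem eq_zero_of_geometric {b : ℤ → ℂ} {q : ℂ}
    (hg : ∀ n : ℕ, b (n + 1) = q * b n ∧ b (-(n + 1)) = q * b (-n)) (h0 : b 0 = 0) : b = 0 := by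
  have key : ∀ n : ℕ, b n = 0 ∧ b (-n) = 0 := by
    intro n
    induction n with
    | zero => simpa using h0
    | succ n ih =>
      push_cast
      rw [(hg n).1, (hg n).2, ih.1, ih.2]
      simp
  funext j
  obtain ⟨n, rfl | rfl⟩ := j.eq_nat_or_neg
  · exact (key n).1
  · exact (key n).2

/-- There are no eigenvalues in the bands, except for the common zeros of `sinSol l 1` and
`sinSol l (L / 2)`. -/
theorem IsEigenData.eq_zero_of_notMem {L μ l : ℝ} {b d : ℤ → ℂ} (h : IsEigenData L μ l b d)
    (hl : l ∉ resolventRegion L) (hne : sinSol l 1 ≠ 0 ∨ sinSol l (L / 2) ≠ 0) :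
    b = 0 ∧ d = 0 := by
  -- For `σ = 0` one has `C = ±1`. The rail relation then makes `|b j|` constant, so `b = 0`, and
  -- next the Kirchhoff relation makes `|d j|` constant.
  by_cases hσ : sinSol l 1 = 0
  · have hs := hne.resolve_left (not_not.2 hσ)
    have hs' : (sinSol l (L / 2) : ℂ) ≠ 0 := by exact_mod_cast hs
    have hC : ‖(cosSol l 1 : ℂ)‖ = 1 := by
      have h1 := cosSol_sq_add l 1
      rw [hσ] at h1
      rw [Complex.norm_real, ← pow_eq_one_iff_of_nonneg (norm_nonneg _) two_ne_zero,
        Real.norm_eq_abs, sq_abs]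
      linarith
    have hb : b = 0 := by
      refine eq_zero_of_norm_eq_int (fun j => ?_) h.summable_b
      have h1 := h.rail j
      rw [hσ, Complex.ofReal_zero, mul_zero, add_zero, mul_assoc] at h1
      rw [mul_left_cancel₀ hs' h1, norm_mul, hC, mul_one]
    refine ⟨hb, eq_zero_of_norm_eq_int (fun j => ?_) h.summable_d⟩
    have h1 := h.kirchhoff (j + 1)
    rw [hb, hσ, add_sub_cancel_right] at h1
    simp only [Pi.zero_apply, mul_zero, Complex.ofReal_zero, zero_add, sub_zero] at h1
    rw [sub_eq_zero.1 h1, norm_mul, hC, mul_one]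
  · have hs : sinSol l (L / 2) ≠ 0 := by
      intro hs
      have h1 : |discr L l| ≤ 2 * |sinSol l (L / 2)| := not_lt.1 hl
      rw [hs, abs_zero, mul_zero, abs_nonpos_iff, discr, hs, mul_zero, zero_add, mul_eq_zero] at h1
      exact cosSol_ne_zero_of_sinSol_eq_zero hs (h1.resolve_left hσ)
    obtain ⟨q, hq1, hq⟩ := exists_unimodular_discr hl
    have hq0 : q ≠ 0 := by rintro rfl; simp at hq1
    have hg := h.geometric hs hq0 hq1.le hq
    have h0 : b 0 = 0 := by
      have h1 := eq_zero_of_norm_eq (a := fun n : ℕ => b n) (fun n => ?_)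
        (tendsto_zero_of_summable_sq h.summable_b Nat.cast_injective) 0
      · simpa using h1
      · push_cast
        rw [(hg n).1, norm_mul, hq1, one_mul]
    have hb : b = 0 := eq_zero_of_geometric hg h0
    subst hb
    exact ⟨rfl, h.d_eq_zero hσ⟩

/-! ### The eigenvalue equation in the gaps. -/

theorem exists_contracting_add_inv {g : ℝ} (hg : 1 < |g|) :
    ∃ r : ℝ, r ≠ 0 ∧ |r| < 1 ∧ r + r⁻¹ = 2 * g := by
  have gen : ∀ g : ℝ, 1 < g → ∃ r : ℝ, r ≠ 0 ∧ |r| < 1 ∧ r + r⁻¹ = 2 * g := by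
    intro g hg
    have h1 : 0 < g ^ 2 - 1 := by nlinarith
    have h2 := Real.sqrt_pos.2 h1
    have h3 := Real.sq_sqrt h1.le
    have h4 : 1 < g + √(g ^ 2 - 1) := by linarith
    refine ⟨(g + √(g ^ 2 - 1))⁻¹, by positivity, ?_, ?_⟩
    · rw [abs_of_pos (by positivity)]
      exact inv_lt_one_of_one_lt₀ h4
    · rw [inv_inv]
      have : (g + √(g ^ 2 - 1))⁻¹ = g - √(g ^ 2 - 1) := by
        refine inv_eq_of_mul_eq_one_right ?_
        linear_combination -h3
      rw [this]
      ring
  rcases lt_abs.1 hg with h | h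
  · exact gen g h
  · obtain ⟨r, h1, h2, h3⟩ := gen (-g) h
    refine ⟨-r, neg_ne_zero.2 h1, by rwa [abs_neg], ?_⟩
    rw [inv_neg]
    linarith

/-- The eigenvalue condition outside the essential spectrum. -/
theorem IsEigenData.exists_root {L μ l : ℝ} (hμ : 0 < μ) {b d : ℤ → ℂ} (h : IsEigenData L μ l b d)
    (hl : l ∈ resolventRegion L) (hbd : ¬ (b = 0 ∧ d = 0)) :
    sinSol l (L / 2) ≠ 0 ∧ ∃ r : ℝ, r ≠ 0 ∧ |r| < 1 ∧
      sinSol l (L / 2) * (r + r⁻¹) = discr L l ∧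
      2 * sinSol l (L / 2) * r = 2 * cosSol l 1 * sinSol l (L / 2)
        + μ * sinSol l 1 * cosSol l (L / 2) := by
  have hσ := sinSol_one_ne_zero hl
  have hl' : 2 * |sinSol l (L / 2)| < |discr L l| := hl
  have hb : b ≠ 0 := by
    rintro rfl
    exact hbd ⟨rfl, h.d_eq_zero hσ⟩
  -- If `s = 0`, the recurrence degenerates to `w j σ c b j = 0` with nonzero coefficient, so `b =
  -- 0`.
  by_cases hs : sinSol l (L / 2) = 0
  · refine absurd (funext fun j => ?_) hb
    have h1 := h.recurrence j
    rw [hs, Complex.ofReal_zero, zero_mul, mul_zero, zero_add, eq_comm, mul_eq_zero] at h1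
    refine h1.resolve_left ?_
    exact_mod_cast mul_ne_zero (mul_ne_zero (weight_pos hμ _).ne' hσ)
      (cosSol_ne_zero_of_sinSol_eq_zero hs)
  · refine ⟨hs, ?_⟩
    obtain ⟨r, hr0, hr1, hr⟩ := exists_contracting_add_inv (g := discr L l / (2 * sinSol l (L / 2)))
      (by rw [abs_div, abs_mul, abs_two, one_lt_div (by positivity)]; exact hl')
    have hr' : sinSol l (L / 2) * (r + r⁻¹) = discr L l := by
      rw [hr]; field_simp
    refine ⟨r, hr0, hr1, hr', ?_⟩
    have hg := h.geometric hs (q := r) (by exact_mod_cast hr0)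
      (by rw [Complex.norm_real]; exact hr1.le) (by exact_mod_cast hr')
    have h0 : b 0 ≠ 0 := fun h0 => hb (eq_zero_of_geometric hg h0)
    have h1 := h.recurrence 0
    have h2 := hg 0
    simp only [Nat.cast_zero, zero_add, neg_zero] at h2
    rw [zero_add, zero_sub, h2.1, h2.2] at h1
    simp only [weight, if_pos] at h1
    have h3 := mul_right_cancel₀ h0 (show (2 * sinSol l (L / 2) * r : ℂ) * b 0 = _ by
      rw [← h1]; ring)
    exact_mod_cast h3

/-- For `l > 0` use `2 σ c N = N² - 4 C² s² + (σ c)²` together with `4 C² s² ≤ 4 s² < N²`. For `l ≤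
0` all factors are positive. This sign decides for which `μ` the bound state decays. -/
theorem pos_of_mem_resolventRegion {L l : ℝ} (hL : 0 < L) (hl : l ∈ resolventRegion L) :
    0 < sinSol l 1 * cosSol l (L / 2) * discr L l := by
  have hl' : 2 * |sinSol l (L / 2)| < |discr L l| := hl
  rcases le_or_gt l 0 with h0 | h0
  · have h1 := sinSol_pos h0 one_pos
    have h2 := sinSol_pos h0 (half_pos hL)
    have h3 := one_le_cosSol h0 1
    have h4 := one_le_cosSol h0 (L / 2)
    rw [discr]
    positivity
  · have h1 := sq_lt_sq' (by linarith [abs_nonneg (sinSol l (L / 2)), abs_nonneg (discr L l)]) hl'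
    rw [mul_pow, sq_abs, sq_abs] at h1
    have h2 := cosSol_sq_add l 1
    have h3 : 0 ≤ 4 * l * sinSol l 1 ^ 2 * sinSol l (L / 2) ^ 2 := by positivity
    have h4 : 2 * (sinSol l 1 * cosSol l (L / 2) * discr L l)
        = discr L l ^ 2 - 4 * cosSol l 1 ^ 2 * sinSol l (L / 2) ^ 2
          + (sinSol l 1 * cosSol l (L / 2)) ^ 2 := by rw [discr]; ring
    have h5 : 4 * cosSol l 1 ^ 2 * sinSol l (L / 2) ^ 2
        = 4 * sinSol l (L / 2) ^ 2 - 4 * l * sinSol l 1 ^ 2 * sinSol l (L / 2) ^ 2 := by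
      linear_combination 4 * sinSol l (L / 2) ^ 2 * h2
    have h6 := sq_nonneg (sinSol l 1 * cosSol l (L / 2))
    linarith

/-- The two factors of the equation are `2 s r` and `2 s r⁻¹`, so their product is `4 s²`. The
difference of their squares is `4 (1 - μ) σ c N` up to sign, and `|r| < 1` makes `1 - μ` positive.
-/
theorem IsEigenData.dispersion {L μ l : ℝ} (hL : 0 < L) (hμ : 0 < μ) {b d : ℤ → ℂ}
    (h : IsEigenData L μ l b d) (hl : l ∈ resolventRegion L) (hbd : ¬ (b = 0 ∧ d = 0)) :
    μ < 1 ∧ (2 * cosSol l 1 * sinSol l (L / 2) + μ * sinSol l 1 * cosSol l (L / 2))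
      * (2 * cosSol l 1 * sinSol l (L / 2) + (2 - μ) * sinSol l 1 * cosSol l (L / 2))
      = 4 * sinSol l (L / 2) ^ 2 := by
  obtain ⟨hs, r, hr0, hr1, h1, h2⟩ := h.exists_root hμ hl hbd
  have h3 : 2 * sinSol l (L / 2) * r⁻¹
      = 2 * cosSol l 1 * sinSol l (L / 2) + (2 - μ) * sinSol l 1 * cosSol l (L / 2) := by
    rw [discr] at h1
    linear_combination 2 * h1 - h2
  have hrr := mul_inv_cancel₀ hr0
  refine ⟨?_, by rw [← h2, ← h3]; linear_combination 4 * sinSol l (L / 2) ^ 2 * hrr⟩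
  have h4 : 4 * (1 - μ) * (sinSol l 1 * cosSol l (L / 2) * discr L l)
      = 4 * sinSol l (L / 2) ^ 2 * (r⁻¹ ^ 2 - r ^ 2) := by
    have : 4 * sinSol l (L / 2) ^ 2 * (r⁻¹ ^ 2 - r ^ 2)
      = (2 * sinSol l (L / 2) * r⁻¹) ^ 2 - (2 * sinSol l (L / 2) * r) ^ 2 := by ring
    rw [this, h2, h3, discr]
    ring
  have h5 : r ^ 2 < 1 := by rw [← sq_abs]; exact pow_lt_one₀ (abs_nonneg r) hr1 two_ne_zero
  have h6 : 1 < r⁻¹ ^ 2 := by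
    rw [inv_pow]
    exact (one_lt_inv₀ (by positivity)).2 h5
  have h7 : 0 < 4 * sinSol l (L / 2) ^ 2 * (r⁻¹ ^ 2 - r ^ 2) :=
    mul_pos (by positivity) (by linarith)
  rw [← h4] at h7
  have h8 := pos_of_mul_pos_left h7 (pos_of_mem_resolventRegion hL hl).le
  linarith

theorem summable_pow_natAbs {r : ℝ} (h0 : 0 ≤ r) (h1 : r < 1) :
    Summable fun j : ℤ => r ^ j.natAbs := by
  refine Summable.of_nat_of_neg ?_ ?_ <;>
  · simp only [Int.natAbs_neg, Int.natAbs_natCast]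
    exact summable_geometric_of_lt_one h0 h1

/-- The sequence `b j = r ^ |j|` solves the recurrence: off `0` by the equation for `r + r⁻¹`, at
`0` by the second hypothesis. The slopes `d` are defined by the rail relation, and the Kirchhoff
relation times `σ` is then the recurrence. -/
theorem exists_isEigenData_of_root {L μ l : ℝ} (hσ : sinSol l 1 ≠ 0) {r : ℝ} (hr0 : r ≠ 0)
    (hr1 : |r| < 1) (h1 : sinSol l (L / 2) * (r + r⁻¹) = discr L l)
    (h2 : 2 * sinSol l (L / 2) * r = 2 * cosSol l 1 * sinSol l (L / 2)
        + μ * sinSol l 1 * cosSol l (L / 2)) :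
    ∃ b d : ℤ → ℂ, IsEigenData L μ l b d ∧ b 0 ≠ 0 := by
  set s := sinSol l (L / 2) with hs
  set c := cosSol l (L / 2) with hc
  set σ := sinSol l 1 with hσ'
  set C := cosSol l 1 with hC
  have hrec : ∀ j : ℤ, s * (r ^ (j + 1).natAbs + r ^ (j - 1).natAbs)
      = (2 * C * s + weight μ (.rung j) * σ * c) * r ^ j.natAbs := by
    intro j
    have h1' : s * (r ^ 2 + 1) = discr L l * r := by
      rw [← h1]; field_simp
    rw [discr, ← hs, ← hc, ← hσ', ← hC] at h1'
    rcases lt_trichotomy j 0 with hj | hj | hj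
    · obtain ⟨n, rfl⟩ : ∃ n : ℕ, j = -(n + 1) := ⟨(-j - 1).toNat, by omega⟩
      have e1 : (-((n : ℤ) + 1) + 1).natAbs = n := by omega
      have e2 : (-((n : ℤ) + 1) - 1).natAbs = n + 2 := by omega
      have e3 : (-((n : ℤ) + 1)).natAbs = n + 1 := by omega
      rw [e1, e2, e3, weight, if_neg hj.ne]
      linear_combination r ^ n * h1'
    · subst hj
      simp [weight]
      linear_combination h2
    · obtain ⟨n, rfl⟩ : ∃ n : ℕ, j = n + 1 := ⟨(j - 1).toNat, by omega⟩
      have e1 : ((n : ℤ) + 1 + 1).natAbs = n + 2 := by omega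
      have e2 : ((n : ℤ) + 1 - 1).natAbs = n := by omega
      have e3 : ((n : ℤ) + 1).natAbs = n + 1 := by omega
      rw [e1, e2, e3, weight, if_neg hj.ne']
      linear_combination r ^ n * h1'
  have hcs : C ^ 2 + l * σ ^ 2 = 1 := cosSol_sq_add l 1
  have hsum : Summable fun j : ℤ => (r ^ j.natAbs) ^ 2 := by
    refine (summable_pow_natAbs (sq_nonneg r) ?_).congr fun j => ?_
    · rw [← sq_abs]; exact pow_lt_one₀ (abs_nonneg r) hr1 two_ne_zero
    · rw [← pow_mul, ← pow_mul, mul_comm]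
  set d : ℤ → ℝ := fun j => (s * r ^ (j + 1).natAbs - s * r ^ j.natAbs * C) / σ with hd
  have hd' (j) : d j * σ = s * r ^ (j + 1).natAbs - s * r ^ j.natAbs * C :=
    div_mul_cancel₀ _ hσ
  refine ⟨fun j => ((r ^ j.natAbs : ℝ) : ℂ), fun j => (d j : ℂ), ⟨fun j => ?_, fun j => ?_, ?_, ?_⟩,
    by simp⟩
  · have := hd' j
    rw [← hs, ← hC, ← hσ']
    norm_cast
    linear_combination -this
  · have e1 := hd' j
    have e2 := hd' (j - 1)
    rw [sub_add_cancel] at e2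
    rw [← hs, ← hC, ← hσ', ← hc]
    norm_cast
    refine (mul_eq_zero.1 (?_ : _ * σ = 0)).resolve_right hσ
    linear_combination e1 - C * e2 + hrec j + s * r ^ (j - 1).natAbs * hcs
  · simpa only [Complex.norm_real, Real.norm_eq_abs, sq_abs] using hsum
  · simp only [Complex.norm_real, Real.norm_eq_abs, sq_abs]
    refine Summable.of_nonneg_of_le (fun j => sq_nonneg _) (fun j => ?_)
      ((((summable_shift hsum 1).mul_left (2 * s ^ 2)).add
        (hsum.mul_left (2 * (s * C) ^ 2))).mul_right (1 / σ ^ 2))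
    rw [hd, div_pow, mul_one_div]
    refine div_le_div_of_nonneg_right ?_ (sq_nonneg σ)
    linear_combination sq_nonneg (s * r ^ (j + 1).natAbs + s * r ^ j.natAbs * C)

/-- The eigenvalues outside the essential spectrum. -/
theorem isEigenvalue_iff {L μ : ℝ} (hL : 0 < L) (hμ : 0 < μ) (hμ1 : μ < 1) {l : ℝ}
    (hl : l ∈ resolventRegion L) :
    (antisymmetricOperator L μ).IsEigenvaluePMap (l : ℂ) ↔
      (2 * cosSol l 1 * sinSol l (L / 2) + μ * sinSol l 1 * cosSol l (L / 2))
      * (2 * cosSol l 1 * sinSol l (L / 2) + (2 - μ) * sinSol l 1 * cosSol l (L / 2))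
      = 4 * sinSol l (L / 2) ^ 2 := by
  rw [isEigenvaluePMap_iff]
  constructor
  · rintro ⟨U, hU, hg⟩
    obtain ⟨b, d, h1, h2⟩ := exists_isEigenData hL hμ hU hg
    exact (h1.dispersion hL hμ hl h2).2
  · intro h
    have hσ := sinSol_one_ne_zero hl
    have hs : sinSol l (L / 2) ≠ 0 := by
      intro hs
      rw [hs] at h
      have h1 : μ * (2 - μ) * (sinSol l 1 * cosSol l (L / 2)) ^ 2 = 0 := by
        linear_combination h
      have h2 := mul_ne_zero hσ (cosSol_ne_zero_of_sinSol_eq_zero hs)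
      have h3 : 0 < μ * (2 - μ) * (sinSol l 1 * cosSol l (L / 2)) ^ 2 :=
        mul_pos (mul_pos hμ (by linarith)) (by positivity)
      exact h3.ne' h1
    -- The two factors divided by `2 s` are inverse to each other by the equation. The identity `4
    -- s² (r'² - r²) = 4 (1 - μ) σ c N > 0` shows that `r` is the one of modulus less than one.
    set r := (2 * cosSol l 1 * sinSol l (L / 2) + μ * sinSol l 1 * cosSol l (L / 2))
      / (2 * sinSol l (L / 2)) with hr
    set r' := (2 * cosSol l 1 * sinSol l (L / 2) + (2 - μ) * sinSol l 1 * cosSol l (L / 2))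
      / (2 * sinSol l (L / 2)) with hr'
    have hrr : r * r' = 1 := by
      rw [hr, hr', div_mul_div_comm, h]
      field_simp
      ring
    have hr0 : r ≠ 0 := left_ne_zero_of_mul_eq_one hrr
    have hri : r⁻¹ = r' := inv_eq_of_mul_eq_one_right hrr
    have h1 : 2 * sinSol l (L / 2) * r
        = 2 * cosSol l 1 * sinSol l (L / 2) + μ * sinSol l 1 * cosSol l (L / 2) := by
      rw [hr]; field_simp
    have h2 : 2 * sinSol l (L / 2) * r'
        = 2 * cosSol l 1 * sinSol l (L / 2) + (2 - μ) * sinSol l 1 * cosSol l (L / 2) := by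
      rw [hr']; field_simp
    have h3 : 4 * sinSol l (L / 2) ^ 2 * (r' ^ 2 - r ^ 2)
        = 4 * (1 - μ) * (sinSol l 1 * cosSol l (L / 2) * discr L l) := by
      have : 4 * sinSol l (L / 2) ^ 2 * (r' ^ 2 - r ^ 2)
        = (2 * sinSol l (L / 2) * r') ^ 2 - (2 * sinSol l (L / 2) * r) ^ 2 := by ring
      rw [this, h1, h2, discr]
      ring
    have h4 : 0 < 4 * (1 - μ) * (sinSol l 1 * cosSol l (L / 2) * discr L l) :=
      mul_pos (by linarith) (pos_of_mem_resolventRegion hL hl)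
    rw [← h3] at h4
    have h5 := pos_of_mul_pos_right h4 (by positivity)
    have h6 : |r| < |r'| := sq_lt_sq.1 (by linarith)
    have h7 : |r| * |r'| = 1 := by rw [← abs_mul, hrr, abs_one]
    have hr1 : |r| < 1 := by
      by_contra hc
      rw [not_lt] at hc
      have := one_le_mul_of_one_le_of_one_le hc (hc.trans h6.le)
      nlinarith
    obtain ⟨b, d, hbd, hb⟩ := exists_isEigenData_of_root hσ hr0 hr1
      (by rw [hri, discr]; linear_combination (h1 + h2) / 2) h1
    obtain ⟨U, hU, hUt⟩ := isEigenvalue_of_isEigenData hL hμ hbd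
    exact ⟨U, ne_zero_of_ae_eq_trial hL hμ hb hUt, hU⟩

/-! ### Eigenvalues are real -/

/-- Green's identity for an eigenfunction on an edge. -/
theorem IsH2On.im_flux {a b : ℝ} (hab : a ≤ b) {u u' u'' : ℝ → ℂ} (h : IsH2On a b u u' u'') {z : ℂ}
    (hz : ∀ᵐ x ∂(volume.restrict (Ioo a b)), u'' x = -z * u x) :
    (starRingEnd ℂ (u b) * u' b).im - (starRingEnd ℂ (u a) * u' a).im
      = -z.im * ∫ x in Ioo a b, ‖u x‖ ^ 2 := by
  have hb : b ∈ Icc a b := right_mem_Icc.2 hab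
  have i1 := h.intervalIntegrable_fst hb
  have i2 := h.intervalIntegrable_snd hb
  have c1 : ContinuousOn (fun x => starRingEnd ℂ (u' x)) (Icc a b) :=
    Complex.continuous_conj.comp_continuousOn h.continuousOn_fst
  have c0 : ContinuousOn (fun x => starRingEnd ℂ (u x)) (Icc a b) :=
    Complex.continuous_conj.comp_continuousOn h.continuousOn
  have key := integral_mul_add_mul_of_primitive (U := fun x => starRingEnd ℂ (u x))
    (g := fun x => starRingEnd ℂ (u' x)) hab
    (c1.intervalIntegrable_of_Icc hab) i2
    (fun x hx => by rw [intervalIntegral.intervalIntegral_conj, ← map_add, ← h.eq_self x hx]) h.eq_deriv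
  have i3 : IntervalIntegrable (fun t => starRingEnd ℂ (u' t) * u' t + starRingEnd ℂ (u t) * u'' t)
      volume a b := by
    rw [← uIcc_of_le hab] at c0
    refine IntervalIntegrable.add ?_ (i2.continuousOn_mul c0)
    exact (c1.mul h.continuousOn_fst).intervalIntegrable_of_Icc hab
  rw [← Complex.sub_im, ← key, ← Complex.imCLM_apply, ← Complex.imCLM.intervalIntegral_comp_comm i3,
    intervalIntegral.integral_of_le hab, integral_Ioc_eq_integral_Ioo, ← integral_const_mul]
  refine integral_congr_ae (hz.mono fun x hx => ?_)
  simp only [hx, Complex.imCLM_apply, Complex.add_im, Complex.mul_im, Complex.mul_re,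
    Complex.conj_re, Complex.conj_im, Complex.neg_re, Complex.neg_im, Complex.sq_norm,
    Complex.normSq_apply]
  ring

/-- The flux `J = Im (ū u')` changes along an edge by `-Im z` times the squared `L²` norm of `u`.
Continuity and the Kirchhoff condition make the weighted fluxes cancel at every vertex, and the
trace bounds make all sums converge, so `Im z ‖U‖² = 0`. -/
theorem im_eq_zero_of_isEigenvalue {L μ : ℝ} (hL : 0 < L) (hμ : 0 < μ) {z : ℂ}
    {U : antisymmetric L μ} (hU : U ≠ 0) (hg : (U, z • U) ∈ (antisymmetricOperator L μ).graph) :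
    z.im = 0 := by
  obtain ⟨u, u', u'', h⟩ := exists_isRepresentative hg
  obtain ⟨k, hk, hkb⟩ := exists_trace_bound hL hμ h
  set J : Edge → ℝ → ℝ := fun e x => (starRingEnd ℂ (u e x) * u' e x).im with hJ
  have hJk : ∀ e, ∀ x ∈ Icc (e.lo L) (e.hi L), |J e x| ≤ k e ^ 2 := by
    intro e x hx
    refine (Complex.abs_im_le_norm _).trans ?_
    rw [norm_mul, RCLike.norm_conj, sq]
    exact mul_le_mul (hkb e x hx).1 (hkb e x hx).2 (norm_nonneg _)
      ((norm_nonneg _).trans (hkb e x hx).1)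
  have hflux : ∀ e, weight μ e * (J e (e.hi L) - J e (e.lo L))
      = -z.im * ‖(U : L2Graph L μ) e‖ ^ 2 := by
    intro e
    rw [norm_sq_eq_integral hμ e (h.ae_eq e), mul_left_comm]
    congr 1
    refine (h.kirchhoff.isH2On e).im_flux (e.lo_lt_hi hL).le ?_
    refine (ae_edgeMeasure_iff hμ e).1 ?_
    filter_upwards [h.ae_eq_defect z e, Lp.coeFn_zero ℂ 2 (edgeMeasure L μ e)] with x h1 h2
    rw [sub_self, ZeroMemClass.coe_zero, lp.coeFn_zero, Pi.zero_apply, h2, Pi.zero_apply,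
      neg_zero] at h1
    linear_combination h1
  have hkirch : ∀ s j, J (.rail s j) j - J (.rail s (j - 1)) j
      = weight μ (.rung j) * (s.sign * J (.rung j) (s.sign * (L / 2))) := by
    intro s j
    have h1 := h.kirchhoff.kirchhoff s j
    have h2 : (starRingEnd ℂ (u (.rung j) (s.sign * (L / 2))) * ((weight μ (.rail s j) : ℂ)
      * u' (.rail s j) j
      + (weight μ (.rail s (j - 1)) : ℂ) * (-u' (.rail s (j - 1)) j)
      + (weight μ (.rung j) : ℂ) * (-s.sign * u' (.rung j) (s.sign * (L / 2))))).im = 0 := by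
      rw [h1, mul_zero, Complex.zero_im]
    simp only [hJ]
    rw [h.kirchhoff.continuous_right, h.kirchhoff.continuous_left]
    generalize u (.rung j) (s.sign * (L / 2)) = v at h2 ⊢
    rw [show weight μ (.rail s j) = 1 from rfl, show weight μ (.rail s (j - 1)) = 1 from rfl] at h2
    generalize weight μ (.rung j) = w at h2 ⊢
    simp at h2 ⊢
    linear_combination h2
  have hA : ∀ s, Summable fun j : ℤ => J (.rail s j) j := fun s =>
    Summable.of_norm_bounded (hk.comp_injective (rail_injective s))
      fun j => hJk (.rail s j) j ⟨le_rfl, by simp [Edge.hi]⟩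
  have hB : ∀ s, Summable fun j : ℤ => J (.rail s j) (j + 1) := fun s =>
    Summable.of_norm_bounded (hk.comp_injective (rail_injective s))
      fun j => hJk (.rail s j) (j + 1) ⟨by simp [Edge.lo], le_rfl⟩
  have hB' : ∀ s, Summable fun j : ℤ => J (.rail s (j - 1)) j := fun s => by
    refine (summable_shift (hB s) (-1)).congr fun j => ?_
    rw [← sub_eq_add_neg]; simp
  have hBB : ∀ s, ∑' j : ℤ, J (.rail s (j - 1)) j = ∑' j : ℤ, J (.rail s j) (j + 1) := fun s => by
    rw [← tsum_shift (fun j : ℤ => J (.rail s j) (j + 1)) (-1)]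
    refine tsum_congr fun j => ?_
    rw [← sub_eq_add_neg]; simp
  have hrail : ∀ s, ∑' j, -z.im * ‖(U : L2Graph L μ) (.rail s j)‖ ^ 2
      = ∑' j : ℤ, J (.rail s j) (j + 1) - ∑' j : ℤ, J (.rail s j) j := fun s => by
    rw [← (hB s).tsum_sub (hA s)]
    refine tsum_congr fun j => ?_
    rw [← hflux]
    simp [weight, Edge.lo, Edge.hi]
  -- Upper and lower ends of the rungs are converted by the Kirchhoff condition into fluxes on the
  -- rails; after a shift of index these are the negatives of the rail sums in `hrail`.
  have hrung : ∑' j, -z.im * ‖(U : L2Graph L μ) (.rung j)‖ ^ 2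
      = (∑' j : ℤ, J (.rail .upper j) j - ∑' j : ℤ, J (.rail .upper j) (j + 1))
        + (∑' j : ℤ, J (.rail .lower j) j - ∑' j : ℤ, J (.rail .lower j) (j + 1)) := by
    rw [← hBB, ← hBB, ← (hA _).tsum_sub (hB' _), ← (hA _).tsum_sub (hB' _),
      ← ((hA _).sub (hB' _)).tsum_add ((hA _).sub (hB' _))]
    refine tsum_congr fun j => ?_
    rw [hkirch, hkirch, ← hflux]
    simp only [Side.sign, Edge.lo, Edge.hi]
    rw [neg_one_mul, one_mul, neg_div]
    ring_nf
  have hs := (summable_norm_sq (U : L2Graph L μ)).mul_left (-z.im)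
  have htot := tsum_edge hs
  rw [hrung, hrail, hrail, tsum_mul_left, ← norm_sq_eq_tsum] at htot
  have h0 : z.im * ‖(U : L2Graph L μ)‖ ^ 2 = 0 := by linear_combination -htot
  refine (mul_eq_zero.1 h0).resolve_right ?_
  simpa using hU

/-! ### Eigenvalues of infinite multiplicity -/

/-- For `σ = s = 0` the rail relation is void, `d` is arbitrary, and the Kirchhoff condition
determines `b` because `c ≠ 0`. Choosing `d` supported at `2 k` gives an eigenfunction living on the
cells `2 k` and `2 k + 1`, so different `k` give orthogonal eigenfunctions. -/
theorem not_finiteDimensional_eigenspace {L μ : ℝ} (hL : 0 < L) (hμ : 0 < μ) {l : ℝ}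
    (hσ : sinSol l 1 = 0) (hs : sinSol l (L / 2) = 0) :
    ¬ FiniteDimensional ℂ ((antisymmetricOperator L μ).eigenspacePMap (l : ℂ)) := by
  have hc : (cosSol l (L / 2) : ℂ) ≠ 0 := by
    exact_mod_cast cosSol_ne_zero_of_sinSol_eq_zero hs
  have hw (j) : (weight μ (.rung j) : ℂ) ≠ 0 := by exact_mod_cast (weight_pos hμ _).ne'
  set d : ℕ → ℤ → ℂ := fun k => Pi.single (2 * (k : ℤ)) 1 with hd
  set b : ℕ → ℤ → ℂ := fun k j => (d k j - d k (j - 1) * cosSol l 1)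
    / (weight μ (.rung j) * cosSol l (L / 2)) with hb
  have hd0 : ∀ (k : ℕ) (j : ℤ), j ≠ 2 * (k : ℤ) → d k j = 0 := fun k j hj => Pi.single_eq_of_ne hj _
  have hb0 : ∀ (k : ℕ) (j : ℤ), j ≠ 2 * (k : ℤ) → j ≠ 2 * (k : ℤ) + 1 → b k j = 0 := by
    intro k j h1 h2
    simp only [hb]
    rw [hd0 k j h1, hd0 k (j - 1) (by omega)]
    simp
  have hdata : ∀ k, IsEigenData L μ l (b k) (d k) := by
    intro k
    refine ⟨fun j => by rw [hσ, hs]; simp, fun j => ?_, ?_, ?_⟩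
    · have h1 := div_mul_cancel₀ (d k j - d k (j - 1) * cosSol l 1) (mul_ne_zero (hw j) hc)
      change b k j * _ = _ at h1
      rw [hσ, hs, Complex.ofReal_zero]
      linear_combination -h1
    · refine summable_of_ne_finset_zero (s := {2 * (k : ℤ), 2 * (k : ℤ) + 1}) fun j hj => ?_
      simp only [Finset.mem_insert, Finset.mem_singleton, not_or] at hj
      rw [hb0 k j hj.1 hj.2]; simp
    · refine summable_of_ne_finset_zero (s := {2 * (k : ℤ)}) fun j hj => ?_
      rw [hd0 k j (by simpa using hj)]; simp
  choose U hU hUt using fun k => isEigenvalue_of_isEigenData hL hμ (hdata k)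
  have hne : ∀ k, U k ≠ 0 := by
    intro k
    refine ne_zero_of_ae_eq_trial hL hμ (j := 2 * (k : ℤ)) ?_ (hUt k)
    simp only [hb]
    rw [hd0 k (2 * (k : ℤ) - 1) (by omega), hd]
    exact div_ne_zero (by simp) (mul_ne_zero (hw _) hc)
  have hz : ∀ (k : ℕ) (e : Edge), (∀ x, trial L l (fun _ => 1) (b k) (d k) e x = 0) →
      (U k : L2Graph L μ) e = 0 := by
    intro k e he
    refine Lp.ext ?_
    filter_upwards [hUt k e, Lp.coeFn_zero ℂ 2 (edgeMeasure L μ e)] with x h1 h2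
    rw [h2, h1, he x]
    rfl
  have hz' : ∀ (k : ℕ) (j : ℤ), j ≠ 2 * (k : ℤ) → j ≠ 2 * (k : ℤ) + 1 →
      (U k : L2Graph L μ) (.rung j) = 0 ∧ ∀ s, (U k : L2Graph L μ) (.rail s j) = 0 := by
    intro k j h1 h2
    refine ⟨hz _ _ fun x => ?_, fun s => hz _ _ fun x => ?_⟩
    · simp [trial, hb0 k j h1 h2]
    · simp [trial, railSol, hb0 k j h1 h2, hd0 k j h1]
  have horth : Pairwise fun k m => inner ℂ (U k) (U m) = 0 := by
    intro k m hkm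
    have e : inner ℂ (U k) (U m)
      = ∑' e, inner ℂ ((U k : L2Graph L μ) e) ((U m : L2Graph L μ) e) := by
      rw [Submodule.coe_inner]; exact lp.inner_eq_tsum _ _
    rw [e]
    convert tsum_zero with e
    have hj : ∀ j : ℤ, (j ≠ 2 * (k : ℤ) ∧ j ≠ 2 * (k : ℤ) + 1)
        ∨ (j ≠ 2 * (m : ℤ) ∧ j ≠ 2 * (m : ℤ) + 1) := by omega
    cases e with
    | rung j =>
      rcases hj j with h | h
      · rw [(hz' k j h.1 h.2).1, inner_zero_left]
      · rw [(hz' m j h.1 h.2).1, inner_zero_right]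
    | rail s j =>
      rcases hj j with h | h
      · rw [(hz' k j h.1 h.2).2, inner_zero_left]
      · rw [(hz' m j h.1 h.2).2, inner_zero_right]
  intro hfin
  have hlin := linearIndependent_of_ne_zero_of_inner_eq_zero (𝕜 := ℂ) hne horth
  have hlin' : LinearIndependent ℂ fun k =>
      (⟨U k, hU k⟩ : (antisymmetricOperator L μ).eigenspacePMap (l : ℂ)) :=
    LinearIndependent.of_comp (Submodule.subtype _) hlin
  exact not_finite_iff_infinite.2 inferInstance hlin'.finite_of_isNoetherian

/-- Finite multiplicity alone is contradicted; isolation is not needed. An eigenvalue is real; in a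
gap it would give `μ < 1`, and in a band it must be a common zero of `σ` and `s`, where the
multiplicity is infinite. -/
theorem discreteSpectrum_eq_empty {L μ : ℝ} (hL : 0 < L) (hμ : 1 ≤ μ) :
    LinearPMap.discreteSpectrumPMap (antisymmetricOperator L μ) = ∅ := by
  have hμ0 : 0 < μ := by linarith
  refine eq_empty_iff_forall_notMem.2 ?_
  rintro z ⟨hz, hfin, -⟩
  obtain ⟨U, hU, hg⟩ := (isEigenvaluePMap_iff _ _).1 hz
  obtain ⟨l, rfl⟩ : ∃ l : ℝ, (l : ℂ) = z :=
    ⟨z.re, Complex.ext rfl (im_eq_zero_of_isEigenvalue hL hμ0 hU hg).symm⟩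
  obtain ⟨b, d, h1, h2⟩ := exists_isEigenData hL hμ0 hU hg
  by_cases hl : l ∈ resolventRegion L
  · exact hμ.not_gt (h1.dispersion hL hμ0 hl h2).1
  · by_cases hne : sinSol l 1 ≠ 0 ∨ sinSol l (L / 2) ≠ 0
    · exact h2 (h1.eq_zero_of_notMem hl hne)
    · push Not at hne
      exact not_finiteDimensional_eigenspace hL hμ0 hne.1 hne.2 hfin

/-! ### Combinations of cotangents -/

/-- The cotangent of `m x + φ`. -/
noncomputable def shiftedCot (m φ x : ℝ) : ℝ := Real.cos (x * m + φ) / Real.sin (x * m + φ)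

theorem hasDerivAt_shiftedCot {m φ x : ℝ} (h : Real.sin (x * m + φ) ≠ 0) :
    HasDerivAt (shiftedCot m φ) (-m / Real.sin (x * m + φ) ^ 2) x := by
  have h0 : HasDerivAt (fun x : ℝ => x * m + φ) m x := by
    simpa using ((hasDerivAt_id x).mul_const m).add_const φ
  convert! h0.cos.div h0.sin h using 1
  have := Real.sin_sq_add_cos_sq (x * m + φ)
  congr 1
  linear_combination m * this

theorem continuousOn_shiftedCot {m φ : ℝ} {s : Set ℝ} (hs : ∀ x ∈ s, Real.sin (x * m + φ) ≠ 0) :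
    ContinuousOn (shiftedCot m φ) s := fun x hx =>
  (hasDerivAt_shiftedCot (hs x hx)).continuousAt.continuousWithinAt

theorem strictAntiOn_shiftedCot {m φ : ℝ} (hm : 0 < m) {s : Set ℝ} (hs : Convex ℝ s)
    (h : ∀ x ∈ s, Real.sin (x * m + φ) ≠ 0) : StrictAntiOn (shiftedCot m φ) s := by
  refine strictAntiOn_of_deriv_neg hs (continuousOn_shiftedCot h) fun x hx => ?_
  have h1 := h x (interior_subset hx)
  rw [(hasDerivAt_shiftedCot h1).deriv, neg_div, neg_lt_zero]
  positivity

theorem tendsto_cot_zero_right :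
    Tendsto (fun x : ℝ => Real.cos x / Real.sin x) (𝓝[>] 0) atTop := by
  have h1 : Tendsto Real.sin (𝓝[>] 0) (𝓝[>] 0) := by
    refine tendsto_nhdsWithin_iff.2 ⟨?_, ?_⟩
    · simpa using (Real.continuous_sin.tendsto 0).mono_left nhdsWithin_le_nhds
    · filter_upwards [Ioo_mem_nhdsGT Real.pi_pos] with x hx using Real.sin_pos_of_mem_Ioo hx
  have h2 : Tendsto Real.cos (𝓝[>] 0) (𝓝 1) := by
    simpa using (Real.continuous_cos.tendsto 0).mono_left nhdsWithin_le_nhds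
  have h3 := h2.pos_mul_atTop one_pos (tendsto_inv_nhdsGT_zero.comp h1)
  exact h3.congr fun x => (div_eq_mul_inv _ _).symm

theorem shiftedCot_eq {m φ a x : ℝ} (ha : Real.sin (a * m + φ) = 0) :
    shiftedCot m φ x = Real.cos ((x - a) * m) / Real.sin ((x - a) * m) := by
  have e : x * m + φ = (x - a) * m + (a * m + φ) := by ring
  have hc : Real.cos (a * m + φ) ≠ 0 := by
    intro hc
    have := Real.sin_sq_add_cos_sq (a * m + φ)
    rw [ha, hc] at this
    norm_num at this
  rw [shiftedCot, e, Real.sin_add, Real.cos_add, ha, mul_zero, mul_zero, sub_zero, add_zero, mul_div_mul_right _ _ hc]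

theorem tendsto_shiftedCot_right {m φ a : ℝ} (hm : 0 < m) (ha : Real.sin (a * m + φ) = 0) :
    Tendsto (shiftedCot m φ) (𝓝[>] a) atTop := by
  have h1 : Tendsto (fun x => (x - a) * m) (𝓝[>] a) (𝓝[>] 0) := by
    refine tendsto_nhdsWithin_iff.2 ⟨?_, ?_⟩
    · have : Continuous fun x : ℝ => (x - a) * m := by fun_prop
      simpa using (this.tendsto a).mono_left nhdsWithin_le_nhds
    · filter_upwards [self_mem_nhdsWithin] with x hx using mul_pos (sub_pos.2 hx) hm
  exact (tendsto_cot_zero_right.comp h1).congr fun x => (shiftedCot_eq ha).symm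

theorem tendsto_shiftedCot_left {m φ a : ℝ} (hm : 0 < m) (ha : Real.sin (a * m + φ) = 0) :
    Tendsto (shiftedCot m φ) (𝓝[<] a) atBot := by
  have h1 : Tendsto (fun x => (a - x) * m) (𝓝[<] a) (𝓝[>] 0) := by
    refine tendsto_nhdsWithin_iff.2 ⟨?_, ?_⟩
    · have : Continuous fun x : ℝ => (a - x) * m := by fun_prop
      simpa using (this.tendsto a).mono_left nhdsWithin_le_nhds
    · filter_upwards [self_mem_nhdsWithin] with x hx using mul_pos (sub_pos.2 hx) hm
  refine (tendsto_neg_atTop_atBot.comp (tendsto_cot_zero_right.comp h1)).congr fun x => ?_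
  have e : (x - a) * m = -((a - x) * m) := by ring
  simp only [Function.comp_apply]
  rw [shiftedCot_eq ha, e, Real.cos_neg, Real.sin_neg, div_neg]

section

variable {ι : Type*} [Fintype ι]

/-- A combination of cotangents. -/
noncomputable def cotSum (c m φ : ι → ℝ) (x : ℝ) : ℝ := ∑ i, c i * shiftedCot (m i) (φ i) x

theorem strictAntiOn_cotSum [Nonempty ι] {c m φ : ι → ℝ} (hc : ∀ i, 0 < c i) (hm : ∀ i, 0 < m i)
    {s : Set ℝ} (hs : Convex ℝ s) (h : ∀ i, ∀ x ∈ s, Real.sin (x * m i + φ i) ≠ 0) :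
    StrictAntiOn (cotSum c m φ) s := fun _ hx _ hy hxy =>
  Finset.sum_lt_sum_of_nonempty Finset.univ_nonempty fun i _ =>
    mul_lt_mul_of_pos_left (strictAntiOn_shiftedCot (hm i) hs (h i) hx hy hxy) (hc i)

theorem continuousOn_cotSum {c m φ : ι → ℝ} {s : Set ℝ}
    (h : ∀ i, ∀ x ∈ s, Real.sin (x * m i + φ i) ≠ 0) : ContinuousOn (cotSum c m φ) s :=
  continuousOn_finsetSum _ fun i _ => continuousOn_const.mul (continuousOn_shiftedCot (h i))

/-- A combination of cotangents vanishes between two consecutive poles. -/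
theorem exists_cotSum_eq_zero [DecidableEq ι] {c m φ : ι → ℝ} (hc : ∀ i, 0 < c i)
    (hm : ∀ i, 0 < m i) {a b : ℝ} (hab : a < b)
    (h : ∀ i, ∀ x ∈ Ioo a b, Real.sin (x * m i + φ i) ≠ 0)
    (ha : ∃ i, Real.sin (a * m i + φ i) = 0) (hb : ∃ i, Real.sin (b * m i + φ i) = 0) :
    ∃ x ∈ Ioo a b, cotSum c m φ x = 0 := by
  -- All cotangents decrease, so near `a` those without the chosen pole are at least their values at
  -- `p`, and near `b` at most these values. The term with the pole then fixes the sign of the sum.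
  obtain ⟨p, hp⟩ := exists_between hab
  have hanti (i) := (strictAntiOn_shiftedCot (hm i) (convex_Ioo a b) (h i)).antitoneOn
  have hpos : ∃ x ∈ Ioo a b, 0 < cotSum c m φ x := by
    obtain ⟨k, hk⟩ := ha
    obtain ⟨x, hx, hxp⟩ := (((tendsto_shiftedCot_right (hm k) hk).eventually_gt_atTop
      (-(∑ i ∈ Finset.univ.erase k, c i * shiftedCot (m i) (φ i) p) / c k)).and
        (Ioo_mem_nhdsGT hp.1)).exists
    have hxI : x ∈ Ioo a b := ⟨hxp.1, hxp.2.trans hp.2⟩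
    refine ⟨x, hxI, ?_⟩
    rw [cotSum, ← Finset.add_sum_erase _ _ (Finset.mem_univ k)]
    rw [div_lt_iff₀ (hc k)] at hx
    have h1 : ∑ i ∈ Finset.univ.erase k, c i * shiftedCot (m i) (φ i) p
        ≤ ∑ i ∈ Finset.univ.erase k, c i * shiftedCot (m i) (φ i) x :=
      Finset.sum_le_sum fun i _ => mul_le_mul_of_nonneg_left (hanti i hxI hp hxp.2.le) (hc i).le
    linarith
  have hneg : ∃ x ∈ Ioo a b, cotSum c m φ x < 0 := by
    obtain ⟨k, hk⟩ := hb
    obtain ⟨x, hx, hxp⟩ := (((tendsto_shiftedCot_left (hm k) hk).eventually_lt_atBot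
      (-(∑ i ∈ Finset.univ.erase k, c i * shiftedCot (m i) (φ i) p) / c k)).and
        (Ioo_mem_nhdsLT hp.2)).exists
    have hxI : x ∈ Ioo a b := ⟨hp.1.trans hxp.1, hxp.2⟩
    refine ⟨x, hxI, ?_⟩
    rw [cotSum, ← Finset.add_sum_erase _ _ (Finset.mem_univ k)]
    rw [lt_div_iff₀ (hc k)] at hx
    have h1 : ∑ i ∈ Finset.univ.erase k, c i * shiftedCot (m i) (φ i) x
        ≤ ∑ i ∈ Finset.univ.erase k, c i * shiftedCot (m i) (φ i) p :=
      Finset.sum_le_sum fun i _ => mul_le_mul_of_nonneg_left (hanti i hp hxI hxp.1.le) (hc i).le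
    linarith
  obtain ⟨x, hx, hx0⟩ := hpos
  obtain ⟨y, hy, hy0⟩ := hneg
  obtain ⟨z, hz, hz0⟩ := isPreconnected_Ioo.intermediate_value hy hx (continuousOn_cotSum h)
    (⟨hy0.le, hx0.le⟩ : (0 : ℝ) ∈ Icc _ _)
  exact ⟨z, hz, hz0⟩

end

theorem mul_pos_of_ne_zero {f : ℝ → ℝ} {s : Set ℝ} [s.OrdConnected] (hf : ContinuousOn f s)
    (h : ∀ x ∈ s, f x ≠ 0) {x y : ℝ} (hx : x ∈ s) (hy : y ∈ s) : 0 < f x * f y := by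
  by_contra hc
  have hsub : uIcc x y ⊆ s := OrdConnected.uIcc_subset inferInstance hx hy
  obtain ⟨z, hz, hz0⟩ := intermediate_value_uIcc (hf.mono hsub) (show (0 : ℝ) ∈ uIcc (f x) (f y) by
    rw [mem_uIcc]
    rcases mul_nonpos_iff.1 (not_lt.1 hc) with h | h
    · exact Or.inr ⟨h.2, h.1⟩
    · exact Or.inl h)
  exact h z (hsub hz) hz0

/-! ### The dispersion relation of the ladder -/

section

variable {L : ℝ}

/-- The product of the denominators of the dispersion relation. -/
noncomputable def poles (L ω : ℝ) : ℝ :=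
  Real.sin ω * (Real.sin (ω * (L / 2)) * Real.cos (ω * (L / 2)))

/-- The dispersion function at the frequency `ω`. -/
noncomputable def secular (L ν : ℝ) : ℝ → ℝ :=
  cotSum ![1, 1, ν / 4] ![1, L / 2, L / 2] ![0, Real.pi / 2, 0]

/-- The phase `π / 2` turns a cotangent into minus a tangent, so that all three terms decrease. -/
theorem secular_eq (L ν ω : ℝ) : secular L ν ω = Real.cos ω / Real.sin ω
    - Real.sin (ω * (L / 2)) / Real.cos (ω * (L / 2))
    + ν / 4 * (Real.cos (ω * (L / 2)) / Real.sin (ω * (L / 2))) := by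
  simp [secular, cotSum, Fin.sum_univ_three, shiftedCot, Real.cos_add_pi_div_two,
    Real.sin_add_pi_div_two, neg_div, sub_eq_add_neg]

/-- The dispersion function without denominators. -/
noncomputable def secularNum (L ν ω : ℝ) : ℝ :=
  4 * Real.cos ω * Real.sin (ω * (L / 2)) * Real.cos (ω * (L / 2))
    + ν * Real.sin ω * Real.cos (ω * (L / 2)) ^ 2 - 4 * Real.sin ω * Real.sin (ω * (L / 2)) ^ 2

theorem secularNum_eq {ν ω : ℝ} (h : poles L ω ≠ 0) :
    secularNum L ν ω = 4 * poles L ω * secular L ν ω := by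
  rw [secular_eq, secularNum]
  rw [poles] at h ⊢
  have h1 := left_ne_zero_of_mul h
  have h2 := left_ne_zero_of_mul (right_ne_zero_of_mul h)
  have h3 := right_ne_zero_of_mul (right_ne_zero_of_mul h)
  generalize Real.sin (ω * (L / 2)) = S at *
  generalize Real.cos (ω * (L / 2)) = C at *
  field_simp
  ring

theorem sin_ne_zero_of_poles {ω : ℝ} (h : poles L ω ≠ 0) (i : Fin 3) :
    Real.sin (ω * ![1, L / 2, L / 2] i + ![0, Real.pi / 2, 0] i) ≠ 0 := by
  rw [poles] at h
  have h1 := left_ne_zero_of_mul h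
  have h2 := left_ne_zero_of_mul (right_ne_zero_of_mul h)
  have h3 := right_ne_zero_of_mul (right_ne_zero_of_mul h)
  fin_cases i
  · simpa using h1
  · simpa [Real.sin_add_pi_div_two] using h3
  · simpa using h2

theorem exists_sin_eq_zero_of_poles {ω : ℝ} (h : poles L ω = 0) :
    ∃ i : Fin 3, Real.sin (ω * ![1, L / 2, L / 2] i + ![0, Real.pi / 2, 0] i) = 0 := by
  rw [poles, mul_eq_zero, mul_eq_zero] at h
  rcases h with h | h | h
  · exact ⟨0, by simpa using h⟩
  · exact ⟨2, by simpa using h⟩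
  · exact ⟨1, by simpa [Real.sin_add_pi_div_two] using h⟩

/-- The condition is squared. In `N² - 4 s²` the part `4 C² s² - 4 s²` equals `-4 l σ² s²`, so a
factor `σ` splits off. -/
theorem mem_resolventRegion_iff {ω : ℝ} (hω : 0 < ω) :
    ω ^ 2 ∈ resolventRegion L ↔ 0 < Real.sin ω * secularNum L 1 ω := by
  have h2 : 0 < ω ^ 2 := by positivity
  have h3 : 2 * |sinSol (ω ^ 2) (L / 2)| = |2 * sinSol (ω ^ 2) (L / 2)| := by
    rw [abs_mul, abs_two]
  change 2 * |sinSol (ω ^ 2) (L / 2)| < |discr L (ω ^ 2)| ↔ _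
  rw [h3, ← sq_lt_sq, discr, cosSol_of_pos h2, cosSol_of_pos h2,
    sinSol_of_pos h2 1, sinSol_of_pos h2 (L / 2), Real.sqrt_sq hω.le, mul_one, ← sub_pos, secularNum]
  have e := Real.sin_sq_add_cos_sq ω
  generalize Real.sin (ω * (L / 2)) = S
  generalize Real.cos (ω * (L / 2)) = C
  have key : (2 * Real.cos ω * (S / ω) + Real.sin ω / ω * C) ^ 2 - (2 * (S / ω)) ^ 2
      = Real.sin ω * (4 * Real.cos ω * S * C + 1 * Real.sin ω * C ^ 2 - 4 * Real.sin ω * S ^ 2)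
        / ω ^ 2 := by
    field_simp
    linear_combination 4 * S ^ 2 * e
  rw [key]
  exact div_pos_iff_of_pos_right h2

/-- The same computation as for the gap condition, except that the coefficient of `σ² c²` is `μ (2 -
μ)` instead of `1`. Gaps and eigenvalues are thus governed by one family of functions. -/
theorem dispersion_iff {μ ω : ℝ} (hω : 0 < ω) (hσ : Real.sin ω ≠ 0) :
    (2 * cosSol (ω ^ 2) 1 * sinSol (ω ^ 2) (L / 2)
        + μ * sinSol (ω ^ 2) 1 * cosSol (ω ^ 2) (L / 2))
      * (2 * cosSol (ω ^ 2) 1 * sinSol (ω ^ 2) (L / 2)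
        + (2 - μ) * sinSol (ω ^ 2) 1 * cosSol (ω ^ 2) (L / 2))
      = 4 * sinSol (ω ^ 2) (L / 2) ^ 2 ↔ secularNum L (μ * (2 - μ)) ω = 0 := by
  have h2 : 0 < ω ^ 2 := by positivity
  rw [cosSol_of_pos h2, cosSol_of_pos h2, sinSol_of_pos h2, sinSol_of_pos h2, Real.sqrt_sq hω.le,
    mul_one, ← sub_eq_zero, secularNum]
  have e := Real.sin_sq_add_cos_sq ω
  generalize Real.sin (ω * (L / 2)) = S
  generalize Real.cos (ω * (L / 2)) = C
  have key : (2 * Real.cos ω * (S / ω) + μ * (Real.sin ω / ω) * C)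
      * (2 * Real.cos ω * (S / ω) + (2 - μ) * (Real.sin ω / ω) * C) - 4 * (S / ω) ^ 2
      = Real.sin ω / ω ^ 2 * (4 * Real.cos ω * S * C + μ * (2 - μ) * Real.sin ω * C ^ 2
        - 4 * Real.sin ω * S ^ 2) := by
    field_simp
    linear_combination 4 * S ^ 2 * e
  rw [key, mul_eq_zero]
  exact or_iff_right (div_ne_zero hσ h2.ne')

theorem continuous_poles (L : ℝ) : Continuous (poles L) := by
  unfold poles
  fun_prop

theorem continuous_secularNum (L ν : ℝ) : Continuous (secularNum L ν) := by
  unfold secularNum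
  fun_prop

theorem strictAntiOn_secular (hL : 0 < L) {ν : ℝ} (hν : 0 < ν) {s : Set ℝ} (hs : Convex ℝ s)
    (h : ∀ x ∈ s, poles L x ≠ 0) : StrictAntiOn (secular L ν) s := by
  refine strictAntiOn_cotSum (fun i => ?_) (fun i => ?_) hs
    fun i x hx => sin_ne_zero_of_poles (h x hx) i
  · fin_cases i <;> simp [hν]
  · fin_cases i <;> simp [hL]

theorem exists_secular_eq_zero (hL : 0 < L) {ν : ℝ} (hν : 0 < ν) {a b : ℝ} (hab : a < b)
    (h : ∀ x ∈ Ioo a b, poles L x ≠ 0) (ha : poles L a = 0) (hb : poles L b = 0) :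
    ∃ x ∈ Ioo a b, secular L ν x = 0 := by
  refine exists_cotSum_eq_zero (fun i => ?_) (fun i => ?_) hab
    (fun i x hx => sin_ne_zero_of_poles (h x hx) i) (exists_sin_eq_zero_of_poles ha)
    (exists_sin_eq_zero_of_poles hb)
  · fin_cases i <;> simp [hν]
  · fin_cases i <;> simp [hL]

/-- The consecutive poles around a point. -/
theorem exists_poles {ω : ℝ} (hω : 0 < ω) (hp : poles L ω ≠ 0) :
    ∃ a b, 0 ≤ a ∧ ω ∈ Ioo a b ∧ (∀ x ∈ Ioo a b, poles L x ≠ 0) ∧ poles L a = 0 ∧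
      poles L b = 0 := by
  have hclosed : IsClosed {x | poles L x = 0} :=
    isClosed_eq (continuous_poles L) continuous_const
  -- The points `0` and `n π` are zeros of the sine, hence poles on either side of `ω`; the nearest
  -- ones exist by compactness.
  obtain ⟨n, hn⟩ := exists_nat_ge (ω / Real.pi)
  have hn' : ω ≤ n * Real.pi := (div_le_iff₀ Real.pi_pos).1 hn
  obtain ⟨a, ⟨haI, ha⟩, hamax⟩ := (isCompact_Icc.inter_right hclosed).exists_isGreatest
    (s := Icc 0 ω ∩ {x | poles L x = 0}) ⟨0, ⟨le_rfl, hω.le⟩, by simp [poles]⟩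
  obtain ⟨b, ⟨hbI, hb⟩, hbmin⟩ := (isCompact_Icc.inter_right hclosed).exists_isLeast
    (s := Icc ω (n * Real.pi) ∩ {x | poles L x = 0})
    ⟨n * Real.pi, ⟨hn', le_rfl⟩, by simp [poles, Real.sin_nat_mul_pi]⟩
  have haω : a < ω := lt_of_le_of_ne haI.2 fun h => hp (h ▸ ha)
  have hωb : ω < b := lt_of_le_of_ne hbI.1 fun h => hp (h ▸ hb)
  refine ⟨a, b, haI.1, ⟨haω, hωb⟩, fun x hx h0 => ?_, ha, hb⟩
  rcases le_total x ω with h | h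
  · exact (hamax ⟨⟨haI.1.trans hx.1.le, h⟩, h0⟩).not_gt hx.1
  · exact (hbmin ⟨⟨h, hx.2.le.trans hbI.2⟩, h0⟩).not_gt hx.2

/-- The sign of `tan (ω L / 2)`. -/
noncomputable def tanSign (L ω : ℝ) : ℝ := Real.sin (ω * (L / 2)) * Real.cos (ω * (L / 2))

theorem continuous_tanSign (L : ℝ) : Continuous (tanSign L) := by
  unfold tanSign
  fun_prop

theorem mem_resolventRegion_iff_of_poles {ω : ℝ} (hω : 0 < ω) (hp : poles L ω ≠ 0) :
    ω ^ 2 ∈ resolventRegion L ↔ 0 < tanSign L ω * secular L 1 ω := by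
  have hσ : Real.sin ω ≠ 0 := left_ne_zero_of_mul hp
  rw [mem_resolventRegion_iff hω, secularNum_eq hp,
    show Real.sin ω * (4 * poles L ω * secular L 1 ω)
      = 4 * Real.sin ω ^ 2 * (tanSign L ω * secular L 1 ω) by rw [poles, tanSign]; ring]
  exact mul_pos_iff_of_pos_left (by positivity)

theorem secular_one_eq (L ν ω : ℝ) : secular L 1 ω = secular L ν ω
    + (1 - ν) / 4 * (Real.cos (ω * (L / 2)) / Real.sin (ω * (L / 2))) := by
  rw [secular_eq, secular_eq]
  ring

/-- The two sides differ by `(1 - ν) / 4` times `cos² θ`, which is positive. In particular a zero of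
`secular L ν` away from the poles always lies in a gap. -/
theorem tanSign_mul_secular_pos {ν ω : ℝ} (hν : ν < 1) (hp : poles L ω ≠ 0)
    (h : 0 ≤ tanSign L ω * secular L ν ω) : 0 < tanSign L ω * secular L 1 ω := by
  have h2 : Real.sin (ω * (L / 2)) ≠ 0 := left_ne_zero_of_mul (right_ne_zero_of_mul hp)
  have h3 : Real.cos (ω * (L / 2)) ≠ 0 := right_ne_zero_of_mul (right_ne_zero_of_mul hp)
  have e : tanSign L ω * secular L 1 ω = tanSign L ω * secular L ν ω
      + (1 - ν) / 4 * Real.cos (ω * (L / 2)) ^ 2 := by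
    rw [secular_one_eq L ν, tanSign]
    generalize Real.sin (ω * (L / 2)) = S at *
    field_simp
  rw [e]
  have : 0 < (1 - ν) / 4 * Real.cos (ω * (L / 2)) ^ 2 := mul_pos (by linarith) (by positivity)
  linarith

/-- From any point of a gap away from the poles one reaches a root without leaving the gap. -/
theorem exists_root_of_mem (hL : 0 < L) {ν : ℝ} (hν0 : 0 < ν) (hν1 : ν < 1) {ω₀ : ℝ} (h0 : 0 < ω₀)
    (hp : poles L ω₀ ≠ 0) (hr : ω₀ ^ 2 ∈ resolventRegion L) :
    ∃ ω, secularNum L ν ω = 0 ∧ ∀ x ∈ uIcc ω₀ ω, 0 < x ∧ x ^ 2 ∈ resolventRegion L := by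
  obtain ⟨a, b, ha0, hI, hne, ha, hb⟩ := exists_poles h0 hp
  obtain ⟨ω, hω, hz⟩ := exists_secular_eq_zero hL hν0 (hI.1.trans hI.2) hne ha hb
  refine ⟨ω, by rw [secularNum_eq (hne ω hω), hz, mul_zero], fun x hx => ?_⟩
  have hxI : x ∈ Ioo a b := OrdConnected.uIcc_subset inferInstance hI hω hx
  have hx0 : 0 < x := ha0.trans_lt hxI.1
  refine ⟨hx0, (mem_resolventRegion_iff_of_poles hx0 (hne x hxI)).2 ?_⟩
  rw [mem_resolventRegion_iff_of_poles h0 hp] at hr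
  have hν := (strictAntiOn_secular hL hν0 (convex_Ioo a b) hne).antitoneOn
  have h1 := (strictAntiOn_secular hL one_pos (convex_Ioo a b) hne).antitoneOn
  have hts : 0 < tanSign L ω₀ * tanSign L x :=
    mul_pos_of_ne_zero (s := Ioo a b) (continuous_tanSign L).continuousOn
      (fun x hx => right_ne_zero_of_mul (hne x hx)) hI hxI
  -- The sign of `tan θ` is constant between poles. If it is positive, a gap means `F_1 > 0`: this
  -- persists to the left of `ω₀` as `F_1` decreases, and it holds up to a root on the right since
  -- `F_ν ≥ 0` there. If it is negative, left and right are exchanged.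
  rcases pos_and_pos_or_neg_and_neg_of_mul_pos hts with ⟨t0, tx⟩ | ⟨t0, tx⟩
  · rcases le_total ω₀ ω with hle | hle
    · rw [uIcc_of_le hle] at hx
      have := hν hxI hω hx.2
      rw [hz] at this
      exact tanSign_mul_secular_pos hν1 (hne x hxI) (mul_nonneg tx.le this)
    · rw [uIcc_of_ge hle] at hx
      have := h1 hxI hI hx.2
      exact mul_pos tx ((pos_of_mul_pos_right hr t0.le).trans_le this)
  · rcases le_total ω₀ ω with hle | hle
    · rw [uIcc_of_le hle] at hx
      have := h1 hI hxI hx.1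
      exact mul_pos_of_neg_of_neg tx (this.trans_lt (neg_of_mul_pos_right hr t0.le))
    · rw [uIcc_of_ge hle] at hx
      have := hν hω hxI hx.1
      rw [hz] at this
      exact tanSign_mul_secular_pos hν1 (hne x hxI) (mul_nonneg_of_nonpos_of_nonpos tx.le this)

theorem sin_ne_zero_of_mem {ω : ℝ} (hω : 0 < ω) (h : ω ^ 2 ∈ resolventRegion L) :
    Real.sin ω ≠ 0 := by
  rw [mem_resolventRegion_iff hω] at h
  exact left_ne_zero_of_mul h.ne'

/-- At a zero of `cos θ` the quantity of the gap condition is `-4 sin² ω sin² θ ≤ 0`. As `sin ω`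
does not vanish in a gap either, zeros of `sin θ` are the only poles that a gap can contain. -/
theorem cos_ne_zero_of_mem {ω : ℝ} (hω : 0 < ω) (h : ω ^ 2 ∈ resolventRegion L) :
    Real.cos (ω * (L / 2)) ≠ 0 := by
  intro hc
  rw [mem_resolventRegion_iff hω, secularNum, hc] at h
  have := sq_nonneg (Real.sin ω * Real.sin (ω * (L / 2)))
  linarith

theorem tanSign_ne_zero {ν ω : ℝ} (hν : 0 < ν) (hω : 0 < ω) (h : ω ^ 2 ∈ resolventRegion L)
    (hz : secularNum L ν ω = 0) : tanSign L ω ≠ 0 := by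
  refine mul_ne_zero (fun hs => ?_) (cos_ne_zero_of_mem hω h)
  rw [secularNum, hs] at hz
  have h1 : ν * Real.sin ω * Real.cos (ω * (L / 2)) ^ 2 = 0 := by linear_combination hz
  exact mul_ne_zero (mul_ne_zero hν.ne' (sin_ne_zero_of_mem hω h))
    (pow_ne_zero 2 (cos_ne_zero_of_mem hω h)) h1

/-- A gap has at most one root for each sign of `tan (ω L / 2)`. -/
theorem not_lt_of_roots (hL : 0 < L) {ν : ℝ} (hν : 0 < ν) {ω₁ ω₂ : ℝ}
    (h : ∀ x ∈ Icc ω₁ ω₂, 0 < x ∧ x ^ 2 ∈ resolventRegion L) (h1 : secularNum L ν ω₁ = 0)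
    (h2 : secularNum L ν ω₂ = 0) (hs : 0 < tanSign L ω₁ * tanSign L ω₂) : ¬ ω₁ < ω₂ := by
  intro hlt
  have m1 : ω₁ ∈ Icc ω₁ ω₂ := left_mem_Icc.2 hlt.le
  have m2 : ω₂ ∈ Icc ω₁ ω₂ := right_mem_Icc.2 hlt.le
  -- Throughout the interval `tan θ` is defined and strictly increasing. If it vanishes between the
  -- roots, its signs there are opposite, against `hs`; if not, there is no pole between them, and a
  -- strictly decreasing function cannot vanish twice.
  by_cases hS : ∃ x ∈ Icc ω₁ ω₂, Real.sin (x * (L / 2)) = 0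
  · obtain ⟨x, hx, hx0⟩ := hS
    have hanti := strictAntiOn_shiftedCot (m := L / 2) (φ := Real.pi / 2) (half_pos hL)
      (convex_Icc ω₁ ω₂) fun y hy => by
        rw [Real.sin_add_pi_div_two]; exact cos_ne_zero_of_mem (h y hy).1 (h y hy).2
    have e : ∀ y ∈ Icc ω₁ ω₂, tanSign L y
        = -shiftedCot (L / 2) (Real.pi / 2) y * Real.cos (y * (L / 2)) ^ 2 := by
      intro y hy
      have := cos_ne_zero_of_mem (h y hy).1 (h y hy).2
      rw [shiftedCot, tanSign, Real.sin_add_pi_div_two, Real.cos_add_pi_div_two]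
      generalize Real.cos (y * (L / 2)) = C at *
      field_simp
    have hx1 : x ≠ ω₁ := by
      rintro rfl
      rw [tanSign, hx0] at hs; simp at hs
    have hx2 : x ≠ ω₂ := by
      rintro rfl
      rw [tanSign, tanSign, hx0] at hs; simp at hs
    have e0 : shiftedCot (L / 2) (Real.pi / 2) x = 0 := by
      rw [shiftedCot, Real.cos_add_pi_div_two, hx0, neg_zero, zero_div]
    have l1 := hanti m1 hx (lt_of_le_of_ne hx.1 hx1.symm)
    have l2 := hanti hx m2 (lt_of_le_of_ne hx.2 hx2)
    rw [e0] at l1 l2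
    rw [e _ m1, e _ m2] at hs
    have c1 := sq_nonneg (Real.cos (ω₁ * (L / 2)))
    have c2 := sq_nonneg (Real.cos (ω₂ * (L / 2)))
    have t1 := mul_nonneg l1.le c1
    have t2 := mul_nonneg (neg_nonneg.2 l2.le) c2
    have t3 := mul_nonneg t1 t2
    linarith
  · push Not at hS
    have hne : ∀ x ∈ Icc ω₁ ω₂, poles L x ≠ 0 := fun x hx =>
      mul_ne_zero (sin_ne_zero_of_mem (h x hx).1 (h x hx).2)
        (mul_ne_zero (hS x hx) (cos_ne_zero_of_mem (h x hx).1 (h x hx).2))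
    have hlt' := strictAntiOn_secular hL hν (convex_Icc ω₁ ω₂) hne m1 m2 hlt
    rw [secularNum_eq (hne _ m1), mul_eq_zero, or_iff_right
      (mul_ne_zero four_ne_zero (hne _ m1))] at h1
    rw [secularNum_eq (hne _ m2), mul_eq_zero, or_iff_right
      (mul_ne_zero four_ne_zero (hne _ m2))] at h2
    rw [h1, h2] at hlt'
    exact lt_irrefl _ hlt'

/-- Near `0` the term `cot ω` tends to infinity, `tan θ` tends to zero and `cot θ` is positive, so
`F_1` and `tan θ` are both positive. This joins the half line `l ≤ 0` to positive frequencies. -/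
theorem eventually_mem_zero (hL : 0 < L) :
    ∀ᶠ ω in 𝓝[>] (0 : ℝ), poles L ω ≠ 0 ∧ ω ^ 2 ∈ resolventRegion L := by
  have hc : Tendsto (fun ω : ℝ => Real.sin (ω * (L / 2)) / Real.cos (ω * (L / 2))) (𝓝[>] 0)
      (𝓝 0) := by
    have : ContinuousAt (fun ω : ℝ => Real.sin (ω * (L / 2)) / Real.cos (ω * (L / 2))) 0 :=
      ContinuousAt.div (by fun_prop) (by fun_prop) (by simp)
    simpa using this.tendsto.mono_left nhdsWithin_le_nhds
  have hθ : Tendsto (fun ω : ℝ => ω * (L / 2)) (𝓝[>] 0) (𝓝 0) := by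
    have : Continuous fun ω : ℝ => ω * (L / 2) := by fun_prop
    simpa using (this.tendsto 0).mono_left nhdsWithin_le_nhds
  filter_upwards [tendsto_cot_zero_right.eventually_gt_atTop 1, hc.eventually_lt_const one_pos,
    hθ.eventually_lt_const (half_pos Real.pi_pos), Ioo_mem_nhdsGT Real.pi_pos] with ω h1 h2 h3 h4
  have hω : 0 < ω := h4.1
  have hσ : 0 < Real.sin ω := Real.sin_pos_of_mem_Ioo h4
  have hθ0 : 0 < ω * (L / 2) := by positivity
  have hS : 0 < Real.sin (ω * (L / 2)) := Real.sin_pos_of_mem_Ioo ⟨hθ0, by linarith [Real.pi_pos]⟩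
  have hC : 0 < Real.cos (ω * (L / 2)) := Real.cos_pos_of_mem_Ioo ⟨by linarith, h3⟩
  have hp : poles L ω ≠ 0 := by rw [poles]; positivity
  refine ⟨hp, (mem_resolventRegion_iff_of_poles hω hp).2 (mul_pos (by rw [tanSign]; positivity) ?_)⟩
  have : 0 < Real.cos (ω * (L / 2)) / Real.sin (ω * (L / 2)) := by positivity
  rw [secular_eq]
  linarith

/-- The monotonicity arguments need positive frequencies away from the poles. For `l > 0` the gap is
open and a zero of `sin θ` in it is isolated, so a small move to the right suffices. -/
theorem exists_mem_of_mem (hL : 0 < L) {l : ℝ} (hl : l ∈ resolventRegion L) :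
    ∃ ω, 0 < ω ∧ poles L ω ≠ 0 ∧ uIcc l (ω ^ 2) ⊆ resolventRegion L := by
  have root : ∀ {x : ℝ}, 0 < x → √x ^ 2 = x := fun hx => Real.sq_sqrt hx.le
  rcases le_or_gt l 0 with h0 | h0
  · obtain ⟨ε, hε, h⟩ := (mem_nhdsGT_iff_exists_Ioo_subset' zero_lt_one).1 (eventually_mem_zero hL)
    have hε : (0 : ℝ) < ε := hε
    obtain ⟨ω, hω0, hωε⟩ := exists_between hε
    refine ⟨ω, hω0, (h ⟨hω0, hωε⟩).1, fun x hx => ?_⟩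
    rw [uIcc_of_le (h0.trans (sq_nonneg ω))] at hx
    rcases le_or_gt x 0 with hx0 | hx0
    · exact mem_resolventRegion_of_nonpos hL hx0
    · rw [← root hx0]
      refine (h ⟨Real.sqrt_pos.2 hx0, lt_of_le_of_lt ?_ hωε⟩).2
      exact Real.sqrt_le_iff.2 ⟨hω0.le, hx.2⟩
  · set ω₀ := √l with hω₀
    have hω₀0 : 0 < ω₀ := Real.sqrt_pos.2 h0
    have hl' : l = ω₀ ^ 2 := (root h0).symm
    have e1 : ∀ᶠ x in 𝓝 ω₀, 0 < x ∧ 0 < Real.sin x * secularNum L 1 x := by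
      refine (eventually_gt_nhds hω₀0).and ?_
      have : Continuous fun x => Real.sin x * secularNum L 1 x :=
        Real.continuous_sin.mul (continuous_secularNum L 1)
      refine this.continuousAt.eventually_const_lt ?_
      rwa [← mem_resolventRegion_iff hω₀0, ← hl']
    have e2 : ∀ᶠ x in 𝓝[>] ω₀, Real.sin (x * (L / 2)) ≠ 0 := by
      by_cases hS : Real.sin (ω₀ * (L / 2)) = 0
      · have hd : HasDerivAt (fun x : ℝ => Real.sin (x * (L / 2)))
            (Real.cos (ω₀ * (L / 2)) * (L / 2)) ω₀ := by
          simpa using ((hasDerivAt_id ω₀).mul_const (L / 2)).sin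
        have hne : Real.cos (ω₀ * (L / 2)) * (L / 2) ≠ 0 :=
          mul_ne_zero (cos_ne_zero_of_mem hω₀0 (hl' ▸ hl)) (half_pos hL).ne'
        exact (hd.eventually_ne hne).filter_mono (nhdsWithin_mono _ fun x hx => ne_of_gt hx)
      · have : Continuous fun x : ℝ => Real.sin (x * (L / 2)) := by fun_prop
        exact (this.continuousAt.eventually_ne hS).filter_mono nhdsWithin_le_nhds
    obtain ⟨ε, hε, h⟩ := (mem_nhdsGT_iff_exists_Ioo_subset' (lt_add_one ω₀)).1
      ((e1.filter_mono nhdsWithin_le_nhds).and e2)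
    have hε : ω₀ < ε := hε
    obtain ⟨ω, hω0, hωε⟩ := exists_between hε
    obtain ⟨⟨p1, p2⟩, p3⟩ := h ⟨hω0, hωε⟩
    have hmem := (mem_resolventRegion_iff p1).2 p2
    refine ⟨ω, p1, mul_ne_zero (sin_ne_zero_of_mem p1 hmem)
      (mul_ne_zero p3 (cos_ne_zero_of_mem p1 hmem)), fun x hx => ?_⟩
    rw [uIcc_of_le (by rw [hl']; gcongr)] at hx
    rcases eq_or_lt_of_le hx.1 with hxl | hxl
    · rwa [← hxl]
    · have hx0 := h0.trans hxl
      rw [← root hx0]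
      have hx1 : √x ∈ Ioo ω₀ ε :=
        ⟨Real.sqrt_lt_sqrt h0.le hxl, lt_of_le_of_lt (Real.sqrt_le_iff.2 ⟨p1.le, hx.2⟩) hωε⟩
      exact (mem_resolventRegion_iff (h hx1).1.1).2 (h hx1).1.2

/-! ### Counting the eigenvalues in a gap. -/

theorem pos_of_isEigenvalue {μ : ℝ} (hL : 0 < L) (hμ : 0 < μ) (hμ1 : μ < 1) {l : ℝ}
    (hl : l ∈ resolventRegion L) (h : (antisymmetricOperator L μ).IsEigenvaluePMap (l : ℂ)) :
    0 < l := by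
  rw [isEigenvalue_iff hL hμ hμ1 hl] at h
  by_contra h0
  rw [not_lt] at h0
  have h1 := sinSol_pos h0 one_pos
  have h2 := sinSol_pos h0 (half_pos hL)
  have h3 := one_le_cosSol h0 1
  have h4 := one_le_cosSol h0 (L / 2)
  have h5 : 2 * sinSol l (L / 2) ≤ 2 * cosSol l 1 * sinSol l (L / 2) :=
    mul_le_mul_of_nonneg_right (by linarith) h2.le
  have h6 : 0 < μ * sinSol l 1 * cosSol l (L / 2) := by positivity
  have h7 : 0 < (2 - μ) * sinSol l 1 * cosSol l (L / 2) :=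
    mul_pos (mul_pos (by linarith) h1) (by linarith)
  -- For `l ≤ 0` both factors exceed `2 s > 0`, so their product exceeds `4 s²`.
  have h8 := mul_lt_mul'' (h5.trans_lt (lt_add_of_pos_right _ h6))
    (h5.trans_lt (lt_add_of_pos_right _ h7)) (by positivity) (by positivity)
  rw [h] at h8
  linarith

theorem isEigenvalue_sq_iff {μ : ℝ} (hL : 0 < L) (hμ : 0 < μ) (hμ1 : μ < 1) {ω : ℝ} (hω : 0 < ω)
    (h : ω ^ 2 ∈ resolventRegion L) :
    (antisymmetricOperator L μ).IsEigenvaluePMap ((ω ^ 2 : ℝ) : ℂ)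
      ↔ secularNum L (μ * (2 - μ)) ω = 0 := by
  rw [isEigenvalue_iff hL hμ hμ1 h, dispersion_iff hω (sin_ne_zero_of_mem hω h)]

/-- Two connected pieces inside the region are chained: the segment from `l` to a pole-free point
`ω₀²`, and the image under squaring of the segment from `ω₀` to the root. -/
theorem exists_isEigenvalue_of_mem {μ : ℝ} (hL : 0 < L) (hμ : 0 < μ) (hμ1 : μ < 1) {l : ℝ}
    (hl : l ∈ resolventRegion L) :
    ∃ x ∈ connectedComponentIn (resolventRegion L) l,
      (antisymmetricOperator L μ).IsEigenvaluePMap (x : ℂ) := by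
  obtain ⟨ω₀, h0, hp, hsub⟩ := exists_mem_of_mem hL hl
  have hν0 : 0 < μ * (2 - μ) := mul_pos hμ (by linarith)
  have hν1 : μ * (2 - μ) < 1 := by
    have : 0 < (1 - μ) ^ 2 := pow_pos (by linarith) 2
    linarith
  obtain ⟨ω, hz, h⟩ := exists_root_of_mem hL hν0 hν1 h0 hp (hsub right_mem_uIcc)
  obtain ⟨hω, hωr⟩ := h ω right_mem_uIcc
  refine ⟨ω ^ 2, ?_, (isEigenvalue_sq_iff hL hμ hμ1 hω hωr).2 hz⟩
  have h1 := isPreconnected_uIcc.subset_connectedComponentIn left_mem_uIcc hsub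
  have h2 : IsPreconnected ((fun x : ℝ => x ^ 2) '' uIcc ω₀ ω) :=
    isPreconnected_uIcc.image _ (by fun_prop)
  have h3 : (fun x : ℝ => x ^ 2) '' uIcc ω₀ ω ⊆
      connectedComponentIn (resolventRegion L) (ω₀ ^ 2) :=
    h2.subset_connectedComponentIn (mem_image_of_mem _ left_mem_uIcc)
      (by rintro _ ⟨x, hx, rfl⟩; exact (h x hx).2)
  rw [connectedComponentIn_eq (h1 right_mem_uIcc)]
  exact h3 (mem_image_of_mem _ right_mem_uIcc)

/-- Every eigenvalue in the gap is positive and `tan θ` is nonzero there. Each sign of `tan θ`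
admits at most one eigenvalue, and at least one eigenvalue exists. -/
theorem ncard_eigenvalues {μ : ℝ} (hL : 0 < L) (hμ : 0 < μ) (hμ1 : μ < 1) {l : ℝ}
    (hl : l ∈ resolventRegion L) :
    {x ∈ connectedComponentIn (resolventRegion L) l |
        (antisymmetricOperator L μ).IsEigenvaluePMap (x : ℂ)}.ncard = 1 ∨
    {x ∈ connectedComponentIn (resolventRegion L) l |
        (antisymmetricOperator L μ).IsEigenvaluePMap (x : ℂ)}.ncard = 2 := by
  have hν0 : 0 < μ * (2 - μ) := mul_pos hμ (by linarith)
  set I := connectedComponentIn (resolventRegion L) l with hI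
  have hIsub : I ⊆ resolventRegion L := connectedComponentIn_subset _ _
  have hord : I.OrdConnected := isPreconnected_connectedComponentIn.ordConnected
  set E := {x ∈ I | (antisymmetricOperator L μ).IsEigenvaluePMap (x : ℂ)} with hE
  have hpos : ∀ x ∈ E, 0 < x := fun x hx => pos_of_isEigenvalue hL hμ hμ1 (hIsub hx.1) hx.2
  have hroot : ∀ x ∈ E, secularNum L (μ * (2 - μ)) (√x) = 0 := by
    intro x hx
    have e : √x ^ 2 = x := Real.sq_sqrt (hpos x hx).le
    have h1 := hIsub hx.1
    have h2 := hx.2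
    rw [← e] at h1 h2
    exact (isEigenvalue_sq_iff hL hμ hμ1 (Real.sqrt_pos.2 (hpos x hx)) h1).1 h2
  have key : ∀ x ∈ E, ∀ y ∈ E, 0 < tanSign L (√x) * tanSign L (√y) → ¬ x < y := by
    intro x hx y hy hxy hlt
    have hx0 := hpos x hx
    refine not_lt_of_roots hL hν0 (fun w hw => ?_) (hroot x hx) (hroot y hy) hxy
      (Real.sqrt_lt_sqrt hx0.le hlt)
    have hw0 : 0 < w := (Real.sqrt_pos.2 hx0).trans_le hw.1
    refine ⟨hw0, hIsub (hord.out hx.1 hy.1 ⟨?_, ?_⟩)⟩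
    · exact (Real.sqrt_le_left hw0.le).1 hw.1
    · exact (Real.le_sqrt' hw0).1 hw.2
  have hsub : ∀ A ⊆ E, (∀ x ∈ A, ∀ y ∈ A, 0 < tanSign L (√x) * tanSign L (√y)) →
      A.Subsingleton := fun A hA h x hx y hy =>
    le_antisymm (not_lt.1 (key y (hA hy) x (hA hx) (h y hy x hx)))
      (not_lt.1 (key x (hA hx) y (hA hy) (h x hx y hy)))
  have hA : {x ∈ E | 0 < tanSign L (√x)}.Subsingleton :=
    hsub _ (sep_subset _ _) fun x hx y hy => mul_pos hx.2 hy.2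
  have hB : {x ∈ E | tanSign L (√x) < 0}.Subsingleton :=
    hsub _ (sep_subset _ _) fun x hx y hy => mul_pos_of_neg_of_neg hx.2 hy.2
  have hAB : E = {x ∈ E | 0 < tanSign L (√x)} ∪ {x ∈ E | tanSign L (√x) < 0} := by
    ext x
    refine ⟨fun hx => ?_, fun hx => hx.elim And.left And.left⟩
    have e : √x ^ 2 = x := Real.sq_sqrt (hpos x hx).le
    have hne := tanSign_ne_zero hν0 (Real.sqrt_pos.2 (hpos x hx))
      (by rw [e]; exact hIsub hx.1) (hroot x hx)
    rcases lt_or_gt_of_ne hne with h | h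
    · exact Or.inr ⟨hx, h⟩
    · exact Or.inl ⟨hx, h⟩
  have hfin : E.Finite := by
    rw [hAB]
    exact hA.finite.union hB.finite
  have hle : E.ncard ≤ 2 := by
    rw [hAB]
    refine (ncard_union_le _ _).trans ?_
    have := hA.finite.to_subtype
    have := hB.finite.to_subtype
    have h1 := ncard_le_one_iff_subsingleton.2 hA
    have h2 := ncard_le_one_iff_subsingleton.2 hB
    omega
  have hge : 0 < E.ncard := by
    obtain ⟨x, hx, hxe⟩ := exists_isEigenvalue_of_mem hL hμ hμ1 hl
    exact (ncard_pos hfin).2 ⟨x, hx, hxe⟩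
  omega

end

end LadderGraph

theorem mainTheorem4 (L μ : ℝ) (hL : 0 < L) (hμ : 0 < μ) :
    (1 ≤ μ →
      LinearPMap.discreteSpectrumPMap (LadderGraph.antisymmetricOperator L μ) = ∅) ∧
    (μ < 1 → ∀ I : Set ℝ,
      LinearPMap.IsSpectralGap (LadderGraph.antisymmetricOperator L μ) I →
        ({x ∈ I | LinearPMap.IsEigenvaluePMap
            (LadderGraph.antisymmetricOperator L μ) (x : ℂ)}.ncard = 1 ∨
          {x ∈ I | LinearPMap.IsEigenvaluePMap
            (LadderGraph.antisymmetricOperator L μ) (x : ℂ)}.ncard = 2) ∧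
        ∀ x ∈ I, LinearPMap.IsEigenvaluePMap
            (LadderGraph.antisymmetricOperator L μ) (x : ℂ) →
          Module.finrank ℂ (LinearPMap.eigenspacePMap
            (LadderGraph.antisymmetricOperator L μ) (x : ℂ)) = 1) := by
  refine ⟨LadderGraph.discreteSpectrum_eq_empty hL, fun hμ1 I hI => ?_⟩
  obtain ⟨l, hl, rfl⟩ := hI
  have e : {y : ℝ | (y : ℂ) ∉ LinearPMap.essentialSpectrumPMap
      (LadderGraph.antisymmetricOperator L μ)} = LadderGraph.resolventRegion L := by
    ext y
    rw [mem_ofPred_eq, LadderGraph.mem_essentialSpectrum_iff hL hμ, not_not]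
  rw [LadderGraph.mem_essentialSpectrum_iff hL hμ, not_not] at hl
  rw [e]
  exact ⟨LadderGraph.ncard_eigenvalues hL hμ hμ1 hl, fun x hx =>
    LadderGraph.finrank_eigenspace_eq_one hL hμ (connectedComponentIn_subset _ _ hx)⟩
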